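/- Let $\mathcal X,\mathcal Y,\mathcal U$ be Polish spaces with their Borel $\sigma$-fields, $\mathcal X$ nonempty and $\sigma$-compact, and let $T(dx'|x,u)$ be a stochastic kernel from $\mathcal X\times\mathcal U$ to $\mathcal X$ and $Q(dy|x)$ a stochastic kernel from $\mathcal X$ to $\mathcal Y$ (the measurement channel). An admissible policy $\gamma=(\gamma_n)_{n\ge 0}$ is a sequence of measurable maps that gives the actions $U_n=\gamma_n(Y_0,\dots,Y_n,U_0,\dots,U_{n-1})\in\mathcal U$. For a probability measure $\mu$ on $\mathcal X$ and a policy $\gamma$, let $P^{\mu,\gamma}$ be the law of $((X_n,Y_n))_{n\ge 0}$ for which $(X_0,Y_0)\sim Q(dy|x)\,\mu(dx)$ and, for $n\ge 1$, the conditional law of $(X_n,Y_n)$ given $(X,Y)_{[0,n-1]}$ is $Q(dy|x)\,T(dx|X_{n-1},U_{n-1})$; write $E^{\mu,\gamma}$ for its expectation. The filter is $\pi_n^{\mu,\gamma}=P^{\mu,\gamma}(X_n\in\cdot\mid Y_{[0,n]})$ and the predictor is $\pi_{n-}^{\mu,\gamma}=P^{\mu,\gamma}(X_n\in\cdot\mid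 Y_{[0,n-1]})$ (regular conditional distributions, regarded as functions of the measurement sequence). Let $\|P-P'\|_{TV}=\sup\{|\int f\,dP-\int f\,dP'| : f \text{ measurable},\ |f|\le 1\}$, and let $D(P\|P')=\int\log\frac{dP}{dP'}\,dP$ if $P\ll P'$ and $D(P\|P')=\infty$ otherwise. Fix a prior $\mu$. The filter is called *universally stable* in one of the following senses if for every admissible policy $\gamma$ and every probability measure $\nu$ on $\mathcal X$ with $\mu\ll\nu$, as $n\to\infty$: * *weak merging a.s.*: $P^{\mu,\gamma}$-a.s., $|\int f\,d\pi_n^{\mu,\gamma}-\int f\,d\pi_n^{\nu,\gamma}|\to 0$ for all bounded continuous $f:\mathcal X\to\mathbb R$; * *weak merging in expectation*: $E^{\mu,\gamma}\big[|\int f\,d\pi_n^{\mu,\gamma}-\int f\,d\pi_n^{\nu,\gamma}|\big]\to0$ for all bounded continuous $f:\mathcal X\to\mathbb R$; * *total variation in expectation*: $E^{\mu,\gamma}\big[\|\pi_n^{\mu,\gamma}-\pi_n^{\nu,\gamma}\|_{TV}\big]\to0$; * *total variation a.s.*: $\|\pi_n^{\mu,\gamma}-\pi_n^{\nu,\gamma}\|_{TV}\to0$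 $P^{\mu,\gamma}$-a.s.; * *relative entropy*: $E^{\mu,\gamma}\big[D(\pi_n^{\mu,\gamma}\|\pi_n^{\nu,\gamma})\big]\to0$. Universal stability of the predictor is defined in the same way with $\pi_{n-}$ in place of $\pi_n$. Then: (i) Suppose that $\|Q(\cdot|a_n)-Q(\cdot|a)\|_{TV}\to0$ whenever $a_n\to a$ in $\mathcal X$. If the predictor is universally stable in weak merging a.s., then the filter is universally stable in weak merging in expectation. (ii) The filter is universally stable in total variation in expectation if and only if the predictor is universally stable in total variation in expectation. (iii) The filter is universally stable in total variation in expectation if and only if it is universally stable in total variation a.s. (iv) Let $\mu\ll\nu$ and assume that for every admissible policy $\gamma$ there are some $n$ with $E^{\mu,\gamma}\big[D(\pi_n^{\mu,\gamma}\|\pi_n^{\nu,\gamma})\big]<\infty$ and some $m$ such that the relative entropy of the law of $Y_{[0,m]}$ under $P^{\mu,\gamma}$ with respect to its law under $P^{\nu,\gamma}$ is finite. Then $E^{\mu,\gamma}\big[D(\pi_n^{\mu,\gamma}\|\pi_n^{\nu,\gamma})\big]\to0$ for every policy $\gamma$ if and only if $E^{\mu,\gamma}\big[\|\pi_n^{\mu,\gamma}-\pi_n^{\nu,\gamma}\|_{TV}\big]\to0$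 for every policy $\gamma$. In particular, if the assumption holds for every $\nu$ with $\mu\ll\nu$, then the filter is universally stable in relative entropy if and only if it is universally stable in total variation in expectation. -/

import Mathlib

open MeasureTheory ProbabilityTheory Filter Topology
open scoped ENNReal BoundedContinuousFunction

noncomputable section

namespace POMDP

/-- The total variation norm `‖P - Q‖ = sup |∫ f dP - ∫ f dQ|` of the difference of two
probability measures, the supremum being over all measurable `f` with `|f| ≤ 1`. -/
def tvDist {α : Type*} [MeasurableSpace α] (P Q : Measure α) : ℝ≥0∞ :=
  ⨆ f : {f : α → ℝ // Measurable f ∧ ∀ x, |f x| ≤ 1},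
    ENNReal.ofReal |∫ x, f.1 x ∂P - ∫ x, f.1 x ∂Q|

/-- An admissible deterministic control policy: at time `n` the action is a measurable function
`γₙ(y₀, …, yₙ, u₀, …, uₙ₋₁)` of the measurements so far and of the past actions. -/
structure Policy (𝒴 𝒰 : Type*) [MeasurableSpace 𝒴] [MeasurableSpace 𝒰] where
  act : (n : ℕ) → (Fin (n + 1) → 𝒴) × (Fin n → 𝒰) → 𝒰
  measurable_act : ∀ n, Measurable (act n)

section Model

variable {𝒳 𝒴 𝒰 : Type*} [MeasurableSpace 𝒳] [MeasurableSpace 𝒴] [MeasurableSpace 𝒰]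

/-- The action `uₙ` that the policy applies at time `n` when the measurements are `y₀, …, yₙ`;
recursively `uₙ = γₙ(y₀, …, yₙ, u₀, …, uₙ₋₁)`. -/
def Policy.action (γ : Policy 𝒴 𝒰) (n : ℕ) (y : Fin (n + 1) → 𝒴) : 𝒰 :=
  γ.act n (y, fun k : Fin n =>
    γ.action k.1 fun i : Fin (k.1 + 1) => y ⟨i.1, i.2.trans (Nat.succ_lt_succ k.2)⟩)
termination_by n
decreasing_by exact k.2

theorem Policy.measurable_action (γ : Policy 𝒴 𝒰) (n : ℕ) : Measurable (γ.action n) := by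
  induction n using Nat.strong_induction_on with
  | _ n ih =>
    have h : γ.action n = fun y => γ.act n (y, fun k : Fin n =>
        γ.action k.1 fun i : Fin (k.1 + 1) => y ⟨i.1, i.2.trans (Nat.succ_lt_succ k.2)⟩) := by
      funext y
      rw [Policy.action]
    rw [h]
    refine (γ.measurable_act n).comp (measurable_id.prodMk (measurable_pi_lambda _ fun k => ?_))
    exact (ih k.1 k.2).comp (measurable_pi_lambda _ fun i => measurable_pi_apply _)

/-- From the state-measurement history up to time `n` to the pair `(xₙ, uₙ)`. -/
def stateAction (γ : Policy 𝒴 𝒰) (n : ℕ) (h : Finset.Iic n → 𝒳 × 𝒴) : 𝒳 × 𝒰 :=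
  ((h ⟨n, Finset.mem_Iic.2 le_rfl⟩).1,
    γ.action n fun i : Fin (n + 1) => (h ⟨i.1, Finset.mem_Iic.2 (Nat.lt_succ_iff.1 i.2)⟩).2)

theorem measurable_stateAction (γ : Policy 𝒴 𝒰) (n : ℕ) :
    Measurable (stateAction (𝒳 := 𝒳) γ n) := by
  refine (measurable_pi_apply _).fst.prodMk ((γ.measurable_action n).comp ?_)
  exact measurable_pi_lambda _ fun i => (measurable_pi_apply _).snd

/-- The conditional law of `(Xₙ₊₁, Yₙ₊₁)` given the history up to time `n`:
`(x₀, y₀, …, xₙ, yₙ) ↦ Q(dy | x) T(dx | xₙ, uₙ)`. -/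
def stepKernel (T : Kernel (𝒳 × 𝒰) 𝒳) (Q : Kernel 𝒳 𝒴) (γ : Policy 𝒴 𝒰) (n : ℕ) :
    Kernel (Finset.Iic n → 𝒳 × 𝒴) (𝒳 × 𝒴) :=
  (T ⊗ₖ Kernel.prodMkLeft (𝒳 × 𝒰) Q).comap (stateAction γ n) (measurable_stateAction γ n)

instance (T : Kernel (𝒳 × 𝒰) 𝒳) [IsMarkovKernel T] (Q : Kernel 𝒳 𝒴) [IsMarkovKernel Q]
    (γ : Policy 𝒴 𝒰) (n : ℕ) : IsMarkovKernel (stepKernel T Q γ n) := by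
  unfold stepKernel; infer_instance

variable (T : Kernel (𝒳 × 𝒰) 𝒳) [IsMarkovKernel T] (Q : Kernel 𝒳 𝒴) [IsMarkovKernel Q]

/-- The strategic measure `P^{μ,γ}` on sequences `((xₙ, yₙ))ₙ`: `(X₀, Y₀)` has law
`Q(dy | x) μ(dx)`, and `(Xₙ₊₁, Yₙ₊₁)` has conditional law `stepKernel T Q γ n` given the past. -/
def strategicMeasure (μ : ProbabilityMeasure 𝒳) (γ : Policy 𝒴 𝒰) : Measure (ℕ → 𝒳 × 𝒴) :=
  Kernel.trajMeasure (X := fun _ => 𝒳 × 𝒴) ((μ : Measure 𝒳) ⊗ₘ Q) (stepKernel T Q γ)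

instance (μ : ProbabilityMeasure 𝒳) (γ : Policy 𝒴 𝒰) :
    IsProbabilityMeasure (strategicMeasure T Q μ γ) := by
  unfold strategicMeasure; infer_instance

/-- The first `m` entries `(y₀, …, y_{m-1})` of a measurement sequence. -/
def history (m : ℕ) (y : ℕ → 𝒴) : Fin m → 𝒴 := fun i => y i

/-- The measurement sequence of a trajectory. -/
def measurements (ω : ℕ → 𝒳 × 𝒴) : ℕ → 𝒴 := fun n => (ω n).2

/-- The law of the measurement sequence `Y_{[0,∞)}` under `P^{μ,γ}`. -/
def measurementLaw (μ : ProbabilityMeasure 𝒳) (γ : Policy 𝒴 𝒰) : Measure (ℕ → 𝒴) :=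
  (strategicMeasure T Q μ γ).map measurements

/-- A regular conditional distribution `P^{μ,γ}(Xₙ ∈ · | Y₀, …, Y_{m-1})`, at a measurement
sequence `y`. -/
def condState [StandardBorelSpace 𝒳] [Nonempty 𝒳] (μ : ProbabilityMeasure 𝒳) (γ : Policy 𝒴 𝒰)
    (n m : ℕ) (y : ℕ → 𝒴) : Measure 𝒳 :=
  condDistrib (fun ω : ℕ → 𝒳 × 𝒴 => (ω n).1) (fun ω => history m (measurements ω))
    (strategicMeasure T Q μ γ) (history m y)

variable [StandardBorelSpace 𝒳] [Nonempty 𝒳]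

/-- The filter `πₙ^{μ,γ} = P^{μ,γ}(Xₙ ∈ · | Y_{[0,n]})`. -/
def filterAt (μ : ProbabilityMeasure 𝒳) (γ : Policy 𝒴 𝒰) (n : ℕ) (y : ℕ → 𝒴) : Measure 𝒳 :=
  condState T Q μ γ n (n + 1) y

/-- The one step predictor `πₙ₋^{μ,γ} = P^{μ,γ}(Xₙ ∈ · | Y_{[0,n-1]})`. -/
def predictorAt (μ : ProbabilityMeasure 𝒳) (γ : Policy 𝒴 𝒰) (n : ℕ) (y : ℕ → 𝒴) : Measure 𝒳 :=
  condState T Q μ γ n n y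

end Model

/-! ### Merging notions, for a pair of sequences of random measures

`p n y` and `r n y` are random probability measures, functions of the measurement sequence `y`,
whose law is `L`. -/

section Merging

variable {𝒳 𝒴 : Type*} [MeasurableSpace 𝒳] [MeasurableSpace 𝒴]

/-- Weak merging almost surely: off one null set, `|∫ f dpₙ - ∫ f drₙ| → 0` for all `f ∈ C_b`. -/
def WeakMergeAS [TopologicalSpace 𝒳] (L : Measure (ℕ → 𝒴)) (p r : ℕ → (ℕ → 𝒴) → Measure 𝒳) :
    Prop :=
  ∀ᵐ y ∂L, ∀ f : 𝒳 →ᵇ ℝ,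
    Tendsto (fun n => |∫ x, f x ∂(p n y) - ∫ x, f x ∂(r n y)|) atTop (𝓝 0)

/-- Weak merging in expectation: `E |∫ f dpₙ - ∫ f drₙ| → 0` for every `f ∈ C_b`. -/
def WeakMergeExp [TopologicalSpace 𝒳] (L : Measure (ℕ → 𝒴)) (p r : ℕ → (ℕ → 𝒴) → Measure 𝒳) :
    Prop :=
  ∀ f : 𝒳 →ᵇ ℝ, Tendsto
    (fun n => ∫⁻ y, ENNReal.ofReal |∫ x, f x ∂(p n y) - ∫ x, f x ∂(r n y)| ∂L) atTop (𝓝 0)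

/-- Merging in total variation in expectation: `E ‖pₙ - rₙ‖ → 0`. -/
def TVMergeExp (L : Measure (ℕ → 𝒴)) (p r : ℕ → (ℕ → 𝒴) → Measure 𝒳) : Prop :=
  Tendsto (fun n => ∫⁻ y, tvDist (p n y) (r n y) ∂L) atTop (𝓝 0)

/-- Merging in total variation almost surely. -/
def TVMergeAS (L : Measure (ℕ → 𝒴)) (p r : ℕ → (ℕ → 𝒴) → Measure 𝒳) : Prop :=
  ∀ᵐ y ∂L, Tendsto (fun n => tvDist (p n y) (r n y)) atTop (𝓝 0)

/-- Merging in relative entropy: `E D(pₙ ‖ rₙ) → 0`. -/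
def EntropyMerge (L : Measure (ℕ → 𝒴)) (p r : ℕ → (ℕ → 𝒴) → Measure 𝒳) : Prop :=
  Tendsto (fun n => ∫⁻ y, InformationTheory.klDiv (p n y) (r n y) ∂L) atTop (𝓝 0)

end Merging

/-! ### Universal stability: for every policy and every prior `ν` with `μ ≪ ν` -/

section Stability

variable {𝒳 𝒴 𝒰 : Type*} [MeasurableSpace 𝒳] [MeasurableSpace 𝒴] [MeasurableSpace 𝒰]
  [StandardBorelSpace 𝒳] [Nonempty 𝒳]
  (T : Kernel (𝒳 × 𝒰) 𝒳) [IsMarkovKernel T] (Q : Kernel 𝒳 𝒴) [IsMarkovKernel Q]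
  (μ : ProbabilityMeasure 𝒳)

def PredictorStableWeakAS [TopologicalSpace 𝒳] : Prop :=
  ∀ (γ : Policy 𝒴 𝒰) (ν : ProbabilityMeasure 𝒳), (μ : Measure 𝒳) ≪ ν →
    WeakMergeAS (measurementLaw T Q μ γ) (predictorAt T Q μ γ) (predictorAt T Q ν γ)

def FilterStableWeakExp [TopologicalSpace 𝒳] : Prop :=
  ∀ (γ : Policy 𝒴 𝒰) (ν : ProbabilityMeasure 𝒳), (μ : Measure 𝒳) ≪ ν →
    WeakMergeExp (measurementLaw T Q μ γ) (filterAt T Q μ γ) (filterAt T Q ν γ)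

def PredictorStableTVExp : Prop :=
  ∀ (γ : Policy 𝒴 𝒰) (ν : ProbabilityMeasure 𝒳), (μ : Measure 𝒳) ≪ ν →
    TVMergeExp (measurementLaw T Q μ γ) (predictorAt T Q μ γ) (predictorAt T Q ν γ)

def FilterStableTVExp : Prop :=
  ∀ (γ : Policy 𝒴 𝒰) (ν : ProbabilityMeasure 𝒳), (μ : Measure 𝒳) ≪ ν →
    TVMergeExp (measurementLaw T Q μ γ) (filterAt T Q μ γ) (filterAt T Q ν γ)

def FilterStableTVAS : Prop :=
  ∀ (γ : Policy 𝒴 𝒰) (ν : ProbabilityMeasure 𝒳), (μ : Measure 𝒳) ≪ ν →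
    TVMergeAS (measurementLaw T Q μ γ) (filterAt T Q μ γ) (filterAt T Q ν γ)

def FilterStableEntropy : Prop :=
  ∀ (γ : Policy 𝒴 𝒰) (ν : ProbabilityMeasure 𝒳), (μ : Measure 𝒳) ≪ ν →
    EntropyMerge (measurementLaw T Q μ γ) (filterAt T Q μ γ) (filterAt T Q ν γ)

/-- For every policy `γ`, the expected relative entropy `E^{μ,γ} D(πₙ^{μ,γ} ‖ πₙ^{ν,γ})` is finite
for some `n`, and the relative entropy between the laws of `Y_{[0,m]}` under `P^{μ,γ}` and
`P^{ν,γ}` is finite for some `m`. -/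
def FiniteEntropies (ν : ProbabilityMeasure 𝒳) : Prop :=
  ∀ γ : Policy 𝒴 𝒰,
    (∃ n : ℕ, ∫⁻ y, InformationTheory.klDiv (filterAt T Q μ γ n y) (filterAt T Q ν γ n y)
      ∂(measurementLaw T Q μ γ) < ∞) ∧
    (∃ m : ℕ, InformationTheory.klDiv ((measurementLaw T Q μ γ).map (history (m + 1)))
      ((measurementLaw T Q ν γ).map (history (m + 1))) < ∞)

end Stability

/-- The measurement channel is continuous in total variation. -/
def ChannelTVContinuous {𝒳 𝒴 : Type*} [MeasurableSpace 𝒳] [MeasurableSpace 𝒴]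
    [TopologicalSpace 𝒳] (Q : Kernel 𝒳 𝒴) : Prop :=
  ∀ (a : ℕ → 𝒳) (a₀ : 𝒳), Tendsto a atTop (𝓝 a₀) →
    Tendsto (fun n => tvDist (Q (a n)) (Q a₀)) atTop (𝓝 0)

end POMDP

end

/-!
Fix `μ ≪ ν`, a policy `γ`, and write `P ≪ P₀` for the strategic measures of the two priors and
`ρ = dP/dP₀`. For a statistic `Y` of the trajectory the conditional laws of a variable `X` given
`Y` under `P` and `P₀` are compared through the identity (`abs_condExp_sub_condExp_eq`)

  `|E₀[ρ | Y, X] - E₀[ρ | Y]| = E₀[ρ | Y] · |dκ/dη - 1|`,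

where `κ` and `η` are these conditional laws. Hence expected total variation distances are
`L¹(P₀)` distances of conditional expectations of `ρ` (`lintegral_tvKernel_eq`), and there is a
conditional version of this (`condExp_abs_sub_eq_mul_tvKernel`).

* *Filter and predictor in total variation* (`tvMergeExp_filter_iff_predictor`). The measurement
  `Yₙ` is drawn from `Xₙ` through the same channel under both laws, so that `E₀[ρ | Y₀, …, Yₙ, Xₙ]`
  and `E₀[ρ | Y₀, …, Yₙ₋₁, Xₙ]` coincide. The two distances are therefore those of one and the same
  variable from two consecutive terms of the martingale `E₀[ρ | Y₀, …, Yₙ]`, which converges in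
  `L¹`.
* *Almost sure total variation* (`TVMergeExp.tvMergeAS`). By the Markov property
  (`condExp_forget_eq`), `E₀[ρ | Y₀, …, Yₙ, Xₙ]` is the conditional expectation of `ρ` given all
  measurements and the states from time `n` on. This information decreases in `n` and always
  contains all measurements, so that given the measurements its distance from
  `E₀[ρ | Y₀, Y₁, …]` decreases; a decreasing sequence tending to `0` in `L¹` does so almost surely
  (`ae_tendsto_condExp_abs_sub`). One divides by `E₀[ρ | Y₀, …, Yₙ]`, whose limit is positive
  `P`-almost surely.
* *Relative entropy* (`TVMergeExp.entropyMerge`, `EntropyMerge.tvMergeExp`). Let the expected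
  entropy of the filter be finite at time `n`. Replacing `P₀` by its reweighting under which
  `Y₀, …, Yₙ` have the law that they have under `P` changes no conditional law from time `n` on, and
  makes the relative entropy of `(Y₀, …, Yₙ, Xₙ)` finite. By the Markov property, so are then the
  relative entropies of all later `(Y₀, …, Yₖ, Xₖ)` and `(Y₀, …, Yₖ)`, uniformly. By the chain rule
  the expected entropy of the filter is the difference of these two. If the filters merge in total
  variation, then the densities of both converge in `L¹` to the same limit, and by Jensen's
  inequality their entropies are uniformly integrable, so that the difference tends to `0`
  (`tendsto_integral_klFun_condExp`). The converse is Pinsker's inequality.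
* *Weak merging* (`WeakMergeAS.weakMergeExp`). The expected distance `E |πₙ^μ f - πₙ^ν f|` is the
  expectation of the difference of the integrals, against the two predictors, of a bounded function
  of `x`, which depends on `x` only through `f x` and the channel `Q(· | x)`
  (`integral_abs_filterMean_sub`). These functions vary with `n` and with the measurements, but
  if `(wⱼ)` is a partition of unity on whose pieces `f` and the channel oscillate little, then they
  are all close to combinations `∑ cⱼ wⱼ` with uniformly bounded coefficients, and weakly merging
  laws merge uniformly over all such combinations by Schur's lemma in `ℓ¹`
  (`tendsto_tsum_abs_of_forall_tendsto`).
-/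

noncomputable section

set_option linter.unusedSectionVars false

namespace POMDP

/-! ### Total variation and relative entropy in terms of densities -/

section Divergences

variable {α : Type*} [MeasurableSpace α]

theorem tvDist_le_two (P Q : Measure α) [IsProbabilityMeasure P] [IsProbabilityMeasure Q] :
    tvDist P Q ≤ 2 := by
  refine iSup_le fun f => ?_
  have bound (P₀ : Measure α) [IsProbabilityMeasure P₀] : ‖∫ x, f.1 x ∂P₀‖ ≤ 1 := by
    have := norm_integral_le_of_norm_le_const (μ := P₀) (f := f.1) (C := 1)
      (ae_of_all _ fun x => f.2.2 x)
    simpa using this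
  rw [show (2 : ℝ≥0∞) = ENNReal.ofReal 2 by simp]
  refine ENNReal.ofReal_le_ofReal ((norm_sub_le (∫ x, f.1 x ∂P) (∫ x, f.1 x ∂Q)).trans ?_)
  linarith [bound P, bound Q]

theorem abs_integral_sub_le_tvDist (P Q : Measure α) {f : α → ℝ} (hf : Measurable f)
    (h1 : ∀ x, |f x| ≤ 1) :
    ENNReal.ofReal |∫ x, f x ∂P - ∫ x, f x ∂Q| ≤ tvDist P Q :=
  le_iSup (fun f : {f : α → ℝ // Measurable f ∧ ∀ x, |f x| ≤ 1} =>
    ENNReal.ofReal |∫ x, f.1 x ∂P - ∫ x, f.1 x ∂Q|) ⟨f, hf, h1⟩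

/-- The total variation distance is the `L¹` distance of the density from `1`. -/
theorem tvDist_eq_lintegral_rnDeriv {P Q : Measure α} [IsProbabilityMeasure P]
    [IsProbabilityMeasure Q] (h : P ≪ Q) :
    tvDist P Q = ∫⁻ x, ENNReal.ofReal |(P.rnDeriv Q x).toReal - 1| ∂Q := by
  set d : α → ℝ := fun x => (P.rnDeriv Q x).toReal with hd
  have hdm : Measurable d := (Measure.measurable_rnDeriv P Q).ennreal_toReal
  have hdi : Integrable d Q := Measure.integrable_toReal_rnDeriv
  have hint : Integrable (fun x => |d x - 1|) Q := (hdi.sub (integrable_const 1)).abs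
  have key (f : α → ℝ) (hf : Measurable f) (h1 : ∀ x, |f x| ≤ 1) :
      ∫ x, f x ∂P - ∫ x, f x ∂Q = ∫ x, (d x - 1) * f x ∂Q := by
    rw [← integral_rnDeriv_smul h, ← integral_sub]
    · simp only [smul_eq_mul, hd]
      congr with x
      ring
    · exact hdi.mul_bdd (c := 1) hf.aestronglyMeasurable (ae_of_all _ h1)
    · exact Integrable.of_bound hf.aestronglyMeasurable 1 (ae_of_all _ h1)
  rw [← ofReal_integral_eq_lintegral_ofReal hint (ae_of_all _ fun x => abs_nonneg _)]
  refine le_antisymm (iSup_le fun f => ENNReal.ofReal_le_ofReal ?_) ?_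
  · rw [key f.1 f.2.1 f.2.2]
    refine (abs_integral_le_integral_abs).trans (integral_mono_of_nonneg
      (ae_of_all _ fun x => abs_nonneg _) hint (ae_of_all _ fun x => ?_))
    simp only [abs_mul]
    exact mul_le_of_le_one_right (abs_nonneg _) (f.2.2 x)
  · -- the supremum is attained at the sign of `dP/dQ - 1`
    let f : α → ℝ := fun x => if 1 ≤ d x then 1 else -1
    have hf : Measurable f :=
      Measurable.ite (measurableSet_le measurable_const hdm) measurable_const measurable_const
    have h1 : ∀ x, |f x| ≤ 1 := fun x => by
      by_cases hx : 1 ≤ d x <;> simp [f, hx]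
    refine le_trans (ENNReal.ofReal_le_ofReal ?_) (abs_integral_sub_le_tvDist P Q hf h1)
    rw [key f hf h1]
    refine le_trans (le_of_eq (integral_congr_ae (ae_of_all _ fun x => ?_))) (le_abs_self _)
    by_cases hx : 1 ≤ d x
    · simp [f, hx]
    · simp only [f, hx, if_false, mul_neg, mul_one]
      exact abs_of_neg (by linarith [not_le.1 hx])

/-- Young's inequality for `klFun`: its convex conjugate is `a ↦ eᵃ - 1`. -/
theorem mul_sub_one_le_klFun {t : ℝ} (ht : 0 ≤ t) (a : ℝ) :
    a * (t - 1) ≤ InformationTheory.klFun t + (Real.exp a - 1 - a) := by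
  rw [InformationTheory.klFun_apply]
  rcases ht.eq_or_lt with rfl | ht
  · simp only [zero_mul]
    linarith [Real.exp_pos a]
  · have h := mul_le_mul_of_nonneg_left (Real.add_one_le_exp (a - Real.log t)) ht.le
    rw [Real.exp_sub, Real.exp_log ht, mul_div_cancel₀ _ ht.ne'] at h
    nlinarith

theorem mul_abs_sub_one_le_klFun {t : ℝ} (ht : 0 ≤ t) {δ : ℝ} (h0 : 0 ≤ δ) (h1 : δ ≤ 1) :
    δ * |t - 1| ≤ InformationTheory.klFun t + δ ^ 2 := by
  have key (a : ℝ) (ha : |a| ≤ 1) : Real.exp a - 1 - a ≤ a ^ 2 :=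
    (le_abs_self _).trans (Real.abs_exp_sub_one_sub_id_le ha)
  rcases abs_cases (t - 1) with ⟨h, -⟩ | ⟨h, -⟩ <;> rw [h]
  · have h2 := key δ (by rwa [abs_of_nonneg h0])
    linarith [mul_sub_one_le_klFun ht δ]
  · have h2 := key (-δ) (by rwa [abs_neg, abs_of_nonneg h0])
    have h3 := mul_sub_one_le_klFun ht (-δ)
    nlinarith

/-- A linearised form of Pinsker's inequality. -/
theorem mul_tvDist_le_klDiv (P Q : Measure α) [IsProbabilityMeasure P] [IsProbabilityMeasure Q]
    {δ : ℝ} (h0 : 0 ≤ δ) (h1 : δ ≤ 1) :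
    ENNReal.ofReal δ * tvDist P Q ≤ InformationTheory.klDiv P Q + ENNReal.ofReal (δ ^ 2) := by
  by_cases h : P ≪ Q
  · rw [InformationTheory.klDiv_eq_lintegral_klFun_of_ac h, tvDist_eq_lintegral_rnDeriv h,
      ← lintegral_const_mul _ (by fun_prop)]
    calc ∫⁻ x, ENNReal.ofReal δ * ENNReal.ofReal |(P.rnDeriv Q x).toReal - 1| ∂Q
        ≤ ∫⁻ x, (ENNReal.ofReal (InformationTheory.klFun (P.rnDeriv Q x).toReal)
            + ENNReal.ofReal (δ ^ 2)) ∂Q := by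
          refine lintegral_mono fun x => ?_
          rw [← ENNReal.ofReal_mul h0, ← ENNReal.ofReal_add
            (InformationTheory.klFun_nonneg ENNReal.toReal_nonneg) (sq_nonneg δ)]
          exact ENNReal.ofReal_le_ofReal (mul_abs_sub_one_le_klFun ENNReal.toReal_nonneg h0 h1)
      _ = _ := by rw [lintegral_add_right _ measurable_const]; simp
  · simp [InformationTheory.klDiv_of_not_ac h]

end Divergences

/-! ### Disintegrated densities -/

theorem withDensity_compProd {E S : Type*} [MeasurableSpace E] [MeasurableSpace S]
    {r : Measure E} [IsFiniteMeasure r] {η : Kernel E S}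
    [IsMarkovKernel η] {n : E → ℝ≥0∞} (hn : Measurable n) [IsFiniteMeasure (r.withDensity n)] :
    (r.withDensity n) ⊗ₘ η = (r ⊗ₘ η).withDensity fun z => n z.1 := by
  refine Measure.ext_of_lintegral _ fun f hf => ?_
  rw [Measure.lintegral_compProd hf, lintegral_withDensity_eq_lintegral_mul _ hn
      hf.lintegral_kernel_prod_right',
    lintegral_withDensity_eq_lintegral_mul _ (f := fun z => n z.1) (by fun_prop) hf,
    Measure.lintegral_compProd (f := (fun z : E × S => n z.1) * f)
      ((hn.comp measurable_fst).mul hf)]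
  refine lintegral_congr fun y => ?_
  simp only [Pi.mul_apply]
  exact (lintegral_const_mul _ (by fun_prop)).symm

section Disintegration

variable {E S : Type*} [MeasurableSpace E] [MeasurableSpace S] [StandardBorelSpace S]

/-- The total variation distance of two kernels at a point of the base, written with the jointly
measurable density of one kernel with respect to the other, and hence measurable in the point. It
is the distance only where `κ y ≪ η y`. -/
def tvKernel (κ η : Kernel E S) (y : E) : ℝ≥0∞ :=
  ∫⁻ x, ENNReal.ofReal |(Kernel.rnDeriv κ η y x).toReal - 1| ∂(η y)

theorem measurable_tvKernel (κ η : Kernel E S) [IsMarkovKernel η] : Measurable (tvKernel κ η) := by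
  refine Measurable.lintegral_kernel_prod_right ?_
  have := Kernel.measurable_rnDeriv κ η
  fun_prop

theorem tvKernel_eq_tvDist {κ η : Kernel E S} [IsMarkovKernel κ] [IsMarkovKernel η] {y : E}
    (h : κ y ≪ η y) : tvKernel κ η y = tvDist (κ y) (η y) := by
  rw [tvDist_eq_lintegral_rnDeriv h]
  refine lintegral_congr_ae ?_
  filter_upwards [Kernel.rnDeriv_eq_rnDeriv_measure (κ := κ) (η := η) (a := y)] with x hx
  rw [hx]

/-- The relative entropy of two kernels at a point of the base, written with their jointly
measurable density. It is the relative entropy only where `κ y ≪ η y`. -/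
def klKernel (κ η : Kernel E S) (y : E) : ℝ≥0∞ :=
  ∫⁻ x, ENNReal.ofReal (InformationTheory.klFun (Kernel.rnDeriv κ η y x).toReal) ∂(η y)

theorem measurable_klKernel (κ η : Kernel E S) [IsMarkovKernel η] : Measurable (klKernel κ η) := by
  refine Measurable.lintegral_kernel_prod_right ?_
  have := Kernel.measurable_rnDeriv κ η
  fun_prop

theorem klKernel_eq_klDiv {κ η : Kernel E S} [IsMarkovKernel κ] [IsMarkovKernel η] {y : E}
    (h : κ y ≪ η y) : klKernel κ η y = InformationTheory.klDiv (κ y) (η y) := by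
  rw [InformationTheory.klDiv_eq_lintegral_klFun_of_ac h]
  refine lintegral_congr_ae ?_
  filter_upwards [Kernel.rnDeriv_eq_rnDeriv_measure (κ := κ) (η := η) (a := y)] with x hx
  rw [hx]

theorem compProd_eq_withDensity_rnDeriv {p : Measure E} [IsFiniteMeasure p] {κ η : Kernel E S}
    [IsMarkovKernel κ] [IsMarkovKernel η] (h : ∀ᵐ y ∂p, κ y ≪ η y) :
    p ⊗ₘ κ = (p ⊗ₘ η).withDensity fun z => Kernel.rnDeriv κ η z.1 z.2 := by
  rw [← Measure.compProd_withDensity (f := Kernel.rnDeriv κ η) (Kernel.measurable_rnDeriv κ η)]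
  refine Measure.compProd_congr ?_
  filter_upwards [h] with y hy
  exact (Kernel.withDensity_rnDeriv_eq hy).symm

theorem klDiv_compProd_eq_lintegral {p : Measure E} [IsFiniteMeasure p] {κ η : Kernel E S}
    [IsMarkovKernel κ] [IsMarkovKernel η] (h : ∀ᵐ y ∂p, κ y ≪ η y) :
    InformationTheory.klDiv (p ⊗ₘ κ) (p ⊗ₘ η) = ∫⁻ y, klKernel κ η y ∂p := by
  have hm := Kernel.measurable_rnDeriv κ η
  have hac : p ⊗ₘ κ ≪ p ⊗ₘ η := Measure.absolutelyContinuous_compProd_right_iff.2 h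
  rw [InformationTheory.klDiv_eq_lintegral_klFun_of_ac hac]
  have : (p ⊗ₘ κ).rnDeriv (p ⊗ₘ η) =ᵐ[p ⊗ₘ η] fun z => Kernel.rnDeriv κ η z.1 z.2 := by
    rw [compProd_eq_withDensity_rnDeriv h]
    exact Measure.rnDeriv_withDensity _ hm
  rw [lintegral_congr_ae (g := fun z => ENNReal.ofReal
      (InformationTheory.klFun (Kernel.rnDeriv κ η z.1 z.2).toReal)),
    Measure.lintegral_compProd (by fun_prop)]
  · rfl
  · filter_upwards [this] with z hz
    rw [hz]

/-- The joint density is the density of the first marginals times the density of the kernels. -/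
theorem rnDeriv_compProd_eq_mul {p r : Measure E} [IsFiniteMeasure p] [IsFiniteMeasure r]
    {κ η : Kernel E S} [IsMarkovKernel κ] [IsMarkovKernel η] (hpr : p ≪ r)
    (h : ∀ᵐ y ∂p, κ y ≪ η y) :
    (p ⊗ₘ κ).rnDeriv (r ⊗ₘ η) =ᵐ[r ⊗ₘ η]
      fun z => p.rnDeriv r z.1 * Kernel.rnDeriv κ η z.1 z.2 := by
  have hm := Kernel.measurable_rnDeriv κ η
  have hn := Measure.measurable_rnDeriv p r
  have : p ⊗ₘ κ = (r ⊗ₘ η).withDensity fun z => p.rnDeriv r z.1 * Kernel.rnDeriv κ η z.1 z.2 := by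
    have h2 : p ⊗ₘ η = (r ⊗ₘ η).withDensity fun z => p.rnDeriv r z.1 := by
      conv_lhs => rw [← Measure.withDensity_rnDeriv_eq p r hpr]
      have : IsFiniteMeasure (r.withDensity (p.rnDeriv r)) := by
        rw [Measure.withDensity_rnDeriv_eq p r hpr]; infer_instance
      exact withDensity_compProd hn
    rw [compProd_eq_withDensity_rnDeriv h, h2, ← withDensity_mul _
      (f := fun z : E × S => p.rnDeriv r z.1) (hn.comp measurable_fst) hm]
    rfl
  rw [this]
  exact Measure.rnDeriv_withDensity _ ((hn.comp measurable_fst).mul hm)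

theorem ae_absolutelyContinuous_of_map_eq_compProd {Ω : Type*}
    [MeasurableSpace Ω] {P P₀ : Measure Ω} [IsProbabilityMeasure P] {X : Ω → S} {Y : Ω → E}
    {κ η : Kernel E S} [IsMarkovKernel κ] [IsMarkovKernel η] (hPP : P ≪ P₀) (hX : Measurable X)
    (hY : Measurable Y) (hκ : P.map (fun ω => (Y ω, X ω)) = P.map Y ⊗ₘ κ)
    (hη : P₀.map (fun ω => (Y ω, X ω)) = P₀.map Y ⊗ₘ η) : ∀ᵐ y ∂(P.map Y), κ y ≪ η y := by
  refine Measure.AbsolutelyContinuous.kernel_of_compProd (ν := P₀.map Y) ?_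
  rw [← hκ, ← hη]
  exact hPP.map (hY.prodMk hX)

variable {Ω : Type*} [mΩ : MeasurableSpace Ω] {P P₀ : Measure Ω} [IsProbabilityMeasure P]
  [IsProbabilityMeasure P₀] {X : Ω → S} {Y : Ω → E} {κ η : Kernel E S} [IsMarkovKernel κ]
  [IsMarkovKernel η]

/-- The density of `P` with respect to `P₀` on `σ(Y, X)` differs from the density on `σ(Y)` by
the factor `dκ/dη`, where `κ` and `η` are the conditional laws of `X` given `Y`. -/
theorem abs_condExp_sub_condExp_eq (hPP : P ≪ P₀) (hX : Measurable X)
    (hY : Measurable Y) (hκ : P.map (fun ω => (Y ω, X ω)) = P.map Y ⊗ₘ κ)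
    (hη : P₀.map (fun ω => (Y ω, X ω)) = P₀.map Y ⊗ₘ η) :
    (fun ω => |(P₀[fun ω => (P.rnDeriv P₀ ω).toReal |
        MeasurableSpace.comap (fun ω => (Y ω, X ω)) inferInstance]) ω
      - (P₀[fun ω => (P.rnDeriv P₀ ω).toReal | MeasurableSpace.comap Y inferInstance]) ω|)
    =ᵐ[P₀] fun ω => ((P.map Y).rnDeriv (P₀.map Y) (Y ω)).toReal
      * |(Kernel.rnDeriv κ η (Y ω) (X ω)).toReal - 1| := by
  have hac := ae_absolutelyContinuous_of_map_eq_compProd hPP hX hY hκ hη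
  have h1 := toReal_rnDeriv_map hPP (hY.prodMk hX)
  have h2 := toReal_rnDeriv_map hPP hY
  have h3 := rnDeriv_compProd_eq_mul (hPP.map hY) hac
  rw [← hκ, ← hη] at h3
  have h4 := ae_of_ae_map (hY.prodMk hX).aemeasurable h3
  filter_upwards [h1, h2, h4] with ω h1 h2 h4
  rw [← h1, ← h2, h4, ENNReal.toReal_mul, ← mul_sub_one, abs_mul,
    abs_of_nonneg ENNReal.toReal_nonneg]

/-- The expected total variation distance between the conditional laws of `X` given `Y` is the
`L¹(P₀)` distance between the densities on `σ(Y, X)` and `σ(Y)`. -/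
theorem lintegral_tvKernel_eq (hPP : P ≪ P₀) (hX : Measurable X)
    (hY : Measurable Y) (hκ : P.map (fun ω => (Y ω, X ω)) = P.map Y ⊗ₘ κ)
    (hη : P₀.map (fun ω => (Y ω, X ω)) = P₀.map Y ⊗ₘ η) :
    ∫⁻ y, tvKernel κ η y ∂(P.map Y) =
      ∫⁻ ω, ENNReal.ofReal |(P₀[fun ω => (P.rnDeriv P₀ ω).toReal |
        MeasurableSpace.comap (fun ω => (Y ω, X ω)) inferInstance]) ω
      - (P₀[fun ω => (P.rnDeriv P₀ ω).toReal | MeasurableSpace.comap Y inferInstance]) ω| ∂P₀ := by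
  have hm := Kernel.measurable_rnDeriv κ η
  have hn := Measure.measurable_rnDeriv (P.map Y) (P₀.map Y)
  have hfin : ∀ᵐ ω ∂P₀, (P.map Y).rnDeriv (P₀.map Y) (Y ω) ≠ ∞ :=
    ae_of_ae_map hY.aemeasurable (Measure.rnDeriv_ne_top _ _)
  have : (fun ω => ENNReal.ofReal |(P₀[fun ω => (P.rnDeriv P₀ ω).toReal |
        MeasurableSpace.comap (fun ω => (Y ω, X ω)) inferInstance]) ω
      - (P₀[fun ω => (P.rnDeriv P₀ ω).toReal | MeasurableSpace.comap Y inferInstance]) ω|)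
      =ᵐ[P₀] fun ω => (P.map Y).rnDeriv (P₀.map Y) (Y ω)
        * ENNReal.ofReal |(Kernel.rnDeriv κ η (Y ω) (X ω)).toReal - 1| := by
    filter_upwards [abs_condExp_sub_condExp_eq hPP hX hY hκ hη, hfin] with ω h1 h2
    rw [h1, ENNReal.ofReal_mul ENNReal.toReal_nonneg, ENNReal.ofReal_toReal h2]
  rw [lintegral_congr_ae this]
  have h5 : Measurable fun z : E × S => (P.map Y).rnDeriv (P₀.map Y) z.1
        * ENNReal.ofReal |(Kernel.rnDeriv κ η z.1 z.2).toReal - 1| :=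
    (hn.comp measurable_fst).mul (by fun_prop)
  rw [← lintegral_map (f := fun z : E × S => (P.map Y).rnDeriv (P₀.map Y) z.1
        * ENNReal.ofReal |(Kernel.rnDeriv κ η z.1 z.2).toReal - 1|) h5 (hY.prodMk hX), hη,
    Measure.lintegral_compProd h5]
  conv_lhs => rw [← Measure.withDensity_rnDeriv_eq _ _ (hPP.map hY)]
  rw [lintegral_withDensity_eq_lintegral_mul _ hn (measurable_tvKernel κ η)]
  refine lintegral_congr fun y => ?_
  simp only [Pi.mul_apply, tvKernel]
  exact (lintegral_const_mul _ (by fun_prop)).symm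

/-- The conditional version of `lintegral_tvKernel_eq`. -/
theorem condExp_abs_sub_eq_mul_tvKernel [Nonempty S] (hPP : P ≪ P₀) (hX : Measurable X)
    (hY : Measurable Y) (hκ : P.map (fun ω => (Y ω, X ω)) = P.map Y ⊗ₘ κ)
    (hη : P₀.map (fun ω => (Y ω, X ω)) = P₀.map Y ⊗ₘ η) :
    P₀[fun ω => |(P₀[fun ω => (P.rnDeriv P₀ ω).toReal |
        MeasurableSpace.comap (fun ω => (Y ω, X ω)) inferInstance]) ω
      - (P₀[fun ω => (P.rnDeriv P₀ ω).toReal | MeasurableSpace.comap Y inferInstance]) ω| |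
        MeasurableSpace.comap Y inferInstance]
    =ᵐ[P₀] fun ω => (P₀[fun ω => (P.rnDeriv P₀ ω).toReal | MeasurableSpace.comap Y inferInstance]) ω
      * (tvKernel κ η (Y ω)).toReal := by
  have hm := Kernel.measurable_rnDeriv κ η
  have hn := Measure.measurable_rnDeriv (P.map Y) (P₀.map Y)
  have h1 := abs_condExp_sub_condExp_eq hPP hX hY hκ hη
  let f : E × S → ℝ := fun z => ((P.map Y).rnDeriv (P₀.map Y) z.1).toReal
    * |(Kernel.rnDeriv κ η z.1 z.2).toReal - 1|
  have hf : Measurable f := (hn.comp measurable_fst).ennreal_toReal.mul (by fun_prop)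
  have hfi : Integrable (fun ω => f (Y ω, X ω)) P₀ :=
    (integrable_condExp.sub integrable_condExp).abs.congr h1
  have h2 := condExp_prod_ae_eq_integral_condDistrib hY hX.aemeasurable hf.stronglyMeasurable hfi
  have h3 := ae_of_ae_map hY.aemeasurable
    (condDistrib_ae_eq_of_measure_eq_compProd Y hX.aemeasurable hη)
  filter_upwards [condExp_congr_ae h1, h2, h3, toReal_rnDeriv_map hPP hY] with ω h1 h2 h3 h4
  rw [h1, h2, h3, ← h4]
  simp only [f]
  rw [integral_const_mul, integral_eq_lintegral_of_nonneg_ae (ae_of_all _ fun _ => abs_nonneg _)]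
  · rfl
  · exact (Measurable.aestronglyMeasurable (by fun_prop))

end Disintegration

/-! ### Conditional expectations along increasing and decreasing information -/

section Martingales

variable {Ω : Type*} {m0 : MeasurableSpace Ω} {P : Measure Ω} [IsProbabilityMeasure P]

theorem tendsto_integral_abs_sub_iff {Ω : Type*} {_ : MeasurableSpace Ω} {P : Measure Ω}
    {f : ℕ → Ω → ℝ} {g : Ω → ℝ} (hf : ∀ k, Integrable (f k) P)
    (hg : Integrable g P) :
    Tendsto (fun k => ∫ ω, |f k ω - g ω| ∂P) atTop (𝓝 0) ↔
      Tendsto (fun k => eLpNorm (f k - g) 1 P) atTop (𝓝 0) := by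
  have h (k : ℕ) : eLpNorm (f k - g) 1 P = ENNReal.ofReal (∫ ω, |f k ω - g ω| ∂P) := by
    have hi : Integrable (fun ω => |f k ω - g ω|) P := ((hf k).sub hg).abs
    rw [eLpNorm_one_eq_lintegral_enorm, ofReal_integral_eq_lintegral_ofReal hi
      (ae_of_all _ fun _ => abs_nonneg _)]
    refine lintegral_congr fun ω => ?_
    rw [← ofReal_norm]
    rfl
  simp only [h]
  constructor
  · intro h
    simpa using ENNReal.tendsto_ofReal h
  · intro h
    have h' := (ENNReal.tendsto_toReal ENNReal.zero_ne_top).comp h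
    refine h'.congr fun k => ?_
    exact ENNReal.toReal_ofReal (integral_nonneg fun _ => abs_nonneg _)

/-- Let the information `G k` decrease and contain the whole increasing information `F`. If
`E[g | G k]` and `E[g | F k]` merge in `L¹`, then they merge almost surely given `F k`.

Given all of `F`, the distance of `E[g | G k]` from `E[g | ⨆ F]` decreases in `k` by Jensen's
inequality, so that it tends to `0` almost surely; the rest is Lévy's upward theorem. -/
theorem ae_tendsto_condExp_abs_sub {F : Filtration ℕ m0} {G : ℕ → MeasurableSpace Ω}
    (hG : Antitone G) (hGm : ∀ k, G k ≤ m0) (hFG : ∀ j k, F j ≤ G k) (g : Ω → ℝ)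
    (h : Tendsto (fun k => ∫ ω, |(P[g | G k]) ω - (P[g | F k]) ω| ∂P) atTop (𝓝 0)) :
    ∀ᵐ ω ∂P, Tendsto (fun k => (P[fun ω => |(P[g | G k]) ω - (P[g | F k]) ω| | F k]) ω) atTop
      (𝓝 0) := by
  set F' : MeasurableSpace Ω := ⨆ n, F n with hF'
  have hF'G (k) : F' ≤ G k := iSup_le fun j => hFG j k
  have hF'm : F' ≤ m0 := (hF'G 0).trans (hGm 0)
  set A : ℕ → Ω → ℝ := fun k ω => |(P[g | G k]) ω - (P[g | F']) ω| with hA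
  set R : ℕ → Ω → ℝ := fun k => P[A k | F'] with hR
  have hAi (k) : Integrable (A k) P := (integrable_condExp.sub integrable_condExp).abs
  have hRm (k) : StronglyMeasurable[F'] (R k) := stronglyMeasurable_condExp
  have hRi (k) : Integrable (R k) P := integrable_condExp
  -- the conditional distances decrease
  have hanti (k) : R (k + 1) ≤ᵐ[P] R k := by
    have h1 : A (k + 1) ≤ᵐ[P] P[A k | G (k + 1)] := by
      have e1 : P[fun ω => (P[g | G k]) ω - (P[g | F']) ω | G (k + 1)] =ᵐ[P]
          fun ω => (P[g | G (k + 1)]) ω - (P[g | F']) ω := by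
        have e2 := condExp_sub (μ := P) (f := P[g | G k]) (g := P[g | F']) integrable_condExp
          integrable_condExp (G (k + 1))
        have e3 : P[P[g | G k] | G (k + 1)] =ᵐ[P] P[g | G (k + 1)] :=
          condExp_condExp_of_le (hG k.le_succ) (hGm k)
        have e4 : P[P[g | F'] | G (k + 1)] = P[g | F'] :=
          condExp_of_stronglyMeasurable (hGm _)
            (stronglyMeasurable_condExp.mono (hF'G _)) integrable_condExp
        rw [e4] at e2
        filter_upwards [e2, e3] with ω e2 e3
        have e5 := e2
        simp only [Pi.sub_apply, e3] at e5
        exact e5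
      filter_upwards [e1, abs_condExp_ae_le_condExp_abs (μ := P) (m := G (k + 1))
        (fun ω => (P[g | G k]) ω - (P[g | F']) ω)] with ω e1 e2
      simp only [Pi.abs_apply, e1] at e2
      exact e2
    have h2 : P[P[A k | G (k + 1)] | F'] =ᵐ[P] R k := condExp_condExp_of_le (hF'G _) (hGm _)
    exact (condExp_mono (hAi _) integrable_condExp h1).trans h2.le
  have hanti' : ∀ᵐ ω ∂P, Antitone fun k => R k ω := by
    filter_upwards [ae_all_iff.2 hanti] with ω hω
    exact antitone_nat_of_succ_le hω
  have hpos : ∀ᵐ ω ∂P, ∀ k, 0 ≤ R k ω := by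
    refine ae_all_iff.2 fun k => ?_
    exact condExp_nonneg (ae_of_all _ fun ω => abs_nonneg _)
  -- they tend to zero in `L¹`
  have hL1 : Tendsto (fun k => ∫ ω, |R k ω - 0| ∂P) atTop (𝓝 0) := by
    have h1 : Tendsto (fun k => ∫ ω, |(P[g | F k]) ω - (P[g | F']) ω| ∂P) atTop (𝓝 0) :=
      (tendsto_integral_abs_sub_iff (fun _ => integrable_condExp) integrable_condExp).2
        (tendsto_eLpNorm_condExp g)
    have h2 := h.add h1
    rw [add_zero] at h2
    refine squeeze_zero (fun k => integral_nonneg fun _ => abs_nonneg _) (fun k => ?_) h2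
    have e1 : ∫ ω, |R k ω - 0| ∂P = ∫ ω, A k ω ∂P := by
      rw [← integral_condExp hF'm (f := A k)]
      refine integral_congr_ae ?_
      filter_upwards [hpos] with ω hω
      rw [sub_zero, abs_of_nonneg (hω k)]
    have i1 : Integrable (fun ω => |(P[g | G k]) ω - (P[g | F k]) ω|) P :=
      (integrable_condExp.sub integrable_condExp).abs
    have i2 : Integrable (fun ω => |(P[g | F k]) ω - (P[g | F']) ω|) P :=
      (integrable_condExp.sub integrable_condExp).abs
    rw [e1, ← integral_add i1 i2]
    refine integral_mono (hAi k) (i1.add i2) fun ω => ?_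
    exact abs_sub_le _ _ _
  have hR0 : ∀ᵐ ω ∂P, Tendsto (fun k => R k ω) atTop (𝓝 0) := by
    have h1 := (tendsto_integral_abs_sub_iff (P := P) (g := fun _ => 0) hRi
      (integrable_const _)).1 hL1
    obtain ⟨ns, hns, h2⟩ := (tendstoInMeasure_of_tendsto_eLpNorm one_ne_zero
      (fun k => (hRi k).aestronglyMeasurable) aestronglyMeasurable_const h1).exists_seq_tendsto_ae
    filter_upwards [hanti', h2] with ω h3 h4
    exact (tendsto_iff_tendsto_subseq_of_antitone h3 hns.tendsto_atTop).2 h4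
  -- Lévy's upward theorem
  have hN := tendsto_ae_condExp (μ := P) (ℱ := F) g
  have hlim1 : ∀ᵐ ω ∂P, ∀ m, Tendsto (fun k => (P[R m | F k]) ω) atTop (𝓝 (R m ω)) :=
    ae_all_iff.2 fun m => (hRi m).tendsto_ae_condExp (hRm m)
  let D : ℕ → Ω → ℝ := fun m ω => |(P[g | F']) ω - (P[g | F m]) ω|
  have hDi (m) : Integrable (D m) P := (integrable_condExp.sub integrable_condExp).abs
  have hDm (m) : StronglyMeasurable[F'] (D m) := by
    have e1 : StronglyMeasurable[F'] (P[g | F']) := stronglyMeasurable_condExp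
    have e2 : StronglyMeasurable[F'] (P[g | F m]) :=
      stronglyMeasurable_condExp.mono (le_iSup (fun n => (F n : MeasurableSpace Ω)) m)
    exact (e1.sub e2).norm
  have hlim2 : ∀ᵐ ω ∂P, ∀ m, Tendsto (fun k => (P[D m | F k]) ω) atTop (𝓝 (D m ω)) :=
    ae_all_iff.2 fun m => (hDi m).tendsto_ae_condExp (hDm m)
  -- compare with a fixed earlier time `m`, for which all terms converge as `k` grows
  have hbound : ∀ᵐ ω ∂P, ∀ m k, m ≤ k →
      (P[fun ω => |(P[g | G k]) ω - (P[g | F k]) ω| | F k]) ω ≤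
        (P[R m | F k]) ω + (P[D m | F k]) ω + |(P[g | F m]) ω - (P[g | F k]) ω| := by
    refine ae_all_iff.2 fun m => ae_all_iff.2 fun k => ?_
    by_cases hmk : m ≤ k
    swap
    · exact ae_of_all _ fun _ h => absurd h hmk
    let C : Ω → ℝ := fun ω => |(P[g | F m]) ω - (P[g | F k]) ω|
    have hCi : Integrable C P := (integrable_condExp.sub integrable_condExp).abs
    have hCm : StronglyMeasurable[F k] C := by
      have e1 : StronglyMeasurable[F k] (P[g | F k]) := stronglyMeasurable_condExp
      have e2 : StronglyMeasurable[F k] (P[g | F m]) :=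
        stronglyMeasurable_condExp.mono (F.mono hmk)
      exact (e2.sub e1).norm
    have h1 : P[fun ω => |(P[g | G k]) ω - (P[g | F k]) ω| | F k] ≤ᵐ[P]
        P[A k + D m + C | F k] := by
      refine condExp_mono (integrable_condExp.sub integrable_condExp).abs
        (((hAi k).add (hDi m)).add hCi) (ae_of_all _ fun ω => ?_)
      simp only [Pi.add_apply, A, D, C]
      exact (abs_sub_le _ ((P[g | F m]) ω) _).trans
        (add_le_add_left (abs_sub_le _ _ _) _)
    have h2 := condExp_add ((hAi k).add (hDi m)) hCi (F k)
    have h3 := condExp_add (hAi k) (hDi m) (F k)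
    have h4 : P[C | F k] = C := condExp_of_stronglyMeasurable (F.le k) hCm hCi
    have h5 : P[R k | F k] =ᵐ[P] P[A k | F k] :=
      condExp_condExp_of_le (le_iSup (fun n => (F n : MeasurableSpace Ω)) k) hF'm
    have h6 : P[R k | F k] ≤ᵐ[P] P[R m | F k] := by
      refine condExp_mono (hRi k) (hRi m) ?_
      filter_upwards [hanti'] with ω hω
      exact hω hmk
    filter_upwards [h1, h2, h3, h5, h6] with ω h1 h2 h3 h5 h6 _
    rw [h4] at h2
    simp only [Pi.add_apply] at h2 h3
    rw [h2, h3, ← h5] at h1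
    linarith
  have hpos2 : ∀ᵐ ω ∂P, ∀ k, 0 ≤ (P[fun ω => |(P[g | G k]) ω - (P[g | F k]) ω| | F k]) ω :=
    ae_all_iff.2 fun k => condExp_nonneg (ae_of_all _ fun ω => abs_nonneg _)
  filter_upwards [hN, hlim1, hlim2, hbound, hpos2, hR0] with ω hN hlim1 hlim2 hbound hpos2 hR0
  have hD0 : Tendsto (fun m => D m ω) atTop (𝓝 0) := by
    have := (tendsto_const_nhds (x := (P[g | F']) ω)).sub hN
    rw [sub_self] at this
    simpa using this.abs
  rw [Metric.tendsto_atTop]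
  intro ε hε
  have hc : Tendsto (fun m => R m ω + D m ω + D m ω) atTop (𝓝 0) := by
    simpa using (hR0.add hD0).add hD0
  obtain ⟨m, hm⟩ := (hc.eventually (gt_mem_nhds hε)).exists
  have hlim : Tendsto (fun k => (P[R m | F k]) ω + (P[D m | F k]) ω
      + |(P[g | F m]) ω - (P[g | F k]) ω|) atTop (𝓝 (R m ω + D m ω + D m ω)) := by
    refine ((hlim1 m).add (hlim2 m)).add ?_
    have := ((tendsto_const_nhds (x := (P[g | F m]) ω)).sub hN).abs
    rwa [abs_sub_comm] at this
  obtain ⟨K, hK⟩ := eventually_atTop.1 (hlim.eventually (gt_mem_nhds hm))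
  refine ⟨max K m, fun k hk => ?_⟩
  rw [Real.dist_eq, sub_zero, abs_of_nonneg (hpos2 k)]
  exact (hbound m k ((le_max_right _ _).trans hk)).trans_lt (hK k ((le_max_left _ _).trans hk))

/-- If `g` has finite entropy, then so have all its conditional expectations, uniformly; hence
`L¹` convergence of the conditional expectations entails convergence of their entropies. -/
theorem tendsto_integral_klFun_condExp {m : ℕ → MeasurableSpace Ω} {m' : MeasurableSpace Ω}
    (hm : ∀ k, m k ≤ m0) (hm' : m' ≤ m0) {g : Ω → ℝ} (h0 : 0 ≤ᵐ[P] g) (hg : Integrable g P)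
    (hkl : Integrable (fun ω => InformationTheory.klFun (g ω)) P)
    (h : Tendsto (fun k => ∫ ω, |(P[g | m k]) ω - (P[g | m']) ω| ∂P) atTop (𝓝 0)) :
    Tendsto (fun k => ∫ ω, InformationTheory.klFun ((P[g | m k]) ω) ∂P) atTop
      (𝓝 (∫ ω, InformationTheory.klFun ((P[g | m']) ω) ∂P)) := by
  have jensen {m : MeasurableSpace Ω} (hm : m ≤ m0) :
      (∀ᵐ ω ∂P, |InformationTheory.klFun ((P[g | m]) ω)| ≤
        |(P[fun ω => InformationTheory.klFun (g ω) | m]) ω|) ∧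
      AEStronglyMeasurable[m0] (fun ω => InformationTheory.klFun ((P[g | m]) ω)) P := by
    refine ⟨?_, (InformationTheory.measurable_klFun.comp
      (stronglyMeasurable_condExp.mono hm).measurable).aestronglyMeasurable⟩
    have h1 := InformationTheory.convexOn_klFun.map_condExp_le (μ := P) (f := g) hm
      (InformationTheory.continuous_klFun.lowerSemicontinuous.lowerSemicontinuousOn _) h0
      isClosed_Ici hg hkl
    have h2 : 0 ≤ᵐ[P] P[g | m] := condExp_nonneg h0
    filter_upwards [h1, h2] with ω h1 h2
    rw [abs_of_nonneg (InformationTheory.klFun_nonneg h2)]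
    exact h1.trans (le_abs_self _)
  have hint {m : MeasurableSpace Ω} (hm : m ≤ m0) :
      Integrable (fun ω => InformationTheory.klFun ((P[g | m]) ω)) P :=
    Integrable.mono (g := P[fun ω => InformationTheory.klFun (g ω) | m]) integrable_condExp
      (jensen hm).2 (jensen hm).1
  -- by Jensen's inequality the entropies are dominated by a uniformly integrable martingale
  have hui : UnifIntegrable (fun k ω => InformationTheory.klFun ((P[g | m k]) ω)) 1 P := by
    intro ε hε
    obtain ⟨δ, hδ, H⟩ := (hkl.uniformIntegrable_condExp hm).2.1 hε
    refine ⟨δ, hδ, fun k s hs hs' => le_trans (eLpNorm_mono_ae ?_) (H k s hs hs')⟩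
    filter_upwards [(jensen (hm k)).1] with ω hω
    by_cases hωs : ω ∈ s
    · simpa [hωs] using hω
    · simp [hωs]
  have hmeas : TendstoInMeasure P (fun k ω => InformationTheory.klFun ((P[g | m k]) ω)) atTop
      (fun ω => InformationTheory.klFun ((P[g | m']) ω)) := by
    have h1 := tendstoInMeasure_of_tendsto_eLpNorm one_ne_zero
      (fun k => (integrable_condExp (μ := P) (f := g) (m := m k)).aestronglyMeasurable)
      (integrable_condExp (μ := P) (f := g) (m := m')).aestronglyMeasurable
      ((tendsto_integral_abs_sub_iff (fun _ => integrable_condExp) integrable_condExp).1 h)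
    rw [exists_seq_tendstoInMeasure_atTop_iff
      fun k => (integrable_condExp (μ := P) (f := g) (m := m k)).aestronglyMeasurable] at h1
    rw [exists_seq_tendstoInMeasure_atTop_iff fun k => (jensen (hm k)).2]
    intro ns hns
    obtain ⟨ns', hns', h2⟩ := h1 ns hns
    refine ⟨ns', hns', ?_⟩
    filter_upwards [h2] with ω hω
    exact (InformationTheory.continuous_klFun.tendsto _).comp hω
  have hL1 := tendsto_Lp_finite_of_tendstoInMeasure le_rfl ENNReal.one_ne_top
    (fun k => (jensen (hm k)).2) (memLp_one_iff_integrable.2 (hint hm')) hui hmeas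
  have := (tendsto_integral_abs_sub_iff (fun k => hint (hm k)) (hint hm')).2 hL1
  exact tendsto_integral_of_L1' _ (hint hm').aestronglyMeasurable
    (Eventually.of_forall fun k => hint (hm k)) hL1

end Martingales

/-! ### The Markov property of the strategic measures -/

section Markov

variable {𝒳 𝒴 𝒰 : Type*} [MeasurableSpace 𝒳] [MeasurableSpace 𝒴] [MeasurableSpace 𝒰]
  {T : Kernel (𝒳 × 𝒰) 𝒳} [IsMarkovKernel T] {Q : Kernel 𝒳 𝒴} [IsMarkovKernel Q]
  {γ : Policy 𝒴 𝒰}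

/-- The first `m` measurements of a trajectory. -/
def obs (m : ℕ) (ω : ℕ → 𝒳 × 𝒴) : Fin m → 𝒴 := history m (measurements ω)

theorem measurable_history (m : ℕ) : Measurable (history (𝒴 := 𝒴) m) :=
  measurable_pi_lambda _ fun _ => measurable_pi_apply _

theorem measurable_measurements : Measurable (measurements (𝒳 := 𝒳) (𝒴 := 𝒴)) :=
  measurable_pi_lambda _ fun _ => (measurable_pi_apply _).snd

theorem measurable_obs (m : ℕ) : Measurable (obs (𝒳 := 𝒳) (𝒴 := 𝒴) m) :=
  (measurable_history m).comp measurable_measurements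

/-- The measurements up to time `n` together with the state at time `n`. -/
def obsState (n : ℕ) (ω : ℕ → 𝒳 × 𝒴) : (Fin (n + 1) → 𝒴) × 𝒳 := (obs (n + 1) ω, (ω n).1)

theorem measurable_obsState (n : ℕ) : Measurable (obsState (𝒳 := 𝒳) (𝒴 := 𝒴) n) :=
  (measurable_obs _).prodMk (measurable_pi_apply _).fst

variable (T Q γ) in
/-- From time `n` on, the law `P` of a trajectory evolves by the transition kernels of the
model; nothing is asked of the law up to time `n`. -/
def EvolvesFrom (n : ℕ) (P : Measure (ℕ → 𝒳 × 𝒴)) : Prop :=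
  ∀ m, n ≤ m → P.map (fun ω => (Preorder.frestrictLe m ω, ω (m + 1))) =
    P.map (Preorder.frestrictLe m) ⊗ₘ stepKernel T Q γ m

theorem evolvesFrom_strategicMeasure (μ : ProbabilityMeasure 𝒳) (n : ℕ) :
    EvolvesFrom T Q γ n (strategicMeasure T Q μ γ) := fun m _ =>
  (Kernel.map_frestrictLe_trajMeasure_compProd_eq_map_trajMeasure (X := fun _ => 𝒳 × 𝒴)
    (μ₀ := (μ : Measure 𝒳) ⊗ₘ Q) (κ := stepKernel T Q γ) (a := m)).symm

theorem strategicMeasure_absolutelyContinuous {μ ν : ProbabilityMeasure 𝒳}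
    (h : (μ : Measure 𝒳) ≪ ν) : strategicMeasure T Q μ γ ≪ strategicMeasure T Q ν γ := by
  unfold strategicMeasure Kernel.trajMeasure
  exact ((h.compProd_left Q).map (by fun_prop)).comp_right _

theorem map_withDensity_comp {α β : Type*} [MeasurableSpace α] [MeasurableSpace β]
    (P : Measure α) {g : α → β} (hg : Measurable g) {f : β → ℝ≥0∞} (hf : Measurable f) :
    (P.withDensity (f ∘ g)).map g = (P.map g).withDensity f := by
  refine Measure.ext_of_lintegral _ fun F hF => ?_
  rw [lintegral_map hF hg, lintegral_withDensity_eq_lintegral_mul _ (hf.comp hg)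
      (g := fun a => F (g a)) (hF.comp hg),
    lintegral_withDensity_eq_lintegral_mul _ hf hF, lintegral_map (hf.mul hF) hg]
  rfl

/-- Weighting the past by a density does not affect the evolution. -/
theorem EvolvesFrom.withDensity {n : ℕ} {P : Measure (ℕ → 𝒳 × 𝒴)} [IsFiniteMeasure P]
    (hP : EvolvesFrom T Q γ n P) {f : (Finset.Iic n → 𝒳 × 𝒴) → ℝ≥0∞} (hf : Measurable f)
    [IsFiniteMeasure (P.withDensity fun ω => f (Preorder.frestrictLe n ω))] :
    EvolvesFrom T Q γ n (P.withDensity fun ω => f (Preorder.frestrictLe n ω)) := by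
  intro m hm
  have hr : Measurable (Preorder.frestrictLe₂ (π := fun _ => 𝒳 × 𝒴) hm) :=
    measurable_pi_lambda _ fun _ => measurable_pi_apply _
  have hf' : Measurable fun h : Finset.Iic m → 𝒳 × 𝒴 =>
      f (Preorder.frestrictLe₂ (π := fun _ => 𝒳 × 𝒴) hm h) := hf.comp hr
  have hm1 : Measurable fun ω : ℕ → 𝒳 × 𝒴 =>
      (Preorder.frestrictLe (π := fun _ => 𝒳 × 𝒴) m ω, ω (m + 1)) := by fun_prop
  have hm2 : Measurable (Preorder.frestrictLe (π := fun _ => 𝒳 × 𝒴) m) := by fun_prop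
  have e1 := map_withDensity_comp P hm1 (f := fun z : (Finset.Iic m → 𝒳 × 𝒴) × (𝒳 × 𝒴) =>
    f (Preorder.frestrictLe₂ (π := fun _ => 𝒳 × 𝒴) hm z.1)) (hf'.comp measurable_fst)
  have e2 := map_withDensity_comp P hm2 hf'
  have hfin : IsFiniteMeasure ((P.map (Preorder.frestrictLe m)).withDensity
      fun h => f (Preorder.frestrictLe₂ (π := fun _ => 𝒳 × 𝒴) hm h)) := by
    rw [← e2]
    change IsFiniteMeasure (Measure.map _ (P.withDensity fun ω => f (Preorder.frestrictLe n ω)))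
    infer_instance
  have e3 := withDensity_compProd (r := P.map (Preorder.frestrictLe m))
    (η := stepKernel T Q γ m) hf'
  rw [← hP m hm] at e3
  exact e1.trans (e3.symm.trans (by rw [← e2]; rfl))

/-- The history up to time `m + 1` from the history up to time `m` and the next point. -/
def snocIic (m : ℕ) (z : (Finset.Iic m → 𝒳 × 𝒴) × (𝒳 × 𝒴)) : Finset.Iic (m + 1) → 𝒳 × 𝒴 :=
  fun k => if h : k.1 ≤ m then z.1 ⟨k.1, Finset.mem_Iic.2 h⟩ else z.2

theorem measurable_snocIic (m : ℕ) : Measurable (snocIic (𝒳 := 𝒳) (𝒴 := 𝒴) m) := by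
  refine measurable_pi_lambda _ fun k => ?_
  unfold snocIic
  by_cases h : k.1 ≤ m
  · simp only [h, dif_pos]
    exact (measurable_pi_apply _).comp measurable_fst
  · simp only [h, dif_neg, not_false_eq_true]
    exact measurable_snd

theorem snocIic_frestrictLe (m : ℕ) (ω : ℕ → 𝒳 × 𝒴) :
    snocIic m (Preorder.frestrictLe m ω, ω (m + 1)) = Preorder.frestrictLe (m + 1) ω := by
  funext k
  unfold snocIic
  by_cases h : k.1 ≤ m
  · simp [h]
  · have hk : k.1 = m + 1 := le_antisymm (Finset.mem_Iic.1 k.2) (by omega)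
    simp [hk]

/-- The law up to time `n` determines the law of the whole trajectory. -/
theorem EvolvesFrom.ext {n : ℕ} {P P' : Measure (ℕ → 𝒳 × 𝒴)} [IsFiniteMeasure P]
    [IsFiniteMeasure P'] (hP : EvolvesFrom T Q γ n P) (hP' : EvolvesFrom T Q γ n P')
    (h : P.map (Preorder.frestrictLe n) = P'.map (Preorder.frestrictLe n)) : P = P' := by
  have step : ∀ m, n ≤ m → P.map (Preorder.frestrictLe m) = P'.map (Preorder.frestrictLe m) := by
    intro m hm
    induction m, hm using Nat.le_induction with
    | base => exact h
    | succ m hm ih =>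
      have key (R : Measure (ℕ → 𝒳 × 𝒴)) (hR : EvolvesFrom T Q γ n R) :
          R.map (Preorder.frestrictLe (m + 1)) =
            (R.map (Preorder.frestrictLe m) ⊗ₘ stepKernel T Q γ m).map (snocIic m) := by
        rw [← hR m hm, Measure.map_map (measurable_snocIic m) (by fun_prop)]
        congr 1
        funext ω
        exact (snocIic_frestrictLe m ω).symm
      rw [key P hP, key P' hP', ih]
  have hfam : IsProjectiveMeasureFamily (α := fun _ : ℕ => 𝒳 × 𝒴) fun I => P'.map I.restrict := by
    intro I J hJI
    have hr : Measurable (Finset.restrict₂ (π := fun _ : ℕ => 𝒳 × 𝒴) hJI) :=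
      measurable_pi_lambda _ fun _ => measurable_pi_apply _
    have hr' : Measurable (I.restrict (π := fun _ : ℕ => 𝒳 × 𝒴)) :=
      measurable_pi_lambda _ fun _ => measurable_pi_apply _
    exact (Measure.map_map (μ := P') hr hr').symm
  have h1 : IsProjectiveLimit P fun I => P'.map (I.restrict (π := fun _ : ℕ => 𝒳 × 𝒴)) :=
    (isProjectiveLimit_nat_iff' hfam P n).2 fun m hm => step m hm
  exact h1.unique fun I => rfl

variable [Nonempty 𝒳]

/-- Forget the states before time `n`, replacing them by an arbitrary point, and keep all
measurements. -/
def forget (n : ℕ) (ω : ℕ → 𝒳 × 𝒴) : ℕ → 𝒳 × 𝒴 :=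
  fun k => if n ≤ k then ω k else (Classical.arbitrary 𝒳, (ω k).2)

/-- The map `forget` on finite histories. -/
def forgetIic (n m : ℕ) (h : Finset.Iic m → 𝒳 × 𝒴) : Finset.Iic m → 𝒳 × 𝒴 :=
  fun k => if n ≤ k.1 then h k else (Classical.arbitrary 𝒳, (h k).2)

theorem measurable_forget (n : ℕ) : Measurable (forget (𝒳 := 𝒳) (𝒴 := 𝒴) n) := by
  refine measurable_pi_lambda _ fun k => ?_
  unfold forget
  by_cases h : n ≤ k
  · simp only [h, if_true]
    exact measurable_pi_apply _
  · simp only [h, if_false]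
    exact measurable_const.prodMk (measurable_pi_apply _).snd

theorem measurable_forgetIic (n m : ℕ) : Measurable (forgetIic (𝒳 := 𝒳) (𝒴 := 𝒴) n m) := by
  refine measurable_pi_lambda _ fun k => ?_
  unfold forgetIic
  by_cases h : n ≤ k.1
  · simp only [h, if_true]
    exact measurable_pi_apply _
  · simp only [h, if_false]
    exact measurable_const.prodMk (measurable_pi_apply _).snd

theorem measurements_forget (n : ℕ) (ω : ℕ → 𝒳 × 𝒴) :
    measurements (forget n ω) = measurements ω := by
  funext k
  unfold measurements forget
  split_ifs <;> rfl

theorem obs_forget (n m : ℕ) (ω : ℕ → 𝒳 × 𝒴) : obs m (forget n ω) = obs m ω := by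
  unfold obs
  rw [measurements_forget]

theorem obsState_forget {n m : ℕ} (h : n ≤ m) (ω : ℕ → 𝒳 × 𝒴) :
    obsState m (forget n ω) = obsState m ω := by
  unfold obsState
  rw [obs_forget]
  simp [forget, h]

theorem forget_forget {n m : ℕ} (h : n ≤ m) (ω : ℕ → 𝒳 × 𝒴) :
    forget m (forget n ω) = forget m ω := by
  funext k
  unfold forget
  by_cases h1 : m ≤ k
  · simp [h1, h.trans h1]
  · by_cases h2 : n ≤ k <;> simp [h1, h2]

/-- The action depends on the past through the measurements only, so that forgetting earlier
states does not change the transition kernel. -/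
theorem stepKernel_forgetIic {n m : ℕ} (h : n ≤ m) (z : Finset.Iic m → 𝒳 × 𝒴) :
    stepKernel T Q γ m (forgetIic n m z) = stepKernel T Q γ m z := by
  have : stateAction γ m (forgetIic n m z) = stateAction γ m z := by
    unfold stateAction forgetIic
    refine Prod.ext (by simp [h]) ?_
    simp only
    congr 1
    funext i
    split_ifs <;> rfl
  simp only [stepKernel, Kernel.comap_apply, this]

theorem compProd_map_of_comp_eq {α β : Type*} [MeasurableSpace α] [MeasurableSpace β]
    {p : Measure α} [IsFiniteMeasure p] {κ : Kernel α β} [IsMarkovKernel κ] {f : α → α}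
    (hf : Measurable f) (h : ∀ a, κ (f a) = κ a) :
    p.map f ⊗ₘ κ = (p ⊗ₘ κ).map (Prod.map f id) := by
  refine Measure.ext_of_lintegral _ fun F hF => ?_
  rw [Measure.lintegral_compProd hF, lintegral_map hF.lintegral_kernel_prod_right' hf,
    lintegral_map hF (hf.prodMap measurable_id),
    Measure.lintegral_compProd (f := fun z => F (Prod.map f id z))
      (hF.comp (hf.prodMap measurable_id))]
  simp [h]

theorem EvolvesFrom.map_forget {n : ℕ} {P : Measure (ℕ → 𝒳 × 𝒴)} [IsFiniteMeasure P]
    (hP : EvolvesFrom T Q γ n P) : EvolvesFrom T Q γ n (P.map (forget n)) := by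
  intro m hm
  have hm1 : Measurable fun ω : ℕ → 𝒳 × 𝒴 =>
      (Preorder.frestrictLe (π := fun _ => 𝒳 × 𝒴) m ω, ω (m + 1)) := by fun_prop
  have hm2 : Measurable (Preorder.frestrictLe (π := fun _ => 𝒳 × 𝒴) m) := by fun_prop
  have e1 : (Preorder.frestrictLe (π := fun _ => 𝒳 × 𝒴) m) ∘ forget n
      = forgetIic n m ∘ Preorder.frestrictLe m := rfl
  have e2 : (fun ω : ℕ → 𝒳 × 𝒴 => (Preorder.frestrictLe (π := fun _ => 𝒳 × 𝒴) m ω, ω (m + 1)))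
      ∘ forget n = Prod.map (forgetIic n m) id ∘
        fun ω : ℕ → 𝒳 × 𝒴 => (Preorder.frestrictLe (π := fun _ => 𝒳 × 𝒴) m ω, ω (m + 1)) := by
    funext ω
    refine Prod.ext rfl ?_
    simp [forget, hm.trans (Nat.le_succ m)]
  rw [Measure.map_map hm1 (measurable_forget n), Measure.map_map hm2 (measurable_forget n), e1, e2,
    ← Measure.map_map ((measurable_forgetIic n m).prodMap measurable_id) hm1,
    ← Measure.map_map (measurable_forgetIic n m) hm2, hP m hm,
    compProd_map_of_comp_eq (measurable_forgetIic n m) (stepKernel_forgetIic hm)]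

/-- **Markov property.** Two laws with the same evolution after time `n` have the same density
on the information `σ(Y₀, …, Yₙ, Xₙ)` as on the larger information generated by all
measurements and all states from time `n` on. -/
theorem condExp_forget_eq {n : ℕ} {P P₀ : Measure (ℕ → 𝒳 × 𝒴)} [IsProbabilityMeasure P]
    [IsProbabilityMeasure P₀] (hPP : P ≪ P₀) (hP : EvolvesFrom T Q γ n P)
    (hP₀ : EvolvesFrom T Q γ n P₀) :
    P₀[fun ω => (P.rnDeriv P₀ ω).toReal | MeasurableSpace.comap (forget n) inferInstance]
      =ᵐ[P₀] P₀[fun ω => (P.rnDeriv P₀ ω).toReal |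
        MeasurableSpace.comap (obsState n) inferInstance] := by
  set d := (P.map (obsState n)).rnDeriv (P₀.map (obsState n)) with hd
  have hdm : Measurable d := Measure.measurable_rnDeriv _ _
  have hf : Measurable (d ∘ obsState n) := hdm.comp (measurable_obsState n)
  have hV : (P₀.withDensity (d ∘ obsState n)).map (obsState n) = P.map (obsState n) := by
    rw [map_withDensity_comp P₀ (measurable_obsState n) hdm]
    exact Measure.withDensity_rnDeriv_eq _ _ (hPP.map (measurable_obsState n))
  have hprob : IsProbabilityMeasure (P₀.withDensity (d ∘ obsState n)) := by
    constructor
    have h1 : (P₀.withDensity (d ∘ obsState n)).map (obsState n) Set.univ = 1 := by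
      rw [hV, Measure.map_apply (measurable_obsState n) MeasurableSet.univ]
      simp
    rwa [Measure.map_apply (measurable_obsState n) MeasurableSet.univ] at h1
  -- the reweighted law evolves in the same way, and agrees with `P` on `σ(Y₀, …, Yₙ, Xₙ)`
  let v : (Finset.Iic n → 𝒳 × 𝒴) → (Fin (n + 1) → 𝒴) × 𝒳 := fun h =>
    (fun i => (h ⟨i.1, Finset.mem_Iic.2 (Nat.lt_succ_iff.1 i.2)⟩).2,
      (h ⟨n, Finset.mem_Iic.2 le_rfl⟩).1)
  have hv : Measurable v :=
    (measurable_pi_lambda _ fun i => (measurable_pi_apply _).snd).prodMk (measurable_pi_apply _).fst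
  have hE : EvolvesFrom T Q γ n (P₀.withDensity (d ∘ obsState n)) := by
    have hfin : IsFiniteMeasure
        (P₀.withDensity fun ω => (d ∘ v) (Preorder.frestrictLe n ω)) :=
      inferInstanceAs (IsFiniteMeasure (P₀.withDensity (d ∘ obsState n)))
    exact hP₀.withDensity (f := d ∘ v) (hdm.comp hv)
  let u : (Fin (n + 1) → 𝒴) × 𝒳 → (Finset.Iic n → 𝒳 × 𝒴) := fun z k =>
    (if n ≤ k.1 then z.2 else Classical.arbitrary 𝒳,
      z.1 ⟨k.1, Nat.lt_succ_iff.2 (Finset.mem_Iic.1 k.2)⟩)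
  have hu : Measurable u := by
    refine measurable_pi_lambda _ fun k => ?_
    refine Measurable.prodMk ?_ ((measurable_pi_apply _).comp measurable_fst)
    by_cases h : n ≤ k.1
    · simp only [h, if_true]
      exact measurable_snd
    · simp only [h, if_false]
      exact measurable_const
  have huv : (Preorder.frestrictLe (π := fun _ => 𝒳 × 𝒴) n) ∘ forget n = u ∘ obsState n := by
    funext ω k
    simp only [Function.comp_apply, u, obsState, Preorder.frestrictLe_apply, forget]
    by_cases h : n ≤ k.1
    · have hk : k.1 = n := le_antisymm (Finset.mem_Iic.1 k.2) h
      simp only [h, if_true]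
      refine Prod.ext ?_ rfl
      simp [hk]
    · simp only [h, if_false]
      rfl
  have hagree : P.map (forget n) = (P₀.withDensity (d ∘ obsState n)).map (forget n) := by
    have : IsFiniteMeasure ((P₀.withDensity (d ∘ obsState n)).map (forget n)) := inferInstance
    refine hP.map_forget.ext hE.map_forget ?_
    have hm2 : Measurable (Preorder.frestrictLe (π := fun _ => 𝒳 × 𝒴) n) := by fun_prop
    rw [Measure.map_map hm2 (measurable_forget n), Measure.map_map hm2 (measurable_forget n),
      huv, ← Measure.map_map hu (measurable_obsState n),
      ← Measure.map_map hu (measurable_obsState n), hV]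
  have hcomp : d ∘ obsState n = (d ∘ obsState n) ∘ forget n := by
    funext ω
    simp [obsState_forget]
  rw [hcomp, map_withDensity_comp P₀ (measurable_forget n) hf] at hagree
  have h1 := toReal_rnDeriv_map hPP (measurable_forget (𝒳 := 𝒳) (𝒴 := 𝒴) n)
  have h2 := toReal_rnDeriv_map hPP (measurable_obsState (𝒳 := 𝒳) (𝒴 := 𝒴) n)
  have h3 : (P.map (forget n)).rnDeriv (P₀.map (forget n)) =ᵐ[P₀.map (forget n)]
      d ∘ obsState n := by
    rw [hagree]
    exact Measure.rnDeriv_withDensity _ hf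
  have h4 := ae_of_ae_map (measurable_forget n).aemeasurable h3
  filter_upwards [h1, h2, h4] with ω h1 h2 h4
  rw [← h1, ← h2, h4]
  simp [hd, obsState_forget]

end Markov

/-! ### The measurement channel -/

section Channel

variable {𝒳 𝒴 𝒰 : Type*} [MeasurableSpace 𝒳] [MeasurableSpace 𝒴] [MeasurableSpace 𝒰]
  {T : Kernel (𝒳 × 𝒰) 𝒳} [IsMarkovKernel T] {Q : Kernel 𝒳 𝒴} [IsMarkovKernel Q]
  {γ : Policy 𝒴 𝒰}

/-- The measurements before time `n` together with the state at time `n`. -/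
def obsPred (n : ℕ) (ω : ℕ → 𝒳 × 𝒴) : (Fin n → 𝒴) × 𝒳 := (obs n ω, (ω n).1)

theorem measurable_obsPred (n : ℕ) : Measurable (obsPred (𝒳 := 𝒳) (𝒴 := 𝒴) n) :=
  (measurable_obs _).prodMk (measurable_pi_apply _).fst

theorem strategicMeasure_map_zero (μ : ProbabilityMeasure 𝒳) :
    (strategicMeasure T Q μ γ).map (fun ω => ω 0) = (μ : Measure 𝒳) ⊗ₘ Q := by
  have e : (fun ω : ℕ → 𝒳 × 𝒴 => ω 0) =
      (MeasurableEquiv.piUnique (fun _ : Finset.Iic 0 => 𝒳 × 𝒴)) ∘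
        Preorder.frestrictLe (π := fun _ => 𝒳 × 𝒴) 0 := by
    funext ω
    rfl
  have hm2 : Measurable (Preorder.frestrictLe (π := fun _ => 𝒳 × 𝒴) 0) := by fun_prop
  rw [e, ← Measure.map_map (MeasurableEquiv.measurable _) hm2]
  unfold strategicMeasure Kernel.trajMeasure
  rw [Measure.map_comp _ _ hm2, Kernel.traj_map_frestrictLe, Kernel.partialTraj_self,
    Measure.id_comp, Measure.map_map (MeasurableEquiv.measurable _) (MeasurableEquiv.measurable _)]
  exact (Measure.map_congr (ae_of_all _ fun z => rfl)).trans Measure.map_id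

theorem lintegral_channel (μ : ProbabilityMeasure 𝒳) (n : ℕ)
    {F : ((Fin n → 𝒴) × 𝒳) × 𝒴 → ℝ≥0∞} (hF : Measurable F) :
    ∫⁻ ω, F (obsPred n ω, (ω n).2) ∂(strategicMeasure T Q μ γ) =
      ∫⁻ ω, ∫⁻ y, F (obsPred n ω, y) ∂(Q (ω n).1) ∂(strategicMeasure T Q μ γ) := by
  cases n with
  | zero =>
    have e (ω : ℕ → 𝒳 × 𝒴) : obsPred 0 ω = (Fin.elim0, (ω 0).1) :=
      Prod.ext (Subsingleton.elim _ _) rfl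
    have h1 : Measurable fun z : 𝒳 × 𝒴 => F ((Fin.elim0, z.1), z.2) := by fun_prop
    have h2 : Measurable fun z : 𝒳 × 𝒴 => ∫⁻ y, F ((Fin.elim0, z.1), y) ∂(Q z.1) := by
      have : Measurable fun x : 𝒳 => ∫⁻ y, F ((Fin.elim0, x), y) ∂(Q x) :=
        Measurable.lintegral_kernel_prod_right h1
      exact this.comp measurable_fst
    simp only [e]
    rw [← lintegral_map (f := fun z : 𝒳 × 𝒴 => F ((Fin.elim0, z.1), z.2)) h1
        (measurable_pi_apply 0),
      ← lintegral_map (f := fun z : 𝒳 × 𝒴 => ∫⁻ y, F ((Fin.elim0, z.1), y) ∂(Q z.1)) h2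
        (measurable_pi_apply 0), strategicMeasure_map_zero, Measure.lintegral_compProd h1,
      Measure.lintegral_compProd h2]
    simp
  | succ n =>
    let o : (Finset.Iic n → 𝒳 × 𝒴) → (Fin (n + 1) → 𝒴) := fun h i =>
      (h ⟨i.1, Finset.mem_Iic.2 (Nat.lt_succ_iff.1 i.2)⟩).2
    have ho : Measurable o := measurable_pi_lambda _ fun i => (measurable_pi_apply _).snd
    have hm : Measurable fun ω : ℕ → 𝒳 × 𝒴 =>
      (Preorder.frestrictLe (π := fun _ => 𝒳 × 𝒴) n ω, ω (n + 1)) := by fun_prop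
    have step (G : (Fin (n + 1) → 𝒴) × (𝒳 × 𝒴) → ℝ≥0∞) (hG : Measurable G) :
        ∫⁻ ω, G (obs (n + 1) ω, ω (n + 1)) ∂(strategicMeasure T Q μ γ) =
          ∫⁻ h, ∫⁻ x, ∫⁻ y, G (o h, (x, y)) ∂(Q x) ∂(T (stateAction γ n h))
            ∂((strategicMeasure T Q μ γ).map (Preorder.frestrictLe n)) := by
      have hG' : Measurable fun z : (Finset.Iic n → 𝒳 × 𝒴) × (𝒳 × 𝒴) => G (o z.1, z.2) := by
        fun_prop
      have e1 := lintegral_map (μ := strategicMeasure T Q μ γ) hG' hm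
      rw [evolvesFrom_strategicMeasure μ 0 n (Nat.zero_le n), Measure.lintegral_compProd hG'] at e1
      refine Eq.trans e1.symm (lintegral_congr fun h => ?_)
      rw [stepKernel, Kernel.comap_apply, Kernel.lintegral_compProd _ _ _ (by fun_prop)]
      rfl
    have h1 : Measurable fun z : (Fin (n + 1) → 𝒴) × (𝒳 × 𝒴) => F ((z.1, z.2.1), z.2.2) := by
      fun_prop
    have h2 : Measurable fun z : (Fin (n + 1) → 𝒴) × (𝒳 × 𝒴) =>
        ∫⁻ y, F ((z.1, z.2.1), y) ∂(Q z.2.1) := by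
      have : Measurable fun z : (Fin (n + 1) → 𝒴) × 𝒳 =>
          ∫⁻ y, F (z, y) ∂(Kernel.prodMkLeft (Fin (n + 1) → 𝒴) Q z) :=
        Measurable.lintegral_kernel_prod_right hF
      exact this.comp (measurable_fst.prodMk measurable_snd.fst)
    refine (step _ h1).trans (Eq.trans ?_ (step _ h2).symm)
    simp

/-- Given the earlier measurements and the current state, the current measurement is drawn
from the channel. -/
theorem map_obsPred_prod (μ : ProbabilityMeasure 𝒳) (n : ℕ) :
    (strategicMeasure T Q μ γ).map (fun ω => (obsPred n ω, (ω n).2)) =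
      (strategicMeasure T Q μ γ).map (obsPred n) ⊗ₘ Kernel.prodMkLeft (Fin n → 𝒴) Q := by
  have hm : Measurable fun ω : ℕ → 𝒳 × 𝒴 => (obsPred n ω, (ω n).2) :=
    (measurable_obsPred n).prodMk (measurable_pi_apply n).snd
  refine Measure.ext_of_lintegral _ fun F hF => ?_
  rw [lintegral_map hF hm, Measure.lintegral_compProd hF,
    lintegral_map hF.lintegral_kernel_prod_right' (measurable_obsPred n), lintegral_channel μ n hF]
  rfl

theorem obs_succ_eq_snoc (n : ℕ) (ω : ℕ → 𝒳 × 𝒴) :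
    obs (n + 1) ω = Fin.snoc (α := fun _ => 𝒴) (obs n ω) (ω n).2 := by
  funext i
  refine Fin.lastCases ?_ (fun j => ?_) i
  · simp [obs, history, measurements]
  · simp [obs, history, measurements]

theorem measurable_snoc (n : ℕ) :
    Measurable fun z : (Fin n → 𝒴) × 𝒴 =>
      (Fin.snoc (α := fun _ => 𝒴) z.1 z.2 : Fin (n + 1) → 𝒴) := by
  refine measurable_pi_lambda _ fun i => ?_
  refine Fin.lastCases ?_ (fun j => ?_) i
  · simp only [Fin.snoc_last]
    exact measurable_snd
  · simp only [Fin.snoc_castSucc]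
    exact (measurable_pi_apply j).comp measurable_fst

theorem comap_obsState_eq (n : ℕ) :
    MeasurableSpace.comap (obsState (𝒳 := 𝒳) (𝒴 := 𝒴) n) inferInstance =
      MeasurableSpace.comap (fun ω : ℕ → 𝒳 × 𝒴 => (obsPred n ω, (ω n).2)) inferInstance := by
  refine le_antisymm ?_ ?_
  · let u : ((Fin n → 𝒴) × 𝒳) × 𝒴 → (Fin (n + 1) → 𝒴) × 𝒳 := fun z =>
      (Fin.snoc (α := fun _ => 𝒴) z.1.1 z.2, z.1.2)
    have hu : Measurable u := by
      refine Measurable.prodMk ?_ (by fun_prop)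
      exact (measurable_snoc n).comp ((measurable_fst.comp measurable_fst).prodMk measurable_snd)
    have : obsState (𝒳 := 𝒳) (𝒴 := 𝒴) n = u ∘ fun ω => (obsPred n ω, (ω n).2) := by
      funext ω
      exact Prod.ext (obs_succ_eq_snoc n ω) rfl
    rw [this, ← MeasurableSpace.comap_comp]
    exact MeasurableSpace.comap_mono hu.comap_le
  · let u : (Fin (n + 1) → 𝒴) × 𝒳 → ((Fin n → 𝒴) × 𝒳) × 𝒴 := fun z =>
      ((fun i => z.1 i.castSucc, z.2), z.1 (Fin.last n))
    have hu : Measurable u := by fun_prop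
    have : (fun ω : ℕ → 𝒳 × 𝒴 => (obsPred n ω, (ω n).2)) = u ∘ obsState n := rfl
    rw [this, ← MeasurableSpace.comap_comp]
    exact MeasurableSpace.comap_mono hu.comap_le

/-- The current measurement, being drawn from the same channel under both laws, adds nothing to
the density on `σ(Y₀, …, Yₙ₋₁, Xₙ)`. -/
theorem condExp_obsState_eq_obsPred {μ ν : ProbabilityMeasure 𝒳} (h : (μ : Measure 𝒳) ≪ ν)
    (n : ℕ) :
    (strategicMeasure T Q ν γ)[fun ω =>
        ((strategicMeasure T Q μ γ).rnDeriv (strategicMeasure T Q ν γ) ω).toReal |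
          MeasurableSpace.comap (obsState n) inferInstance]
      =ᵐ[strategicMeasure T Q ν γ] (strategicMeasure T Q ν γ)[fun ω =>
        ((strategicMeasure T Q μ γ).rnDeriv (strategicMeasure T Q ν γ) ω).toReal |
          MeasurableSpace.comap (obsPred n) inferInstance] := by
  have hPP := strategicMeasure_absolutelyContinuous (T := T) (Q := Q) (γ := γ) h
  have hm : Measurable fun ω : ℕ → 𝒳 × 𝒴 => (obsPred n ω, (ω n).2) :=
    (measurable_obsPred n).prodMk (measurable_pi_apply n).snd
  rw [comap_obsState_eq]
  have h1 := toReal_rnDeriv_map hPP hm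
  have h2 := toReal_rnDeriv_map hPP (measurable_obsPred (𝒳 := 𝒳) (𝒴 := 𝒴) n)
  have h3 := rnDeriv_measure_compProd_left ((strategicMeasure T Q μ γ).map (obsPred n))
    ((strategicMeasure T Q ν γ).map (obsPred n)) (Kernel.prodMkLeft (Fin n → 𝒴) Q)
  rw [← map_obsPred_prod, ← map_obsPred_prod] at h3
  have h4 := ae_of_ae_map hm.aemeasurable h3
  filter_upwards [h1, h2, h4] with ω h1 h2 h4
  rw [← h1, ← h2, h4]

/-- The filtration of the measurements, the `n`-th σ-algebra being that of `Y₀, …, Yₙ₋₁`. -/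
def obsFiltration : Filtration ℕ (inferInstance : MeasurableSpace (ℕ → 𝒳 × 𝒴)) where
  seq n := MeasurableSpace.comap (obs n) inferInstance
  mono' := by
    intro m n h
    let u : (Fin n → 𝒴) → (Fin m → 𝒴) := fun y i => y (Fin.castLE h i)
    have hu : Measurable u := by fun_prop
    have : obs (𝒳 := 𝒳) (𝒴 := 𝒴) m = u ∘ obs n := rfl
    simp only
    rw [this, ← MeasurableSpace.comap_comp]
    exact MeasurableSpace.comap_mono hu.comap_le
  le' n := (measurable_obs n).comap_le

variable [Nonempty 𝒳]

theorem comap_forget_antitone :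
    Antitone fun n => MeasurableSpace.comap (forget (𝒳 := 𝒳) (𝒴 := 𝒴) n) inferInstance := by
  intro m n h
  have : forget (𝒳 := 𝒳) (𝒴 := 𝒴) n = forget n ∘ forget m := by
    funext ω
    exact (forget_forget h ω).symm
  simp only
  rw [this, ← MeasurableSpace.comap_comp]
  exact MeasurableSpace.comap_mono (measurable_forget n).comap_le

theorem comap_obs_le_forget (m n : ℕ) :
    MeasurableSpace.comap (obs (𝒳 := 𝒳) (𝒴 := 𝒴) m) inferInstance ≤
      MeasurableSpace.comap (forget (𝒳 := 𝒳) (𝒴 := 𝒴) n) inferInstance := by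
  have : obs (𝒳 := 𝒳) (𝒴 := 𝒴) m = obs m ∘ forget n := by
    funext ω
    exact (obs_forget n m ω).symm
  rw [this, ← MeasurableSpace.comap_comp]
  exact MeasurableSpace.comap_mono (measurable_obs m).comap_le

theorem comap_obsState_le_forget {m n : ℕ} (h : n ≤ m) :
    MeasurableSpace.comap (obsState (𝒳 := 𝒳) (𝒴 := 𝒴) m) inferInstance ≤
      MeasurableSpace.comap (forget (𝒳 := 𝒳) (𝒴 := 𝒴) n) inferInstance := by
  have : obsState (𝒳 := 𝒳) (𝒴 := 𝒴) m = obsState m ∘ forget n := by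
    funext ω
    exact (obsState_forget h ω).symm
  rw [this, ← MeasurableSpace.comap_comp]
  exact MeasurableSpace.comap_mono (measurable_obsState m).comap_le

end Channel

/-! ### Merging of the conditional laws through conditional densities -/

section CondLaws

theorem tendsto_lintegral_ofReal_abs_iff {Ω : Type*} {_ : MeasurableSpace Ω} {P : Measure Ω}
    {f : ℕ → Ω → ℝ} (hf : ∀ n, Integrable (f n) P) :
    Tendsto (fun n => ∫⁻ ω, ENNReal.ofReal |f n ω| ∂P) atTop (𝓝 0) ↔
      Tendsto (fun n => ∫ ω, |f n ω| ∂P) atTop (𝓝 0) := by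
  have h (n : ℕ) : ∫⁻ ω, ENNReal.ofReal |f n ω| ∂P = ENNReal.ofReal (∫ ω, |f n ω| ∂P) :=
    (ofReal_integral_eq_lintegral_ofReal (hf n).abs (ae_of_all _ fun _ => abs_nonneg _)).symm
  simp only [h]
  constructor
  · intro h
    refine ((ENNReal.tendsto_toReal ENNReal.zero_ne_top).comp h).congr fun n => ?_
    exact ENNReal.toReal_ofReal (integral_nonneg fun _ => abs_nonneg _)
  · intro h
    simpa using ENNReal.tendsto_ofReal h

theorem integral_abs_sub_le {Ω : Type*} {_ : MeasurableSpace Ω} {P : Measure Ω} {f g h : Ω → ℝ}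
    (hf : Integrable f P) (hg : Integrable g P) (hh : Integrable h P) :
    ∫ ω, |f ω - h ω| ∂P ≤ ∫ ω, |f ω - g ω| ∂P + ∫ ω, |g ω - h ω| ∂P := by
  have h1 : Integrable (fun ω => |f ω - g ω|) P := (hf.sub hg).abs
  have h2 : Integrable (fun ω => |g ω - h ω|) P := (hg.sub hh).abs
  rw [← integral_add h1 h2]
  exact integral_mono (hf.sub hh).abs (h1.add h2)
    fun ω => abs_sub_le _ _ _

variable {𝒳 𝒴 𝒰 : Type*} [MeasurableSpace 𝒳] [MeasurableSpace 𝒴] [MeasurableSpace 𝒰]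
  [StandardBorelSpace 𝒳] [Nonempty 𝒳]
  {T : Kernel (𝒳 × 𝒰) 𝒳} [IsMarkovKernel T] {Q : Kernel 𝒳 𝒴} [IsMarkovKernel Q]
  {μ ν : ProbabilityMeasure 𝒳} {γ : Policy 𝒴 𝒰}

variable (T Q μ γ) in
/-- The conditional law of `Xₙ` given `Y₀, …, Yₘ₋₁` as a kernel on the finite histories. -/
def condKernel (n m : ℕ) : Kernel (Fin m → 𝒴) 𝒳 :=
  condDistrib (fun ω : ℕ → 𝒳 × 𝒴 => (ω n).1) (obs m) (strategicMeasure T Q μ γ)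

instance (n m : ℕ) : IsMarkovKernel (condKernel T Q μ γ n m) := by
  unfold condKernel; infer_instance

theorem condState_eq (n m : ℕ) (y : ℕ → 𝒴) :
    condState T Q μ γ n m y = condKernel T Q μ γ n m (history m y) := rfl

instance (n m : ℕ) (y : ℕ → 𝒴) : IsProbabilityMeasure (condState T Q μ γ n m y) := by
  rw [condState_eq]; infer_instance

instance (n : ℕ) (y : ℕ → 𝒴) : IsProbabilityMeasure (filterAt T Q μ γ n y) := by
  unfold filterAt; infer_instance

theorem measurable_state (n : ℕ) : Measurable fun ω : ℕ → 𝒳 × 𝒴 => (ω n).1 :=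
  (measurable_pi_apply n).fst

variable (T Q μ γ) in
theorem map_obs_prod_eq_compProd (n m : ℕ) :
    (strategicMeasure T Q μ γ).map (fun ω => (obs m ω, (ω n).1)) =
      (strategicMeasure T Q μ γ).map (obs m) ⊗ₘ condKernel T Q μ γ n m :=
  (compProd_map_condDistrib (measurable_state n).aemeasurable).symm

theorem map_history_measurementLaw (m : ℕ) :
    (measurementLaw T Q μ γ).map (history m) = (strategicMeasure T Q μ γ).map (obs m) :=
  Measure.map_map (measurable_history m) measurable_measurements

instance : IsProbabilityMeasure (measurementLaw T Q μ γ) :=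
  Measure.isProbabilityMeasure_map measurable_measurements.aemeasurable

theorem lintegral_measurementLaw_history {m : ℕ} {f : (Fin m → 𝒴) → ℝ≥0∞} (hf : Measurable f) :
    ∫⁻ y, f (history m y) ∂(measurementLaw T Q μ γ) =
      ∫⁻ y, f y ∂((strategicMeasure T Q μ γ).map (obs m)) := by
  rw [← map_history_measurementLaw, lintegral_map hf (measurable_history m)]

theorem ae_condKernel_absolutelyContinuous (h : (μ : Measure 𝒳) ≪ ν) (n m : ℕ) :
    ∀ᵐ y ∂((strategicMeasure T Q μ γ).map (obs m)),
      condKernel T Q μ γ n m y ≪ condKernel T Q ν γ n m y :=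
  ae_absolutelyContinuous_of_map_eq_compProd (strategicMeasure_absolutelyContinuous h)
    (measurable_state n) (measurable_obs m) (map_obs_prod_eq_compProd T Q μ γ n m)
    (map_obs_prod_eq_compProd T Q ν γ n m)

theorem ae_condState_absolutelyContinuous (h : (μ : Measure 𝒳) ≪ ν) (n m : ℕ) :
    ∀ᵐ y ∂(measurementLaw T Q μ γ), condKernel T Q μ γ n m (history m y) ≪
      condKernel T Q ν γ n m (history m y) := by
  have := ae_condKernel_absolutelyContinuous (T := T) (Q := Q) (γ := γ) h n m
  rw [← map_history_measurementLaw] at this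
  exact ae_of_ae_map (measurable_history m).aemeasurable this

theorem tvDist_condState_ae_eq (h : (μ : Measure 𝒳) ≪ ν) (n m : ℕ) :
    (fun y => tvDist (condState T Q μ γ n m y) (condState T Q ν γ n m y))
      =ᵐ[measurementLaw T Q μ γ] fun y =>
        tvKernel (condKernel T Q μ γ n m) (condKernel T Q ν γ n m) (history m y) := by
  filter_upwards [ae_condState_absolutelyContinuous h n m] with y hy
  exact (tvKernel_eq_tvDist hy).symm

theorem lintegral_tvDist_condState (h : (μ : Measure 𝒳) ≪ ν) (n m : ℕ) :
    ∫⁻ y, tvDist (condState T Q μ γ n m y) (condState T Q ν γ n m y) ∂(measurementLaw T Q μ γ) =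
      ∫⁻ y, tvKernel (condKernel T Q μ γ n m) (condKernel T Q ν γ n m) y
        ∂((strategicMeasure T Q μ γ).map (obs m)) := by
  rw [lintegral_congr_ae (tvDist_condState_ae_eq h n m),
    lintegral_measurementLaw_history (measurable_tvKernel _ _)]

theorem lintegral_klDiv_condState (h : (μ : Measure 𝒳) ≪ ν) (n m : ℕ) :
    ∫⁻ y, InformationTheory.klDiv (condState T Q μ γ n m y) (condState T Q ν γ n m y)
        ∂(measurementLaw T Q μ γ) =
      ∫⁻ y, klKernel (condKernel T Q μ γ n m) (condKernel T Q ν γ n m) y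
        ∂((strategicMeasure T Q μ γ).map (obs m)) := by
  rw [← lintegral_measurementLaw_history (measurable_klKernel _ _)]
  refine lintegral_congr_ae ?_
  filter_upwards [ae_condState_absolutelyContinuous h n m] with y hy
  exact (klKernel_eq_klDiv hy).symm

/-- The expected total variation distance of the conditional laws of `Xₙ` given `Y₀, …, Yₘ₋₁` is
the `L¹` distance of the densities on `σ(Y₀, …, Yₘ₋₁, Xₙ)` and `σ(Y₀, …, Yₘ₋₁)`. -/
theorem lintegral_tvDist_condState_eq (h : (μ : Measure 𝒳) ≪ ν) (n m : ℕ) :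
    ∫⁻ y, tvDist (condState T Q μ γ n m y) (condState T Q ν γ n m y) ∂(measurementLaw T Q μ γ) =
      ∫⁻ ω, ENNReal.ofReal |((strategicMeasure T Q ν γ)[fun ω =>
          ((strategicMeasure T Q μ γ).rnDeriv (strategicMeasure T Q ν γ) ω).toReal |
            MeasurableSpace.comap (fun ω => (obs m ω, (ω n).1)) inferInstance]) ω
        - ((strategicMeasure T Q ν γ)[fun ω =>
          ((strategicMeasure T Q μ γ).rnDeriv (strategicMeasure T Q ν γ) ω).toReal |
            MeasurableSpace.comap (obs m) inferInstance]) ω| ∂(strategicMeasure T Q ν γ) := by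
  rw [lintegral_tvDist_condState h]
  exact lintegral_tvKernel_eq (strategicMeasure_absolutelyContinuous h)
    (measurable_state n) (measurable_obs m) (map_obs_prod_eq_compProd T Q μ γ n m)
    (map_obs_prod_eq_compProd T Q ν γ n m)

theorem tvMergeExp_filter_iff (h : (μ : Measure 𝒳) ≪ ν) :
    TVMergeExp (measurementLaw T Q μ γ) (filterAt T Q μ γ) (filterAt T Q ν γ) ↔
      Tendsto (fun n => ∫ ω, |((strategicMeasure T Q ν γ)[fun ω =>
          ((strategicMeasure T Q μ γ).rnDeriv (strategicMeasure T Q ν γ) ω).toReal |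
            MeasurableSpace.comap (obsState n) inferInstance]) ω
        - ((strategicMeasure T Q ν γ)[fun ω =>
          ((strategicMeasure T Q μ γ).rnDeriv (strategicMeasure T Q ν γ) ω).toReal |
            MeasurableSpace.comap (obs (n + 1)) inferInstance]) ω| ∂(strategicMeasure T Q ν γ))
        atTop (𝓝 0) := by
  refine Iff.trans ?_ (tendsto_lintegral_ofReal_abs_iff (f := fun n ω =>
    ((strategicMeasure T Q ν γ)[fun ω =>
          ((strategicMeasure T Q μ γ).rnDeriv (strategicMeasure T Q ν γ) ω).toReal |
            MeasurableSpace.comap (obsState n) inferInstance]) ω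
        - ((strategicMeasure T Q ν γ)[fun ω =>
          ((strategicMeasure T Q μ γ).rnDeriv (strategicMeasure T Q ν γ) ω).toReal |
            MeasurableSpace.comap (obs (n + 1)) inferInstance]) ω)
    fun n => integrable_condExp.sub integrable_condExp)
  unfold TVMergeExp filterAt
  simp only [lintegral_tvDist_condState_eq h]
  rfl

/-- As the current measurement adds nothing to the density on `σ(Y₀, …, Yₙ₋₁, Xₙ)`, the distance
of the predictors involves the same density on `σ(Y₀, …, Yₙ, Xₙ)` as that of the filters. -/
theorem tvMergeExp_predictor_iff (h : (μ : Measure 𝒳) ≪ ν) :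
    TVMergeExp (measurementLaw T Q μ γ) (predictorAt T Q μ γ) (predictorAt T Q ν γ) ↔
      Tendsto (fun n => ∫ ω, |((strategicMeasure T Q ν γ)[fun ω =>
          ((strategicMeasure T Q μ γ).rnDeriv (strategicMeasure T Q ν γ) ω).toReal |
            MeasurableSpace.comap (obsState n) inferInstance]) ω
        - ((strategicMeasure T Q ν γ)[fun ω =>
          ((strategicMeasure T Q μ γ).rnDeriv (strategicMeasure T Q ν γ) ω).toReal |
            MeasurableSpace.comap (obs n) inferInstance]) ω| ∂(strategicMeasure T Q ν γ))
        atTop (𝓝 0) := by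
  refine Iff.trans ?_ (tendsto_lintegral_ofReal_abs_iff (f := fun n ω =>
    ((strategicMeasure T Q ν γ)[fun ω =>
          ((strategicMeasure T Q μ γ).rnDeriv (strategicMeasure T Q ν γ) ω).toReal |
            MeasurableSpace.comap (obsState n) inferInstance]) ω
        - ((strategicMeasure T Q ν γ)[fun ω =>
          ((strategicMeasure T Q μ γ).rnDeriv (strategicMeasure T Q ν γ) ω).toReal |
            MeasurableSpace.comap (obs n) inferInstance]) ω)
    fun n => integrable_condExp.sub integrable_condExp)
  unfold TVMergeExp predictorAt
  simp only [lintegral_tvDist_condState_eq h]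
  refine iff_of_eq (congrArg (fun u : ℕ → ℝ≥0∞ => Tendsto u atTop (𝓝 0)) (funext fun n => ?_))
  refine lintegral_congr_ae ?_
  filter_upwards [condExp_obsState_eq_obsPred (T := T) (Q := Q) (γ := γ) h n] with ω hω
  rw [hω]
  rfl

/-- Filter and predictor merge in total variation in expectation at the same time: their
distances are those of the same density `E[ρ | σ(Y₀, …, Yₙ, Xₙ)]` from two consecutive terms of
an `L¹`-convergent martingale. -/
theorem tvMergeExp_filter_iff_predictor (h : (μ : Measure 𝒳) ≪ ν) :
    TVMergeExp (measurementLaw T Q μ γ) (filterAt T Q μ γ) (filterAt T Q ν γ) ↔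
      TVMergeExp (measurementLaw T Q μ γ) (predictorAt T Q μ γ) (predictorAt T Q ν γ) := by
  rw [tvMergeExp_filter_iff h, tvMergeExp_predictor_iff h]
  set P₀ := strategicMeasure T Q ν γ
  set ρ : (ℕ → 𝒳 × 𝒴) → ℝ := fun ω => ((strategicMeasure T Q μ γ).rnDeriv P₀ ω).toReal
  set M : ℕ → (ℕ → 𝒳 × 𝒴) → ℝ := fun n => P₀[ρ | MeasurableSpace.comap (obsState n) inferInstance]
  set N : ℕ → (ℕ → 𝒳 × 𝒴) → ℝ := fun n => P₀[ρ | MeasurableSpace.comap (obs n) inferInstance]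
  have hM (n) : Integrable (M n) P₀ := integrable_condExp
  have hN (n) : Integrable (N n) P₀ := integrable_condExp
  have h1 : Tendsto (fun n => ∫ ω, |N n ω - (P₀[ρ | ⨆ n, obsFiltration n]) ω| ∂P₀) atTop (𝓝 0) :=
    (tendsto_integral_abs_sub_iff hN integrable_condExp).2
      (tendsto_eLpNorm_condExp (ℱ := obsFiltration) ρ)
  have h2 : Tendsto (fun n => ∫ ω, |N n ω - N (n + 1) ω| ∂P₀) atTop (𝓝 0) := by
    have h3 := h1.add ((tendsto_add_atTop_iff_nat 1).2 h1)
    rw [add_zero] at h3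
    refine squeeze_zero (fun n => integral_nonneg fun _ => abs_nonneg _) (fun n => ?_) h3
    simp only [abs_sub_comm (N (n + 1) _)]
    exact integral_abs_sub_le (hN n) integrable_condExp (hN (n + 1))
  have tri (a b : ℕ → ℕ) (h3 : Tendsto (fun n => ∫ ω, |N (a n) ω - N (b n) ω| ∂P₀) atTop (𝓝 0))
      (h4 : Tendsto (fun n => ∫ ω, |M n ω - N (a n) ω| ∂P₀) atTop (𝓝 0)) :
      Tendsto (fun n => ∫ ω, |M n ω - N (b n) ω| ∂P₀) atTop (𝓝 0) := by
    have h5 := h4.add h3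
    rw [add_zero] at h5
    refine squeeze_zero (fun n => integral_nonneg fun _ => abs_nonneg _) (fun n => ?_) h5
    exact integral_abs_sub_le (hM n) (hN _) (hN _)
  constructor
  · refine tri (fun n => n + 1) (fun n => n) ?_
    simpa only [abs_sub_comm] using h2
  · exact tri (fun n => n) (fun n => n + 1) h2

/-- Almost sure merging on the space of trajectories, for the measurable version of the
distance. -/
theorem tvMergeAS_filter_iff (h : (μ : Measure 𝒳) ≪ ν) :
    TVMergeAS (measurementLaw T Q μ γ) (filterAt T Q μ γ) (filterAt T Q ν γ) ↔
      ∀ᵐ ω ∂(strategicMeasure T Q μ γ), Tendsto (fun n =>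
        tvKernel (condKernel T Q μ γ n (n + 1)) (condKernel T Q ν γ n (n + 1)) (obs (n + 1) ω))
        atTop (𝓝 0) := by
  have hm (n : ℕ) : Measurable fun y : ℕ → 𝒴 =>
      tvKernel (condKernel T Q μ γ n (n + 1)) (condKernel T Q ν γ n (n + 1)) (history (n + 1) y) :=
    (measurable_tvKernel _ _).comp (measurable_history _)
  have hset : MeasurableSet {y : ℕ → 𝒴 | Tendsto (fun n =>
      tvKernel (condKernel T Q μ γ n (n + 1)) (condKernel T Q ν γ n (n + 1)) (history (n + 1) y))
      atTop (𝓝 0)} := measurableSet_tendsto _ hm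
  have e1 : TVMergeAS (measurementLaw T Q μ γ) (filterAt T Q μ γ) (filterAt T Q ν γ) ↔
      ∀ᵐ y ∂(measurementLaw T Q μ γ), Tendsto (fun n => tvKernel (condKernel T Q μ γ n (n + 1))
        (condKernel T Q ν γ n (n + 1)) (history (n + 1) y)) atTop (𝓝 0) := by
    refine eventually_congr ?_
    filter_upwards [ae_all_iff.2 fun n =>
      tvDist_condState_ae_eq (T := T) (Q := Q) (γ := γ) h n (n + 1)] with y hy
    exact tendsto_congr hy
  rw [e1, measurementLaw, ae_map_iff measurable_measurements.aemeasurable hset]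
  rfl

/-- The distances are bounded by `2`, so that bounded convergence applies. -/
theorem TVMergeAS.tvMergeExp (h : (μ : Measure 𝒳) ≪ ν)
    (hAS : TVMergeAS (measurementLaw T Q μ γ) (filterAt T Q μ γ) (filterAt T Q ν γ)) :
    TVMergeExp (measurementLaw T Q μ γ) (filterAt T Q μ γ) (filterAt T Q ν γ) := by
  have := tendsto_lintegral_of_dominated_convergence' (μ := measurementLaw T Q μ γ)
    (F := fun n y => tvDist (filterAt T Q μ γ n y) (filterAt T Q ν γ n y)) (f := fun _ => 0)
    (fun _ => 2) (fun n => ?_) (fun n => ae_of_all _ fun y => ?_) (by simp) hAS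
  · simpa [TVMergeExp] using this
  · exact ((measurable_tvKernel _ _).comp (measurable_history _)).aemeasurable.congr
      (tvDist_condState_ae_eq h n (n + 1)).symm
  · exact tvDist_le_two (condState T Q μ γ n (n + 1) y) (condState T Q ν γ n (n + 1) y)

/-- The density of `P` on a sub-`σ`-algebra is positive `P`-almost surely. -/
theorem ae_condExp_rnDeriv_pos {Ω : Type*} {m m0 : MeasurableSpace Ω} (hm : m ≤ m0)
    {P P₀ : Measure Ω} [IsProbabilityMeasure P] [IsProbabilityMeasure P₀] (hPP : P ≪ P₀) :
    ∀ᵐ ω ∂P, 0 < (P₀[fun ω => (P.rnDeriv P₀ ω).toReal | m]) ω := by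
  set ρ : Ω → ℝ := fun ω => (P.rnDeriv P₀ ω).toReal
  have hsm : StronglyMeasurable[m] (P₀[ρ | m]) := stronglyMeasurable_condExp
  have hA : MeasurableSet[m] {ω | (P₀[ρ | m]) ω ≤ 0} := by
    have := hsm.measurable
    exact this measurableSet_Iic
  have h1 : ∫ ω in {ω | (P₀[ρ | m]) ω ≤ 0}, ρ ω ∂P₀ ≤ 0 := by
    rw [← setIntegral_condExp hm Measure.integrable_toReal_rnDeriv hA]
    exact setIntegral_nonpos (hm _ hA) fun ω hω => hω
  rw [Measure.setIntegral_toReal_rnDeriv hPP] at h1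
  have h2 : P {ω | (P₀[ρ | m]) ω ≤ 0} = 0 := by
    have h3 := le_antisymm h1 measureReal_nonneg
    rwa [measureReal_eq_zero_iff] at h3
  rw [ae_iff]
  simpa using h2

/-- If the filters merge in total variation in expectation, then they do so almost surely. With
`Nₖ` the density of `P` on `σ(Y₀, …, Yₖ)`, the conditional expectation of the distance of the
densities is `Nₖ` times the distance of the filters; the former tends to `0` by the Markov property
and `ae_tendsto_condExp_abs_sub`, and the limit of `Nₖ` is positive `P`-almost surely. -/
theorem TVMergeExp.tvMergeAS (h : (μ : Measure 𝒳) ≪ ν)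
    (hE : TVMergeExp (measurementLaw T Q μ γ) (filterAt T Q μ γ) (filterAt T Q ν γ)) :
    TVMergeAS (measurementLaw T Q μ γ) (filterAt T Q μ γ) (filterAt T Q ν γ) := by
  rw [tvMergeAS_filter_iff h]
  rw [tvMergeExp_filter_iff h] at hE
  have hPP := strategicMeasure_absolutelyContinuous (T := T) (Q := Q) (γ := γ) h
  set P := strategicMeasure T Q μ γ with hP
  set P₀ := strategicMeasure T Q ν γ with hP₀
  set ρ : (ℕ → 𝒳 × 𝒴) → ℝ := fun ω => (P.rnDeriv P₀ ω).toReal with hρ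
  let F : Filtration ℕ (inferInstance : MeasurableSpace (ℕ → 𝒳 × 𝒴)) :=
    { seq := fun n => MeasurableSpace.comap (obs (n + 1)) inferInstance
      mono' := fun m n hmn => obsFiltration.mono' (Nat.succ_le_succ hmn)
      le' := fun n => (measurable_obs _).comap_le }
  have hmarkov (n : ℕ) := condExp_forget_eq (n := n) hPP
    (evolvesFrom_strategicMeasure (T := T) (Q := Q) (γ := γ) μ n)
    (evolvesFrom_strategicMeasure (T := T) (Q := Q) (γ := γ) ν n)
  have h1 : ∀ᵐ ω ∂P₀, Tendsto (fun k => (P₀[fun ω =>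
      |(P₀[ρ | MeasurableSpace.comap (forget k) inferInstance]) ω - (P₀[ρ | F k]) ω| | F k]) ω)
      atTop (𝓝 0) := by
    refine ae_tendsto_condExp_abs_sub (F := F) comap_forget_antitone
      (fun k => (measurable_forget k).comap_le) (fun j k => comap_obs_le_forget (j + 1) k) ρ ?_
    refine hE.congr fun n => integral_congr_ae ?_
    filter_upwards [hmarkov n] with ω hω
    rw [hω]
  have h2 : ∀ᵐ ω ∂P₀, ∀ k, (P₀[fun ω =>
      |(P₀[ρ | MeasurableSpace.comap (forget k) inferInstance]) ω - (P₀[ρ | F k]) ω| | F k]) ω =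
      (P₀[ρ | F k]) ω * (tvKernel (condKernel T Q μ γ k (k + 1))
        (condKernel T Q ν γ k (k + 1)) (obs (k + 1) ω)).toReal := by
    refine ae_all_iff.2 fun k => ?_
    have h3 := condExp_abs_sub_eq_mul_tvKernel hPP (measurable_state k) (measurable_obs (k + 1))
      (map_obs_prod_eq_compProd T Q μ γ k (k + 1)) (map_obs_prod_eq_compProd T Q ν γ k (k + 1))
    refine EventuallyEq.trans (condExp_congr_ae ?_) h3
    filter_upwards [hmarkov k] with ω hω
    rw [hω]
    rfl
  have h4 := tendsto_ae_condExp (μ := P₀) (ℱ := F) ρ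
  have h5 := ae_condExp_rnDeriv_pos (iSup_le F.le) hPP
  have h7 : ∀ᵐ ω ∂P, ∀ k, tvKernel (condKernel T Q μ γ k (k + 1))
        (condKernel T Q ν γ k (k + 1)) (obs (k + 1) ω) ≠ ∞ := by
    refine ae_all_iff.2 fun k => ?_
    filter_upwards [ae_of_ae_map (measurable_obs (k + 1)).aemeasurable
      (ae_condKernel_absolutelyContinuous (T := T) (Q := Q) (γ := γ) h k (k + 1))] with ω hω
    rw [tvKernel_eq_tvDist hω]
    exact ne_top_of_le_ne_top ENNReal.ofNat_ne_top (tvDist_le_two _ _)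
  filter_upwards [hPP.ae_le h1, hPP.ae_le h2, hPP.ae_le h4, h5, h7] with ω h1 h2 h4 h5 h7
  have h6 : Tendsto (fun k => (P₀[ρ | F k]) ω * (tvKernel (condKernel T Q μ γ k (k + 1))
        (condKernel T Q ν γ k (k + 1)) (obs (k + 1) ω)).toReal / (P₀[ρ | F k]) ω) atTop (𝓝 0) := by
    have := (h1.congr h2).div h4 h5.ne'
    rw [zero_div] at this
    exact this
  have h8 : Tendsto (fun k => (tvKernel (condKernel T Q μ γ k (k + 1))
        (condKernel T Q ν γ k (k + 1)) (obs (k + 1) ω)).toReal) atTop (𝓝 0) := by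
    refine h6.congr' ?_
    filter_upwards [h4.eventually (lt_mem_nhds h5)] with k hk
    exact mul_div_cancel_left₀ _ hk.ne'
  exact (ENNReal.tendsto_toReal_iff h7 ENNReal.zero_ne_top).1 (by simpa using h8)

end CondLaws

/-! ### Relative entropy of the conditional laws -/

section Reweighting

variable {Ω E S : Type*} [MeasurableSpace Ω] [MeasurableSpace E] [MeasurableSpace S]
  {P P₀ : Measure Ω} [IsProbabilityMeasure P] [IsProbabilityMeasure P₀]

theorem klDiv_map_eq_lintegral (hPP : P ≪ P₀) {g : Ω → E} (hg : Measurable g) :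
    InformationTheory.klDiv (P.map g) (P₀.map g) = ∫⁻ ω, ENNReal.ofReal (InformationTheory.klFun
      ((P₀[fun ω => (P.rnDeriv P₀ ω).toReal | MeasurableSpace.comap g inferInstance]) ω)) ∂P₀ := by
  have := Measure.isProbabilityMeasure_map (μ := P) hg.aemeasurable
  have := Measure.isProbabilityMeasure_map (μ := P₀) hg.aemeasurable
  rw [InformationTheory.klDiv_eq_lintegral_klFun_of_ac (hPP.map hg), lintegral_map _ hg]
  · refine lintegral_congr_ae ?_
    filter_upwards [toReal_rnDeriv_map hPP hg] with ω hω
    rw [hω]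
  · have := Measure.measurable_rnDeriv (P.map g) (P₀.map g)
    fun_prop

theorem condExp_toReal_rnDeriv_nonneg {m : MeasurableSpace Ω} :
    0 ≤ᵐ[P₀] P₀[fun ω => (P.rnDeriv P₀ ω).toReal | m] :=
  condExp_nonneg (ae_of_all _ fun _ => ENNReal.toReal_nonneg)

theorem integrable_klFun_condExp (hPP : P ≪ P₀) {g : Ω → E} (hg : Measurable g)
    (h : InformationTheory.klDiv (P.map g) (P₀.map g) ≠ ∞) :
    Integrable (fun ω => InformationTheory.klFun
      ((P₀[fun ω => (P.rnDeriv P₀ ω).toReal | MeasurableSpace.comap g inferInstance]) ω)) P₀ := by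
  rw [klDiv_map_eq_lintegral hPP hg] at h
  refine (lintegral_ofReal_ne_top_iff_integrable ?_ ?_).1 h
  · exact (InformationTheory.measurable_klFun.comp
      (stronglyMeasurable_condExp.mono hg.comap_le).measurable).aestronglyMeasurable
  · filter_upwards [condExp_toReal_rnDeriv_nonneg (P := P) (P₀ := P₀)] with ω hω
    exact InformationTheory.klFun_nonneg hω

/-- The law `P₀`, reweighted so that `Y` has the same law as under `P`. -/
def reweight (P P₀ : Measure Ω) (Y : Ω → E) : Measure Ω :=
  P₀.withDensity ((P.map Y).rnDeriv (P₀.map Y) ∘ Y)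

theorem map_reweight (hPP : P ≪ P₀) {Y : Ω → E} (hY : Measurable Y) :
    (reweight P P₀ Y).map Y = P.map Y := by
  rw [reweight, map_withDensity_comp P₀ hY (Measure.measurable_rnDeriv _ _)]
  exact Measure.withDensity_rnDeriv_eq _ _ (hPP.map hY)

theorem isProbabilityMeasure_reweight (hPP : P ≪ P₀) {Y : Ω → E} (hY : Measurable Y) :
    IsProbabilityMeasure (reweight P P₀ Y) := by
  constructor
  have := Measure.isProbabilityMeasure_map (μ := P) hY.aemeasurable
  rw [← Set.preimage_univ (f := Y), ← Measure.map_apply hY MeasurableSet.univ,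
    map_reweight hPP hY, measure_univ]

theorem absolutelyContinuous_reweight (hPP : P ≪ P₀) {Y : Ω → E} (hY : Measurable Y) :
    P ≪ reweight P P₀ Y := by
  have hm : Measurable ((P.map Y).rnDeriv (P₀.map Y) ∘ Y) :=
    (Measure.measurable_rnDeriv _ _).comp hY
  intro s hs
  have hpos := ae_of_ae_map hY.aemeasurable (Measure.rnDeriv_pos (hPP.map hY))
  rw [reweight, withDensity_apply_eq_zero hm] at hs
  refine measure_mono_null_ae ?_ (hPP hs)
  filter_upwards [hpos] with ω hω h
  exact ⟨hω.ne', h⟩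

/-- Reweighting by a function of `Y` leaves conditional laws given `Y` and more unchanged. -/
theorem map_reweight_eq_compProd (hPP : P ≪ P₀) {E' : Type*} [MeasurableSpace E'] {Y : Ω → E}
    {Y' : Ω → E'} {π : E' → E} (hπ : Measurable π) (hY' : Measurable Y') (hY : Y = π ∘ Y')
    {X : Ω → S} (hX : Measurable X) {η : Kernel E' S} [IsMarkovKernel η]
    (hη : P₀.map (fun ω => (Y' ω, X ω)) = P₀.map Y' ⊗ₘ η) :
    (reweight P P₀ Y).map (fun ω => (Y' ω, X ω)) = (reweight P P₀ Y).map Y' ⊗ₘ η := by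
  have hYm : Measurable Y := hY ▸ hπ.comp hY'
  have := isProbabilityMeasure_reweight hPP hYm
  set d := (P.map Y).rnDeriv (P₀.map Y) with hd
  have hdm : Measurable (d ∘ π) := (Measure.measurable_rnDeriv _ _).comp hπ
  have e : reweight P P₀ Y = P₀.withDensity ((d ∘ π) ∘ Y') := by
    rw [reweight, ← hd, hY]; rfl
  have e1 : (reweight P P₀ Y).map Y' = (P₀.map Y').withDensity (d ∘ π) := by
    rw [e, map_withDensity_comp P₀ hY' hdm]
  have : IsFiniteMeasure ((P₀.map Y').withDensity (d ∘ π)) := by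
    rw [← e1]; infer_instance
  rw [e1, withDensity_compProd hdm, ← hη,
    ← map_withDensity_comp P₀ (hY'.prodMk hX) (f := fun z : E' × S => (d ∘ π) z.1)
      (hdm.comp measurable_fst), e]
  rfl

end Reweighting

section Entropy

variable {𝒳 𝒴 𝒰 : Type*} [MeasurableSpace 𝒳] [MeasurableSpace 𝒴] [MeasurableSpace 𝒰]
  [StandardBorelSpace 𝒳] [Nonempty 𝒳]
  {T : Kernel (𝒳 × 𝒰) 𝒳} [IsMarkovKernel T] {Q : Kernel 𝒳 𝒴} [IsMarkovKernel Q]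
  {μ ν : ProbabilityMeasure 𝒳} {γ : Policy 𝒴 𝒰}

/-- Merging of the conditional laws in total variation makes both relative entropies, that of
`(Y₀, …, Yₖ, Xₖ)` and that of `(Y₀, …, Yₖ)`, converge to the same limit, and by the chain rule
their difference is the conditional relative entropy. -/
theorem tendsto_lintegral_klKernel {P P₀ : Measure (ℕ → 𝒳 × 𝒴)} [IsProbabilityMeasure P]
    [IsProbabilityMeasure P₀] (hPP : P ≪ P₀) {n : ℕ} (hP : EvolvesFrom T Q γ n P)
    (hP₀ : EvolvesFrom T Q γ n P₀) {κ η : (k : ℕ) → Kernel (Fin (k + 1) → 𝒴) 𝒳}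
    [∀ k, IsMarkovKernel (κ k)] [∀ k, IsMarkovKernel (η k)]
    (hκ : ∀ k, n ≤ k → P.map (obsState k) = P.map (obs (k + 1)) ⊗ₘ κ k)
    (hη : ∀ k, n ≤ k → P₀.map (obsState k) = P₀.map (obs (k + 1)) ⊗ₘ η k)
    (hfin : InformationTheory.klDiv (P.map (obsState n)) (P₀.map (obsState n)) ≠ ∞)
    (htv : Tendsto (fun k => ∫⁻ y, tvKernel (κ k) (η k) y ∂(P.map (obs (k + 1)))) atTop (𝓝 0)) :
    Tendsto (fun k => ∫⁻ y, klKernel (κ k) (η k) y ∂(P.map (obs (k + 1)))) atTop (𝓝 0) := by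
  rw [← tendsto_add_atTop_iff_nat n] at htv ⊢
  set ρ : (ℕ → 𝒳 × 𝒴) → ℝ := fun ω => (P.rnDeriv P₀ ω).toReal with hρ
  set g := P₀[ρ | MeasurableSpace.comap (forget n) inferInstance] with hg
  have hforget := condExp_forget_eq hPP hP hP₀
  have hkl0 : InformationTheory.klDiv (P.map (forget n)) (P₀.map (forget n)) ≠ ∞ := by
    rw [klDiv_map_eq_lintegral hPP (measurable_obsState n)] at hfin
    rw [klDiv_map_eq_lintegral hPP (measurable_forget n)]
    convert hfin using 1
    refine lintegral_congr_ae ?_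
    filter_upwards [hforget] with ω hω
    rw [hω]
  have hgkl := integrable_klFun_condExp hPP (measurable_forget n) hkl0
  -- by data processing, all statistics of the trajectory after `forget n` have finite entropy
  have hfinite {E : Type _} [MeasurableSpace E] {f : (ℕ → 𝒳 × 𝒴) → E} (hf : Measurable f)
      (h : f ∘ forget n = f) : InformationTheory.klDiv (P.map f) (P₀.map f) ≠ ∞ := by
    refine ne_top_of_le_ne_top hkl0 ?_
    have e (P : Measure (ℕ → 𝒳 × 𝒴)) : P.map f = (P.map (forget n)).map f := by
      rw [Measure.map_map hf (measurable_forget n), h]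
    have := Measure.isProbabilityMeasure_map (μ := P) (measurable_forget n).aemeasurable
    have := Measure.isProbabilityMeasure_map (μ := P₀) (measurable_forget n).aemeasurable
    rw [e P, e P₀]
    exact InformationTheory.klDiv_map_le _ _ hf
  have tower {m : MeasurableSpace (ℕ → 𝒳 × 𝒴)}
      (hm : m ≤ MeasurableSpace.comap (forget n) MeasurableSpace.pi) : P₀[g | m] =ᵐ[P₀] P₀[ρ | m] :=
    condExp_condExp_of_le hm (measurable_forget n).comap_le
  have hF'le : ⨆ k, obsFiltration (𝒳 := 𝒳) (𝒴 := 𝒴) k ≤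
      MeasurableSpace.comap (forget n) MeasurableSpace.pi :=
    iSup_le fun k => comap_obs_le_forget k n
  have hN : Tendsto (fun k => ∫ ω,
      |(P₀[ρ | MeasurableSpace.comap (obs (k + n + 1)) inferInstance]) ω
      - (P₀[ρ | ⨆ k, obsFiltration k]) ω| ∂P₀) atTop (𝓝 0) := by
    have h1 : Tendsto (fun k => ∫ ω, |(P₀[ρ | obsFiltration k]) ω
        - (P₀[ρ | ⨆ k, obsFiltration k]) ω| ∂P₀) atTop (𝓝 0) :=
      (tendsto_integral_abs_sub_iff (fun _ => integrable_condExp) integrable_condExp).2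
        (tendsto_eLpNorm_condExp (ℱ := obsFiltration) ρ)
    exact (tendsto_add_atTop_iff_nat (n + 1)).2 h1
  have hM : Tendsto (fun k => ∫ ω,
      |(P₀[ρ | MeasurableSpace.comap (obsState (k + n)) inferInstance]) ω
      - (P₀[ρ | ⨆ k, obsFiltration k]) ω| ∂P₀) atTop (𝓝 0) := by
    have h1 : Tendsto (fun k => ∫ ω,
        |(P₀[ρ | MeasurableSpace.comap (obsState (k + n)) inferInstance]) ω
        - (P₀[ρ | MeasurableSpace.comap (obs (k + n + 1)) inferInstance]) ω| ∂P₀)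
        atTop (𝓝 0) := by
      refine (tendsto_lintegral_ofReal_abs_iff (f := fun k ω =>
        (P₀[ρ | MeasurableSpace.comap (obsState (k + n)) inferInstance]) ω
        - (P₀[ρ | MeasurableSpace.comap (obs (k + n + 1)) inferInstance]) ω)
        fun k => integrable_condExp.sub integrable_condExp).1 (htv.congr fun k => ?_)
      exact lintegral_tvKernel_eq hPP (measurable_state _) (measurable_obs _)
        (hκ _ (Nat.le_add_left n k)) (hη _ (Nat.le_add_left n k))
    have h2 := h1.add hN
    rw [add_zero] at h2
    refine squeeze_zero (fun n => integral_nonneg fun _ => abs_nonneg _) (fun k => ?_) h2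
    exact integral_abs_sub_le integrable_condExp integrable_condExp integrable_condExp
  -- so entropies of densities converging in `L¹` converge
  have key {m : ℕ → MeasurableSpace (ℕ → 𝒳 × 𝒴)}
      (hm : ∀ k, m k ≤ MeasurableSpace.comap (forget n) MeasurableSpace.pi)
      (h : Tendsto (fun k => ∫ ω, |(P₀[ρ | m k]) ω - (P₀[ρ | ⨆ k, obsFiltration k]) ω| ∂P₀)
        atTop (𝓝 0)) :
      Tendsto (fun k => ∫ ω, InformationTheory.klFun ((P₀[ρ | m k]) ω) ∂P₀) atTop
        (𝓝 (∫ ω, InformationTheory.klFun ((P₀[ρ | ⨆ k, obsFiltration k]) ω) ∂P₀)) := by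
    have h1 := tendsto_integral_klFun_condExp (P := P₀) (g := g)
      (fun k => (hm k).trans (measurable_forget n).comap_le)
      (hF'le.trans (measurable_forget n).comap_le) condExp_toReal_rnDeriv_nonneg
      integrable_condExp hgkl (h.congr fun k => integral_congr_ae (by
        filter_upwards [tower (hm k), tower hF'le] with ω h1 h2
        rw [h1, h2]))
    have e {m : MeasurableSpace (ℕ → 𝒳 × 𝒴)}
        (hm : m ≤ MeasurableSpace.comap (forget n) MeasurableSpace.pi) :
        ∫ ω, InformationTheory.klFun ((P₀[g | m]) ω) ∂P₀ =
          ∫ ω, InformationTheory.klFun ((P₀[ρ | m]) ω) ∂P₀ :=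
      integral_congr_ae (by filter_upwards [tower hm] with ω h1; rw [h1])
    rw [e hF'le] at h1
    exact h1.congr fun k => e (hm k)
  have ha := (key (fun k => comap_obsState_le_forget (Nat.le_add_left n k)) hM).congr
    fun k => (InformationTheory.toReal_klDiv_map_of_ac hPP (measurable_obsState (k + n))).symm
  have hb := (key (fun k => comap_obs_le_forget (k + n + 1) n) hN).congr
    fun k => (InformationTheory.toReal_klDiv_map_of_ac hPP (measurable_obs (k + n + 1))).symm
  have hsub := ha.sub hb
  rw [sub_self] at hsub
  have hadd (k : ℕ) : InformationTheory.klDiv (P.map (obsState (k + n))) (P₀.map (obsState (k + n)))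
      = InformationTheory.klDiv (P.map (obs (k + n + 1))) (P₀.map (obs (k + n + 1)))
        + ∫⁻ y, klKernel (κ (k + n)) (η (k + n)) y ∂(P.map (obs (k + n + 1))) := by
    have hk := Nat.le_add_left n k
    have := Measure.isProbabilityMeasure_map (μ := P) (measurable_obs (k + n + 1)).aemeasurable
    have := Measure.isProbabilityMeasure_map (μ := P₀) (measurable_obs (k + n + 1)).aemeasurable
    rw [hκ _ hk, hη _ hk, InformationTheory.klDiv_compProd_eq_add, klDiv_compProd_eq_lintegral]
    exact ae_absolutelyContinuous_of_map_eq_compProd hPP (measurable_state _) (measurable_obs _)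
      (hκ _ hk) (hη _ hk)
  have hfa (k : ℕ) := hfinite (measurable_obsState (k + n))
    (funext fun ω => obsState_forget (Nat.le_add_left n k) ω)
  have hfe (k : ℕ) : ∫⁻ y, klKernel (κ (k + n)) (η (k + n)) y ∂(P.map (obs (k + n + 1))) ≠ ∞ :=
    ne_top_of_le_ne_top (hfa k) (by rw [hadd]; exact le_add_self)
  refine (ENNReal.tendsto_toReal_iff hfe ENNReal.zero_ne_top).1 ?_
  rw [ENNReal.toReal_zero]
  refine hsub.congr fun k => ?_
  have hfb : InformationTheory.klDiv (P.map (obs (k + n + 1))) (P₀.map (obs (k + n + 1))) ≠ ∞ :=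
    ne_top_of_le_ne_top (hfa k) (by rw [hadd]; exact le_self_add)
  rw [hadd, ENNReal.toReal_add hfb (hfe k), add_sub_cancel_left]

theorem map_obsState_reweight (h : (μ : Measure 𝒳) ≪ ν) {n k : ℕ} (hk : n ≤ k) :
    (reweight (strategicMeasure T Q μ γ) (strategicMeasure T Q ν γ) (obs (n + 1))).map
        (obsState k) =
      (reweight (strategicMeasure T Q μ γ) (strategicMeasure T Q ν γ) (obs (n + 1))).map
        (obs (k + 1)) ⊗ₘ condKernel T Q ν γ k (k + 1) := by
  have hle : ∀ i : Fin (n + 1), i.1 < k + 1 := fun i => by omega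
  let π : (Fin (k + 1) → 𝒴) → Fin (n + 1) → 𝒴 := fun y i => y ⟨i.1, hle i⟩
  have hπ : Measurable π := measurable_pi_lambda _ fun _ => measurable_pi_apply _
  exact map_reweight_eq_compProd (strategicMeasure_absolutelyContinuous h) hπ
    (measurable_obs (k + 1)) rfl (measurable_state k) (map_obs_prod_eq_compProd T Q ν γ k (k + 1))

theorem EvolvesFrom.withDensity_obs {n : ℕ} {P : Measure (ℕ → 𝒳 × 𝒴)} [IsFiniteMeasure P]
    (hP : EvolvesFrom T Q γ n P) {d : (Fin (n + 1) → 𝒴) → ℝ≥0∞} (hd : Measurable d)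
    (hfin : IsProbabilityMeasure (P.withDensity (d ∘ obs (n + 1)))) :
    EvolvesFrom T Q γ n (P.withDensity (d ∘ obs (n + 1))) := by
  let f : (Finset.Iic n → 𝒳 × 𝒴) → ℝ≥0∞ := fun z => d fun i : Fin (n + 1) =>
    (z ⟨i.1, Finset.mem_Iic.2 (Nat.lt_succ_iff.1 i.2)⟩).2
  have hf : Measurable f := hd.comp (measurable_pi_lambda _ fun i => (measurable_pi_apply _).snd)
  have e : d ∘ obs (n + 1) = fun ω : ℕ → 𝒳 × 𝒴 => f (Preorder.frestrictLe n ω) := rfl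
  rw [e] at hfin ⊢
  exact hP.withDensity hf

theorem evolvesFrom_reweight (h : (μ : Measure 𝒳) ≪ ν) (n : ℕ) : EvolvesFrom T Q γ n
    (reweight (strategicMeasure T Q μ γ) (strategicMeasure T Q ν γ) (obs (n + 1))) :=
  (evolvesFrom_strategicMeasure ν n).withDensity_obs (Measure.measurable_rnDeriv _ _)
    (isProbabilityMeasure_reweight (strategicMeasure_absolutelyContinuous h)
      (measurable_obs (n + 1)))

theorem klDiv_map_obsState_reweight (h : (μ : Measure 𝒳) ≪ ν) (n : ℕ) :
    InformationTheory.klDiv ((strategicMeasure T Q μ γ).map (obsState n))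
      ((reweight (strategicMeasure T Q μ γ) (strategicMeasure T Q ν γ) (obs (n + 1))).map
        (obsState n)) =
      ∫⁻ y, klKernel (condKernel T Q μ γ n (n + 1)) (condKernel T Q ν γ n (n + 1)) y
        ∂((strategicMeasure T Q μ γ).map (obs (n + 1))) := by
  rw [map_obsState_reweight h le_rfl,
    map_reweight (strategicMeasure_absolutelyContinuous h) (measurable_obs (n + 1)),
    ← klDiv_compProd_eq_lintegral (ae_condKernel_absolutelyContinuous h n (n + 1)),
    ← map_obs_prod_eq_compProd]
  rfl

/-- If the expected relative entropy of the filters is finite at some time, then merging in total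
variation implies merging in relative entropy. The law with prior `ν` is reweighted so as to give
the measurements up to that time the same law as the prior `μ`, which makes the relative entropy of
`(Y₀, …, Yₙ, Xₙ)` equal to the expected relative entropy of the filters. -/
theorem TVMergeExp.entropyMerge (h : (μ : Measure 𝒳) ≪ ν)
    (hfin : ∃ n : ℕ, ∫⁻ y, InformationTheory.klDiv (filterAt T Q μ γ n y) (filterAt T Q ν γ n y)
      ∂(measurementLaw T Q μ γ) < ∞)
    (hE : TVMergeExp (measurementLaw T Q μ γ) (filterAt T Q μ γ) (filterAt T Q ν γ)) :
    EntropyMerge (measurementLaw T Q μ γ) (filterAt T Q μ γ) (filterAt T Q ν γ) := by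
  obtain ⟨n, hn⟩ := hfin
  unfold TVMergeExp filterAt at hE
  unfold EntropyMerge filterAt
  unfold filterAt at hn
  simp only [lintegral_tvDist_condState h] at hE
  simp only [lintegral_klDiv_condState h] at hn ⊢
  have hPP := strategicMeasure_absolutelyContinuous (T := T) (Q := Q) (γ := γ) h
  have hR := isProbabilityMeasure_reweight hPP (measurable_obs (n + 1))
  refine tendsto_lintegral_klKernel (n := n) (T := T) (Q := Q) (γ := γ)
    (P₀ := reweight (strategicMeasure T Q μ γ) (strategicMeasure T Q ν γ) (obs (n + 1)))
    (absolutelyContinuous_reweight hPP (measurable_obs (n + 1)))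
    (evolvesFrom_strategicMeasure μ n) (evolvesFrom_reweight h n)
    (fun k _ => map_obs_prod_eq_compProd T Q μ γ k (k + 1)) (fun k hk => map_obsState_reweight h hk)
    (by rw [klDiv_map_obsState_reweight h]; exact hn.ne) hE

/-- Pinsker's inequality in the weak form `δ ‖p - r‖ ≤ D(p ‖ r) + δ²`. -/
theorem EntropyMerge.tvMergeExp {L : Measure (ℕ → 𝒴)} [IsProbabilityMeasure L]
    {p r : ℕ → (ℕ → 𝒴) → Measure 𝒳} [∀ n y, IsProbabilityMeasure (p n y)]
    [∀ n y, IsProbabilityMeasure (r n y)] (h : EntropyMerge L p r) : TVMergeExp L p r := by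
  have bound (δ : ℝ) (h0 : 0 < δ) (h1 : δ ≤ 1) (n : ℕ) :
      ENNReal.ofReal δ * ∫⁻ y, tvDist (p n y) (r n y) ∂L ≤
        ∫⁻ y, InformationTheory.klDiv (p n y) (r n y) ∂L + ENNReal.ofReal (δ ^ 2) := by
    rw [← lintegral_const_mul' _ _ ENNReal.ofReal_ne_top]
    calc ∫⁻ y, ENNReal.ofReal δ * tvDist (p n y) (r n y) ∂L
        ≤ ∫⁻ y, (InformationTheory.klDiv (p n y) (r n y) + ENNReal.ofReal (δ ^ 2)) ∂L :=
          lintegral_mono fun y => mul_tvDist_le_klDiv _ _ h0.le h1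
      _ = _ := by
          rw [lintegral_add_right _ measurable_const]
          simp
  unfold TVMergeExp
  rw [ENNReal.tendsto_atTop_zero]
  intro ε hε
  by_cases hε1 : ε = ∞
  · exact ⟨0, fun _ _ => by simp [hε1]⟩
  -- with `δ ≤ ε / 2`, it suffices that the entropy is at most `δ²`
  set δ : ℝ := min 1 (ε.toReal / 2) with hδ
  have hε0 : 0 < ε.toReal := ENNReal.toReal_pos hε.ne' hε1
  have hδ0 : 0 < δ := lt_min one_pos (by positivity)
  obtain ⟨N, hN⟩ := ENNReal.tendsto_atTop_zero.1 h (ENNReal.ofReal (δ ^ 2))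
    (ENNReal.ofReal_pos.2 (by positivity))
  refine ⟨N, fun n hn => ?_⟩
  have h1 : ENNReal.ofReal δ * ∫⁻ y, tvDist (p n y) (r n y) ∂L ≤
      ENNReal.ofReal δ * ENNReal.ofReal (2 * δ) := by
    refine (bound δ hδ0 (min_le_left _ _) n).trans ((add_le_add_left (hN n hn) _).trans_eq ?_)
    rw [← ENNReal.ofReal_add (by positivity) (by positivity), ← ENNReal.ofReal_mul hδ0.le]
    ring_nf
  rw [ENNReal.mul_le_mul_iff_right (ENNReal.ofReal_pos.2 hδ0).ne' ENNReal.ofReal_ne_top] at h1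
  refine h1.trans (ENNReal.ofReal_le_of_le_toReal ?_)
  have := min_le_right 1 (ε.toReal / 2)
  linarith

end Entropy

/-! ### Weak merging is uniform over partitions of unity -/

section Schur

/-- **Schur's lemma**: weak convergence to `0` in `ℓ¹` is norm convergence. The proof applies
Baire's theorem to the compact space of sign sequences. -/
theorem tendsto_tsum_abs_of_forall_tendsto {a : ℕ → ℕ → ℝ} (hs : ∀ n, Summable fun j => |a n j|)
    (h : ∀ c : ℕ → ℝ, (∀ j, |c j| ≤ 1) → Tendsto (fun n => ∑' j, c j * a n j) atTop (𝓝 0)) :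
    Tendsto (fun n => ∑' j, |a n j|) atTop (𝓝 0) := by
  have hcoord (j : ℕ) : Tendsto (fun n => |a n j|) atTop (𝓝 0) := by
    have h1 := (h (Pi.single j 1) fun i => by
      by_cases hi : i = j
      · subst hi; simp
      · simp [hi]).abs
    rw [abs_zero] at h1
    refine h1.congr fun n => ?_
    rw [tsum_eq_single j fun i hi => by simp [hi]]
    simp
  let s : Bool → ℝ := fun b => if b then 1 else -1
  have hsabs (b : Bool) : |s b| = 1 := by cases b <;> simp [s]
  have hsum (n : ℕ) (c : ℕ → Bool) : Summable fun j => s (c j) * a n j :=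
    (hs n).of_norm_bounded fun j => by simp [hsabs]
  have hcont (n : ℕ) : Continuous fun c : ℕ → Bool => ∑' j, s (c j) * a n j := by
    refine continuous_tsum (fun j => ?_) (hs n) fun j c => by simp [hsabs]
    exact ((continuous_of_discreteTopology (f := s)).comp (continuous_apply j)).mul
      continuous_const
  rw [Metric.tendsto_atTop]
  intro ε hε
  have hclosed (N : ℕ) :
      IsClosed {c : ℕ → Bool | ∀ n, N ≤ n → |∑' j, s (c j) * a n j| ≤ ε / 4} := by
    simp only [Set.ofPred_forall]
    exact isClosed_iInter fun n => isClosed_iInter fun _ =>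
      isClosed_le (hcont n).abs continuous_const
  have hunion : ⋃ N : ℕ, {c : ℕ → Bool | ∀ n, N ≤ n → |∑' j, s (c j) * a n j| ≤ ε / 4} =
      Set.univ := by
    refine Set.eq_univ_of_forall fun c => Set.mem_iUnion.2 ?_
    obtain ⟨N, hN⟩ := Metric.tendsto_atTop.1 (h (fun j => s (c j)) fun j => (hsabs _).le) (ε / 4)
      (by positivity)
    refine ⟨N, fun n hn => ?_⟩
    have := hN n hn
    rw [Real.dist_0_eq_abs] at this
    exact this.le
  obtain ⟨N, c₀, hc₀⟩ := nonempty_interior_of_iUnion_of_closed hclosed hunion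
  -- a whole cylinder over a finite set `I` of coordinates is uniformly bounded
  obtain ⟨I, u, hu, hsub⟩ := isOpen_pi_iff.1 isOpen_interior c₀ hc₀
  have hI : Tendsto (fun n => ∑ j ∈ I, |a n j|) atTop (𝓝 0) := by
    simpa using tendsto_finsetSum I fun j _ => hcoord j
  obtain ⟨N', hN'⟩ := Metric.tendsto_atTop.1 hI (ε / 4) (by positivity)
  refine ⟨max N N', fun n hn => ?_⟩
  have hIn := hN' n ((le_max_right _ _).trans hn)
  rw [Real.dist_0_eq_abs, abs_of_nonneg (Finset.sum_nonneg fun _ _ => abs_nonneg _)] at hIn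
  rw [Real.dist_0_eq_abs, abs_of_nonneg (tsum_nonneg fun _ => abs_nonneg _)]
  -- off `I`, choose the signs of `a n`
  let c : ℕ → Bool := fun j => if j ∈ I then c₀ j else decide (0 ≤ a n j)
  have hc : c ∈ interior {c : ℕ → Bool | ∀ n, N ≤ n → |∑' j, s (c j) * a n j| ≤ ε / 4} := by
    refine hsub fun j hj => ?_
    have hj' : j ∈ I := hj
    simp only [c, hj', if_true]
    exact (hu j hj').2
  have hcn := interior_subset hc n ((le_max_left _ _).trans hn)
  have hle : ∑' j, |a n j| ≤ ∑' j, s (c j) * a n j + ∑ j ∈ I, 2 * |a n j| := by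
    have hind : HasSum (fun j => if j ∈ I then 2 * |a n j| else 0) (∑ j ∈ I, 2 * |a n j|) := by
      have : HasSum (fun j => if j ∈ I then 2 * |a n j| else 0)
          (∑ j ∈ I, if j ∈ I then 2 * |a n j| else 0) :=
        hasSum_sum_of_ne_finset_zero fun j hj => by simp [hj]
      rwa [Finset.sum_congr rfl fun j hj => by rw [if_pos hj]] at this
    rw [← hind.tsum_eq, ← (hsum n c).tsum_add hind.summable]
    refine (hs n).tsum_le_tsum (fun j => ?_) ((hsum n c).add hind.summable)
    by_cases hj : j ∈ I
    · have h1 : |s (c j) * a n j| = |a n j| := by rw [abs_mul, hsabs, one_mul]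
      have h2 := neg_abs_le (s (c j) * a n j)
      simp only [hj, if_true]
      linarith
    · simp only [hj, if_false, add_zero, c]
      by_cases ha : 0 ≤ a n j
      · simp [ha, s, abs_of_nonneg ha]
      · simp [ha, s, abs_of_neg (not_le.1 ha)]
  rw [← Finset.mul_sum] at hle
  have := le_abs_self (∑' j, s (c j) * a n j)
  have h3 : |∑' j, s (c j) * a n j| ≤ ε / 4 := hcn
  linarith

end Schur

section Partition

variable {X : Type*} [TopologicalSpace X] [MeasurableSpace X] [BorelSpace X]
  (w : PartitionOfUnity ℕ X)

theorem hasSum_partitionOfUnity (x : X) : HasSum (fun j => w j x) 1 := by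
  have hfin : (Function.support fun j => w j x).Finite := w.locallyFinite.point_finite x
  have h : Summable fun j => w j x := summable_of_hasFiniteSupport hfin
  rw [← w.sum_eq_one (Set.mem_univ x), ← tsum_eq_finsum (L := .unconditional ℕ) hfin]
  exact h.hasSum

theorem abs_mul_partitionOfUnity_le {c C : ℝ} (hc : |c| ≤ C) (j : ℕ) (x : X) :
    ‖c * w j x‖ ≤ C * w j x := by
  rw [norm_mul, Real.norm_eq_abs, Real.norm_eq_abs, abs_of_nonneg (w.nonneg j x)]
  exact mul_le_mul_of_nonneg_right hc (w.nonneg j x)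

theorem summable_mul_partitionOfUnity {c : ℕ → ℝ} {C : ℝ} (hc : ∀ j, |c j| ≤ C) (x : X) :
    Summable fun j => c j * w j x :=
  ((hasSum_partitionOfUnity w x).summable.mul_left C).of_norm_bounded
    fun j => abs_mul_partitionOfUnity_le w (hc j) j x

theorem abs_tsum_mul_partitionOfUnity_le {c : ℕ → ℝ} {C : ℝ} (hc : ∀ j, |c j| ≤ C) (x : X) :
    |∑' j, c j * w j x| ≤ C := by
  have := tsum_of_norm_bounded ((hasSum_partitionOfUnity w x).mul_left C)
    fun j => abs_mul_partitionOfUnity_le w (hc j) j x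
  simpa using this

theorem continuous_tsum_mul_partitionOfUnity (c : ℕ → ℝ) :
    Continuous fun x => ∑' j, c j * w j x := by
  have h := w.continuous_finsum_smul (g := fun j _ => c j) fun _ _ _ => continuousAt_const
  refine h.congr fun x => ?_
  rw [tsum_eq_finsum]
  · exact finsum_congr fun j => mul_comm _ _
  · refine (w.locallyFinite.point_finite x).subset fun j hj => ?_
    exact right_ne_zero_of_mul hj

theorem hasSum_integral_partitionOfUnity (P : Measure X) [IsFiniteMeasure P] {c : ℕ → ℝ} {C : ℝ}
    (hc : ∀ j, |c j| ≤ C) :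
    HasSum (fun j => c j * ∫ x, w j x ∂P) (∫ x, ∑' j, c j * w j x ∂P) := by
  have := hasSum_integral_of_dominated_convergence (μ := P) (F := fun j x => c j * w j x)
    (f := fun x => ∑' j, c j * w j x) (fun j x => C * w j x)
    (fun j => ((continuous_const.mul (w j).continuous).measurable).aestronglyMeasurable)
    (fun j => ae_of_all _ fun x => abs_mul_partitionOfUnity_le w (hc j) j x)
    (ae_of_all _ fun x => (hasSum_partitionOfUnity w x).summable.mul_left C)
    (by
      have e (x : X) : ∑' j, C * w j x = C := by
        rw [tsum_mul_left, (hasSum_partitionOfUnity w x).tsum_eq, mul_one]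
      simp only [e]
      exact integrable_const _)
    (ae_of_all _ fun x => (summable_mul_partitionOfUnity w hc x).hasSum)
  simpa only [integral_const_mul] using this

theorem hasSum_integral_partitionOfUnity_one (P : Measure X) [IsProbabilityMeasure P] :
    HasSum (fun j => ∫ x, w j x ∂P) 1 := by
  have := hasSum_integral_partitionOfUnity w P (c := fun _ => 1) (C := 1) (fun _ => by simp)
  simpa only [one_mul, (hasSum_partitionOfUnity w _).tsum_eq, integral_const, probReal_univ,
    smul_eq_mul, mul_one] using this

variable (P P' : Measure X) [IsProbabilityMeasure P] [IsProbabilityMeasure P']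

theorem summable_abs_integral_sub_partitionOfUnity :
    Summable fun j => |∫ x, w j x ∂P - ∫ x, w j x ∂P'| :=
  ((hasSum_integral_partitionOfUnity_one w P).summable.sub
    (hasSum_integral_partitionOfUnity_one w P').summable).abs

theorem tsum_abs_integral_sub_partitionOfUnity_le :
    ∑' j, ENNReal.ofReal |∫ x, w j x ∂P - ∫ x, w j x ∂P'| ≤ 2 := by
  have h0 (P : Measure X) (j : ℕ) : 0 ≤ ∫ x, w j x ∂P := integral_nonneg fun x => w.nonneg j x
  have h1 (P : Measure X) [IsProbabilityMeasure P] : ∑' j, ENNReal.ofReal (∫ x, w j x ∂P) = 1 := by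
    have := hasSum_integral_partitionOfUnity_one w P
    rw [← ENNReal.ofReal_tsum_of_nonneg (h0 P) this.summable, this.tsum_eq, ENNReal.ofReal_one]
  calc ∑' j, ENNReal.ofReal |∫ x, w j x ∂P - ∫ x, w j x ∂P'|
      ≤ ∑' j, (ENNReal.ofReal (∫ x, w j x ∂P) + ENNReal.ofReal (∫ x, w j x ∂P')) := by
        refine ENNReal.tsum_le_tsum fun j => ?_
        rw [← ENNReal.ofReal_add (h0 P j) (h0 P' j)]
        refine ENNReal.ofReal_le_ofReal ((abs_sub _ _).trans_eq ?_)
        rw [abs_of_nonneg (h0 P j), abs_of_nonneg (h0 P' j)]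
    _ = 2 := by rw [ENNReal.tsum_add, h1, h1, one_add_one_eq_two]

/-- Two laws that are close on a partition of unity are close on every bounded function that
oscillates little on its pieces. -/
theorem abs_integral_sub_le_of_partitionOfUnity {u : X → ℝ} (hu : Measurable u) {C δ : ℝ}
    (hC : ∀ x, |u x| ≤ C) {z : ℕ → X} (hδ : ∀ j x, w j x ≠ 0 → |u x - u (z j)| ≤ δ) :
    |∫ x, u x ∂P - ∫ x, u x ∂P'| ≤
      2 * δ + C * ∑' j, |∫ x, w j x ∂P - ∫ x, w j x ∂P'| := by
  set v : X → ℝ := fun x => ∑' j, u (z j) * w j x with hv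
  have hvc : Continuous v := continuous_tsum_mul_partitionOfUnity w _
  have hui (P : Measure X) [IsProbabilityMeasure P] : Integrable u P :=
    Integrable.of_bound hu.aestronglyMeasurable C (ae_of_all _ hC)
  have hvi (P : Measure X) [IsProbabilityMeasure P] : Integrable v P :=
    Integrable.of_bound hvc.measurable.aestronglyMeasurable C
      (ae_of_all _ fun x => abs_tsum_mul_partitionOfUnity_le w (fun j => hC _) x)
  have huv (x : X) : |u x - v x| ≤ δ := by
    have h1 : HasSum (fun j => u x * w j x - u (z j) * w j x) (u x - v x) := by
      have := (hasSum_partitionOfUnity w x).mul_left (u x)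
      rw [mul_one] at this
      exact this.sub (summable_mul_partitionOfUnity w (fun j => hC (z j)) x).hasSum
    have h2 := tsum_of_norm_bounded ((hasSum_partitionOfUnity w x).mul_left δ)
      (f := fun j => u x * w j x - u (z j) * w j x) fun j => by
        rw [← sub_mul]
        by_cases hj : w j x = 0
        · simp [hj]
        · exact abs_mul_partitionOfUnity_le w (hδ j x hj) j x
    rw [h1.tsum_eq] at h2
    simpa using h2
  have h1 (P : Measure X) [IsProbabilityMeasure P] : |∫ x, u x ∂P - ∫ x, v x ∂P| ≤ δ := by
    rw [← integral_sub (hui P) (hvi P)]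
    have := norm_integral_le_of_norm_le_const (μ := P) (f := fun x => u x - v x) (C := δ)
      (ae_of_all _ huv)
    simpa using this
  have h2 : |∫ x, v x ∂P - ∫ x, v x ∂P'| ≤ C * ∑' j, |∫ x, w j x ∂P - ∫ x, w j x ∂P'| := by
    have h3 := (hasSum_integral_partitionOfUnity w P (c := fun j => u (z j)) fun j => hC _).sub
      (hasSum_integral_partitionOfUnity w P' (c := fun j => u (z j)) fun j => hC _)
    have h4 := tsum_of_norm_bounded
      ((summable_abs_integral_sub_partitionOfUnity w P P').hasSum.mul_left C)
      (f := fun j => u (z j) * ∫ x, w j x ∂P - u (z j) * ∫ x, w j x ∂P') fun j => by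
        rw [← mul_sub, norm_mul]
        exact mul_le_mul_of_nonneg_right (hC _) (norm_nonneg _)
    rw [h3.tsum_eq] at h4
    exact h4
  have h3 := h1 P
  have h4 := h1 P'
  rw [abs_le] at *
  constructor <;> linarith

/-- Weak merging forces merging in `ℓ¹` on every partition of unity. -/
theorem tendsto_tsum_abs_integral_sub_partitionOfUnity {p r : ℕ → Measure X}
    [∀ n, IsProbabilityMeasure (p n)] [∀ n, IsProbabilityMeasure (r n)]
    (h : ∀ f : X →ᵇ ℝ, Tendsto (fun n => |∫ x, f x ∂(p n) - ∫ x, f x ∂(r n)|) atTop (𝓝 0)) :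
    Tendsto (fun n => ∑' j, ENNReal.ofReal |∫ x, w j x ∂(p n) - ∫ x, w j x ∂(r n)|) atTop
      (𝓝 0) := by
  have key := tendsto_tsum_abs_of_forall_tendsto
    (a := fun n j => ∫ x, w j x ∂(p n) - ∫ x, w j x ∂(r n))
    (fun n => summable_abs_integral_sub_partitionOfUnity w (p n) (r n)) fun c hc => by
      let f : X →ᵇ ℝ := BoundedContinuousFunction.ofNormedAddCommGroup
        (fun x => ∑' j, c j * w j x) (continuous_tsum_mul_partitionOfUnity w c) 1
        (abs_tsum_mul_partitionOfUnity_le w hc)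
      refine ((tendsto_zero_iff_abs_tendsto_zero _).2 (h f)).congr fun n => ?_
      have := (hasSum_integral_partitionOfUnity w (p n) hc).sub
        (hasSum_integral_partitionOfUnity w (r n) hc)
      simp only [← mul_sub] at this
      exact this.tsum_eq.symm
  have := ENNReal.tendsto_ofReal key
  rw [ENNReal.ofReal_zero] at this
  refine this.congr fun n => ?_
  exact ENNReal.ofReal_tsum_of_nonneg (fun _ => abs_nonneg _)
    (summable_abs_integral_sub_partitionOfUnity w (p n) (r n))

end Partition

section ChannelPartition

variable {𝒳 𝒴 : Type*} [TopologicalSpace 𝒳] [PolishSpace 𝒳] [MeasurableSpace 𝒳] [BorelSpace 𝒳]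
  [Nonempty 𝒳] [MeasurableSpace 𝒴] {Q : Kernel 𝒳 𝒴} [IsMarkovKernel Q]

theorem eventually_tvDist_le (hQ : ChannelTVContinuous Q) (x : 𝒳) {δ : ℝ≥0∞} (hδ : 0 < δ) :
    ∀ᶠ x' in 𝓝 x, tvDist (Q x') (Q x) ≤ δ := by
  have : Tendsto (fun x' => tvDist (Q x') (Q x)) (𝓝 x) (𝓝 0) :=
    tendsto_nhds_iff_seq_tendsto.2 fun a ha => hQ a x ha
  exact (this.eventually (gt_mem_nhds hδ)).mono fun _ h => h.le

/-- A partition of unity on whose pieces both `f` and the channel oscillate by at most `δ`. -/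
theorem exists_partitionOfUnity (hQ : ChannelTVContinuous Q) (f : 𝒳 →ᵇ ℝ) {δ : ℝ} (hδ : 0 < δ) :
    ∃ (w : PartitionOfUnity ℕ 𝒳) (z : ℕ → 𝒳), ∀ j x, w j x ≠ 0 →
      |f x - f (z j)| ≤ δ ∧ tvDist (Q x) (Q (z j)) ≤ ENNReal.ofReal δ := by
  let := TopologicalSpace.upgradeIsCompletelyMetrizable 𝒳
  set V : 𝒳 → Set 𝒳 := fun x => {x' | |f x' - f x| ≤ δ ∧
    tvDist (Q x') (Q x) ≤ ENNReal.ofReal δ} with hV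
  have hVn (x : 𝒳) : interior (V x) ∈ 𝓝 x := by
    rw [interior_mem_nhds]
    refine Filter.inter_mem ?_ (eventually_tvDist_le hQ x (ENNReal.ofReal_pos.2 hδ))
    have h1 : Tendsto (fun x' => |f x' - f x|) (𝓝 x) (𝓝 0) := by
      have : Continuous fun x' => |f x' - f x| := by fun_prop
      simpa using this.tendsto x
    exact (h1.eventually (gt_mem_nhds hδ)).mono fun _ h => le_of_lt h
  obtain ⟨s, hs, hcover⟩ := TopologicalSpace.countable_cover_nhds hVn
  have hne : s.Nonempty := by
    by_contra hs0
    rw [Set.not_nonempty_iff_eq_empty.1 hs0, Set.biUnion_empty] at hcover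
    exact Set.empty_ne_univ hcover
  obtain ⟨z, rfl⟩ := hs.exists_eq_range hne
  obtain ⟨w, hw⟩ := PartitionOfUnity.exists_isSubordinate isClosed_univ
    (fun j => interior (V (z j))) (fun j => isOpen_interior) (by
      rw [← hcover, Set.biUnion_range])
  refine ⟨w, z, fun j x hx => ?_⟩
  have : x ∈ V (z j) := interior_subset (hw j (subset_tsupport _ hx))
  exact this

end ChannelPartition

/-! ### From weak merging of the predictor to weak merging of the filter -/

theorem abs_integral_le_of_abs_le {α : Type*} [MeasurableSpace α] (P : Measure α)
    [IsProbabilityMeasure P] {f : α → ℝ} {C : ℝ} (h : ∀ x, |f x| ≤ C) : |∫ x, f x ∂P| ≤ C := by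
  have := norm_integral_le_of_norm_le_const (μ := P) (f := f) (ae_of_all _ h)
  simpa using this

theorem abs_integral_sub_le_mul_of_tvDist_le {α : Type*} [MeasurableSpace α] (P P' : Measure α)
    [IsProbabilityMeasure P] [IsProbabilityMeasure P'] {f : α → ℝ} (hf : Measurable f) {C δ : ℝ}
    (hC : 0 < C) (hδ : 0 ≤ δ) (hfC : ∀ x, |f x| ≤ C) (h : tvDist P P' ≤ ENNReal.ofReal δ) :
    |∫ x, f x ∂P - ∫ x, f x ∂P'| ≤ C * δ := by
  have h1 := (abs_integral_sub_le_tvDist P P' (f := fun x => C⁻¹ * f x) (by fun_prop) fun x => by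
    rw [abs_mul, abs_of_pos (inv_pos.2 hC), inv_mul_le_iff₀ hC, mul_one]
    exact hfC x).trans h
  rw [ENNReal.ofReal_le_ofReal_iff hδ, integral_const_mul, integral_const_mul, ← mul_sub, abs_mul,
    abs_of_pos (inv_pos.2 hC), inv_mul_le_iff₀ hC] at h1
  exact h1

section CondIntegrals

variable {𝒳 𝒴 𝒰 : Type*} [MeasurableSpace 𝒳] [MeasurableSpace 𝒴] [MeasurableSpace 𝒰]
  [StandardBorelSpace 𝒳] [Nonempty 𝒳]
  {T : Kernel (𝒳 × 𝒰) 𝒳} [IsMarkovKernel T] {Q : Kernel 𝒳 𝒴} [IsMarkovKernel Q]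
  {μ ν : ProbabilityMeasure 𝒳} {γ : Policy 𝒴 𝒰}

theorem lintegral_measurementLaw_eq_obs {m : ℕ} {f : (Fin m → 𝒴) → ℝ≥0∞} (hf : Measurable f) :
    ∫⁻ y, f (history m y) ∂(measurementLaw T Q μ γ) =
      ∫⁻ ω, f (obs m ω) ∂(strategicMeasure T Q μ γ) := by
  rw [lintegral_measurementLaw_history hf, lintegral_map hf (measurable_obs m)]

/-- Integrate out `Xₙ` given `Y₀, …, Yₘ₋₁`. -/
theorem integral_obs_prod_state (n m : ℕ) {F : (Fin m → 𝒴) × 𝒳 → ℝ} (hF : Measurable F) {C : ℝ}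
    (hC : ∀ z, |F z| ≤ C) :
    ∫ ω, F (obs m ω, (ω n).1) ∂(strategicMeasure T Q μ γ) =
      ∫ ω, ∫ x, F (obs m ω, x) ∂(condKernel T Q μ γ n m (obs m ω))
        ∂(strategicMeasure T Q μ γ) := by
  have hm := (measurable_obs (𝒳 := 𝒳) (𝒴 := 𝒴) m).prodMk (measurable_state n)
  have hP := Measure.isProbabilityMeasure_map (μ := strategicMeasure T Q μ γ)
    (measurable_obs m).aemeasurable
  have hG : StronglyMeasurable fun y => ∫ x, F (y, x) ∂(condKernel T Q μ γ n m y) :=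
    StronglyMeasurable.integral_kernel_prod_right' hF.stronglyMeasurable
  rw [← integral_map (φ := fun ω : ℕ → 𝒳 × 𝒴 => (obs m ω, (ω n).1)) (f := F) hm.aemeasurable
      hF.aestronglyMeasurable, map_obs_prod_eq_compProd,
    Measure.integral_compProd (Integrable.of_bound hF.aestronglyMeasurable C (ae_of_all _ hC)),
    integral_map (measurable_obs m).aemeasurable hG.aestronglyMeasurable]

/-- Integrate out first `Yₙ` given `Xₙ`, and then `Xₙ` given `Y₀, …, Yₙ₋₁`. -/
theorem integral_obsPred_prod (n : ℕ) {F : ((Fin n → 𝒴) × 𝒳) × 𝒴 → ℝ} (hF : Measurable F) {C : ℝ}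
    (hC : ∀ z, |F z| ≤ C) :
    ∫ ω, F (obsPred n ω, (ω n).2) ∂(strategicMeasure T Q μ γ) =
      ∫ ω, ∫ x, ∫ y, F ((obs n ω, x), y) ∂(Q x) ∂(condKernel T Q μ γ n n (obs n ω))
        ∂(strategicMeasure T Q μ γ) := by
  have hm : Measurable fun ω : ℕ → 𝒳 × 𝒴 => (obsPred n ω, (ω n).2) :=
    (measurable_obsPred n).prodMk (measurable_pi_apply n).snd
  have hP := Measure.isProbabilityMeasure_map (μ := strategicMeasure T Q μ γ)
    (measurable_obsPred n).aemeasurable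
  have hG : StronglyMeasurable fun z : (Fin n → 𝒴) × 𝒳 =>
      ∫ y, F (z, y) ∂(Kernel.prodMkLeft (Fin n → 𝒴) Q z) :=
    StronglyMeasurable.integral_kernel_prod_right' hF.stronglyMeasurable
  rw [← integral_map (φ := fun ω : ℕ → 𝒳 × 𝒴 => (obsPred n ω, (ω n).2)) (f := F) hm.aemeasurable
      hF.aestronglyMeasurable, map_obsPred_prod,
    Measure.integral_compProd (Integrable.of_bound hF.aestronglyMeasurable C (ae_of_all _ hC)),
    integral_map (measurable_obsPred n).aemeasurable hG.aestronglyMeasurable]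
  refine integral_obs_prod_state n n hG.measurable (C := C) fun z => ?_
  exact abs_integral_le_of_abs_le _ fun y => hC _

/-- The defining property of the conditional law of `Xₙ` given `Y₀, …, Yₘ₋₁`. -/
theorem integral_mul_state_sub_eq_zero (n m : ℕ) {g : (Fin m → 𝒴) → ℝ} (hg : Measurable g) {C : ℝ}
    (hC : ∀ y, |g y| ≤ C) {f : 𝒳 → ℝ} (hf : Measurable f) {D : ℝ} (hD : ∀ x, |f x| ≤ D) :
    ∫ ω, g (obs m ω) * (f (ω n).1 - ∫ x, f x ∂(condKernel T Q μ γ n m (obs m ω)))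
      ∂(strategicMeasure T Q μ γ) = 0 := by
  have hφ : Measurable fun y => ∫ x, f x ∂(condKernel T Q μ γ n m y) :=
    (hf.stronglyMeasurable.integral_kernel (κ := condKernel T Q μ γ n m)).measurable
  have hφD (y) : |∫ x, f x ∂(condKernel T Q μ γ n m y)| ≤ D :=
    abs_integral_le_of_abs_le _ hD
  have h := integral_obs_prod_state (T := T) (Q := Q) (μ := μ) (γ := γ) n m
    (F := fun z => g z.1 * (f z.2 - ∫ x, f x ∂(condKernel T Q μ γ n m z.1)))
    ((hg.comp measurable_fst).mul ((hf.comp measurable_snd).sub (hφ.comp measurable_fst)))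
    (C := C * (D + D)) fun z => by
      rw [abs_mul]
      exact mul_le_mul (hC _) ((abs_sub _ _).trans (add_le_add (hD _) (hφD _))) (abs_nonneg _)
        ((abs_nonneg _).trans (hC z.1))
  refine h.trans ?_
  have e (y : Fin m → 𝒴) : ∫ x, g y * (f x - ∫ x, f x ∂(condKernel T Q μ γ n m y))
      ∂(condKernel T Q μ γ n m y) = 0 := by
    rw [integral_const_mul, integral_sub (Integrable.of_bound hf.aestronglyMeasurable D
      (ae_of_all _ hD)) (integrable_const _)]
    simp
  simp only [e, integral_zero]

variable (T Q μ γ) in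
/-- The conditional expectation of `f Xₙ` given `Y₀, …, Yₙ`, as a function of these. -/
def filterMean (f : 𝒳 → ℝ) (n : ℕ) (y : Fin (n + 1) → 𝒴) : ℝ :=
  ∫ x, f x ∂(condKernel T Q μ γ n (n + 1) y)

theorem measurable_filterMean {f : 𝒳 → ℝ} (hf : Measurable f) (n : ℕ) :
    Measurable (filterMean T Q μ γ f n) :=
  (hf.stronglyMeasurable.integral_kernel (κ := condKernel T Q μ γ n (n + 1))).measurable

theorem abs_filterMean_le {f : 𝒳 → ℝ} {D : ℝ} (hD : ∀ x, |f x| ≤ D) (n : ℕ)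
    (y : Fin (n + 1) → 𝒴) : |filterMean T Q μ γ f n y| ≤ D :=
  abs_integral_le_of_abs_le _ hD

/-- The sign of the difference of the two filter means, with the value `1` at `0`. -/
def filterSign (T : Kernel (𝒳 × 𝒰) 𝒳) [IsMarkovKernel T] (Q : Kernel 𝒳 𝒴) [IsMarkovKernel Q]
    (μ ν : ProbabilityMeasure 𝒳) (γ : Policy 𝒴 𝒰) (f : 𝒳 → ℝ) (n : ℕ) (y : Fin (n + 1) → 𝒴) : ℝ :=
  if 0 ≤ filterMean T Q μ γ f n y - filterMean T Q ν γ f n y then 1 else -1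

theorem measurable_filterSign {f : 𝒳 → ℝ} (hf : Measurable f) (n : ℕ) :
    Measurable (filterSign T Q μ ν γ f n) :=
  Measurable.ite (measurableSet_le measurable_const
    ((measurable_filterMean hf n).sub (measurable_filterMean hf n))) measurable_const
    measurable_const

theorem abs_filterSign (f : 𝒳 → ℝ) (n : ℕ) (y : Fin (n + 1) → 𝒴) :
    |filterSign T Q μ ν γ f n y| = 1 := by
  unfold filterSign
  split_ifs <;> simp

theorem filterSign_mul (f : 𝒳 → ℝ) (n : ℕ) (y : Fin (n + 1) → 𝒴) :
    filterSign T Q μ ν γ f n y * (filterMean T Q μ γ f n y - filterMean T Q ν γ f n y) =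
      |filterMean T Q μ γ f n y - filterMean T Q ν γ f n y| := by
  unfold filterSign
  split_ifs with h
  · rw [one_mul, abs_of_nonneg h]
  · rw [neg_one_mul, abs_of_neg (not_le.1 h)]

/-- The error `f(Xₙ) - E^ν[f(Xₙ) | Y₀, …, Yₙ]`, signed so as to have the mean
`E^μ |πₙ^μ f - πₙ^ν f|`, and averaged over `Yₙ` given `Xₙ = x`. -/
def channelError (T : Kernel (𝒳 × 𝒰) 𝒳) [IsMarkovKernel T] (Q : Kernel 𝒳 𝒴) [IsMarkovKernel Q]
    (μ ν : ProbabilityMeasure 𝒳) (γ : Policy 𝒴 𝒰) (f : 𝒳 → ℝ) (n : ℕ) (y : Fin n → 𝒴) (x : 𝒳) : ℝ :=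
  ∫ y', filterSign T Q μ ν γ f n (Fin.snoc (α := fun _ => 𝒴) y y') *
    (f x - filterMean T Q ν γ f n (Fin.snoc (α := fun _ => 𝒴) y y')) ∂(Q x)

theorem measurable_channelError_integrand {f : 𝒳 → ℝ} (hf : Measurable f) (n : ℕ) :
    Measurable fun z : ((Fin n → 𝒴) × 𝒳) × 𝒴 =>
      filterSign T Q μ ν γ f n (Fin.snoc (α := fun _ => 𝒴) z.1.1 z.2) *
        (f z.1.2 - filterMean T Q ν γ f n (Fin.snoc (α := fun _ => 𝒴) z.1.1 z.2)) := by
  have hs : Measurable fun z : ((Fin n → 𝒴) × 𝒳) × 𝒴 =>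
      (Fin.snoc (α := fun _ => 𝒴) z.1.1 z.2 : Fin (n + 1) → 𝒴) :=
    (measurable_snoc n).comp ((measurable_fst.comp measurable_fst).prodMk measurable_snd)
  exact ((measurable_filterSign hf n).comp hs).mul
    ((hf.comp (measurable_snd.comp measurable_fst)).sub ((measurable_filterMean hf n).comp hs))

theorem measurable_channelError {f : 𝒳 → ℝ} (hf : Measurable f) (n : ℕ) :
    Measurable fun z : (Fin n → 𝒴) × 𝒳 => channelError T Q μ ν γ f n z.1 z.2 :=
  (StronglyMeasurable.integral_kernel_prod_right' (κ := Kernel.prodMkLeft (Fin n → 𝒴) Q)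
    (measurable_channelError_integrand (T := T) (Q := Q) (μ := μ) (ν := ν) (γ := γ) hf
      n).stronglyMeasurable).measurable

theorem abs_filterSign_mul_le {f : 𝒳 → ℝ} {D : ℝ} (hD : ∀ x, |f x| ≤ D) (n : ℕ)
    (y : Fin (n + 1) → 𝒴) (x : 𝒳) :
    |filterSign T Q μ ν γ f n y * (f x - filterMean T Q ν γ f n y)| ≤ 2 * D := by
  rw [abs_mul, abs_filterSign, one_mul, two_mul]
  exact (abs_sub _ _).trans (add_le_add (hD _) (abs_filterMean_le hD n y))

theorem abs_channelError_le {f : 𝒳 → ℝ} {D : ℝ} (hD : ∀ x, |f x| ≤ D) (n : ℕ)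
    (y : Fin n → 𝒴) (x : 𝒳) : |channelError T Q μ ν γ f n y x| ≤ 2 * D :=
  abs_integral_le_of_abs_le _ fun _ => abs_filterSign_mul_le hD n _ x

/-- Averages of the signed error, weighted by a function of `Y₀, …, Yₙ₋₁`. -/
theorem integral_mul_channelError {f : 𝒳 → ℝ} (hf : Measurable f) {D : ℝ} (hD : ∀ x, |f x| ≤ D)
    (μ' : ProbabilityMeasure 𝒳) (n : ℕ) {g : (Fin n → 𝒴) → ℝ} (hg : Measurable g) {C : ℝ}
    (hC : ∀ y, |g y| ≤ C) :
    ∫ ω, g (obs n ω) * (filterSign T Q μ ν γ f n (obs (n + 1) ω) *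
        (f (ω n).1 - filterMean T Q ν γ f n (obs (n + 1) ω))) ∂(strategicMeasure T Q μ' γ) =
      ∫ ω, g (obs n ω) * ∫ x, channelError T Q μ ν γ f n (obs n ω) x
        ∂(condKernel T Q μ' γ n n (obs n ω)) ∂(strategicMeasure T Q μ' γ) := by
  have h := integral_obsPred_prod (T := T) (Q := Q) (μ := μ') (γ := γ) n
    (F := fun z => g z.1.1 * (filterSign T Q μ ν γ f n (Fin.snoc (α := fun _ => 𝒴) z.1.1 z.2) *
        (f z.1.2 - filterMean T Q ν γ f n (Fin.snoc (α := fun _ => 𝒴) z.1.1 z.2))))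
    ((hg.comp (measurable_fst.comp measurable_fst)).mul (measurable_channelError_integrand hf n))
    (C := C * (2 * D)) fun z => by
      rw [abs_mul]
      exact mul_le_mul (hC _) (abs_filterSign_mul_le hD n _ _) (abs_nonneg _)
        ((abs_nonneg _).trans (hC z.1.1))
  simp only [integral_const_mul] at h
  simp only [obs_succ_eq_snoc]
  exact h

/-- Under `ν` the signed error has conditional mean zero given `Y₀, …, Yₙ₋₁`. -/
theorem ae_integral_channelError_eq_zero {f : 𝒳 → ℝ} (hf : Measurable f) {D : ℝ}
    (hD : ∀ x, |f x| ≤ D) (n : ℕ) :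
    ∀ᵐ ω ∂(strategicMeasure T Q ν γ), ∫ x, channelError T Q μ ν γ f n (obs n ω) x
        ∂(condKernel T Q ν γ n n (obs n ω)) = 0 := by
  set G : (Fin n → 𝒴) → ℝ := fun y =>
    ∫ x, channelError T Q μ ν γ f n y x ∂(condKernel T Q ν γ n n y) with hG
  have hGm : Measurable G := (StronglyMeasurable.integral_kernel_prod_right'
    (measurable_channelError hf n).stronglyMeasurable).measurable
  have hGb (y) : |G y| ≤ 2 * D :=
    abs_integral_le_of_abs_le _ fun x => abs_channelError_le hD n y x
  have h1 := integral_mul_channelError (T := T) (Q := Q) (μ := μ) (ν := ν) (γ := γ) hf hD ν n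
    hGm hGb
  have hinit : Measurable fun y : Fin (n + 1) → 𝒴 => G (fun i => y i.castSucc) :=
    hGm.comp (measurable_pi_lambda _ fun _ => measurable_pi_apply _)
  have h2 := integral_mul_state_sub_eq_zero (T := T) (Q := Q) (μ := ν) (γ := γ) n (n + 1)
    (g := fun y => G (fun i => y i.castSucc) * filterSign T Q μ ν γ f n y)
    (hinit.mul (measurable_filterSign hf n)) (C := 2 * D) (fun y => by
      rw [abs_mul, abs_filterSign, mul_one]
      exact hGb _) hf hD
  -- the conditional mean `G` is orthogonal to itself
  have h3 : ∫ ω, G (obs n ω) * G (obs n ω) ∂(strategicMeasure T Q ν γ) = 0 := by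
    rw [← h2]
    refine h1.symm.trans (integral_congr_ae (ae_of_all _ fun ω => ?_))
    exact (mul_assoc _ _ _).symm
  have hi : Integrable (fun ω => G (obs n ω) * G (obs n ω)) (strategicMeasure T Q ν γ) :=
    Integrable.of_bound ((hGm.mul hGm).comp (measurable_obs n)).aestronglyMeasurable
      ((2 * D) * (2 * D)) (ae_of_all _ fun ω => by
        rw [norm_mul]
        exact mul_le_mul (hGb _) (hGb _) (norm_nonneg _) ((abs_nonneg _).trans (hGb (obs n ω))))
  filter_upwards [(integral_eq_zero_iff_of_nonneg (fun ω => mul_self_nonneg _) hi).1 h3] with ω hω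
  exact mul_self_eq_zero.1 hω

/-- The expected distance of the filter means is a difference of averages over the predictors. -/
theorem integral_abs_filterMean_sub (h : (μ : Measure 𝒳) ≪ ν) {f : 𝒳 → ℝ} (hf : Measurable f)
    {D : ℝ} (hD : ∀ x, |f x| ≤ D) (n : ℕ) :
    ∫ ω, |filterMean T Q μ γ f n (obs (n + 1) ω) - filterMean T Q ν γ f n (obs (n + 1) ω)|
        ∂(strategicMeasure T Q μ γ) =
      ∫ ω, (∫ x, channelError T Q μ ν γ f n (obs n ω) x ∂(condKernel T Q μ γ n n (obs n ω)) -
        ∫ x, channelError T Q μ ν γ f n (obs n ω) x ∂(condKernel T Q ν γ n n (obs n ω)))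
        ∂(strategicMeasure T Q μ γ) := by
  have h1 := integral_mul_channelError (T := T) (Q := Q) (μ := μ) (ν := ν) (γ := γ) hf hD μ n
    (g := fun _ => 1) measurable_const (C := 1) (fun _ => by simp)
  simp only [one_mul] at h1
  have h2 := integral_mul_state_sub_eq_zero (T := T) (Q := Q) (μ := μ) (γ := γ) n (n + 1)
    (measurable_filterSign (T := T) (Q := Q) (μ := μ) (ν := ν) (γ := γ) hf n) (C := 1)
    (fun y => (abs_filterSign _ _ _).le) hf hD
  have hsm : Measurable fun ω : ℕ → 𝒳 × 𝒴 => filterSign T Q μ ν γ f n (obs (n + 1) ω) :=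
    (measurable_filterSign hf n).comp (measurable_obs _)
  have hfm : Measurable fun ω : ℕ → 𝒳 × 𝒴 => f (ω n).1 := hf.comp (measurable_state n)
  have hint (μ' : ProbabilityMeasure 𝒳) : Integrable (fun ω : ℕ → 𝒳 × 𝒴 =>
      filterSign T Q μ ν γ f n (obs (n + 1) ω) * (f (ω n).1 -
        filterMean T Q μ' γ f n (obs (n + 1) ω))) (strategicMeasure T Q μ γ) := by
    refine Integrable.of_bound (hsm.mul (hfm.sub ((measurable_filterMean hf n).comp
      (measurable_obs _)))).aestronglyMeasurable (D + D) (ae_of_all _ fun ω => ?_)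
    rw [norm_mul, Real.norm_eq_abs, abs_filterSign, one_mul]
    exact (abs_sub _ _).trans (add_le_add (hD _) (abs_filterMean_le hD n _))
  have h3 : ∫ ω, |filterMean T Q μ γ f n (obs (n + 1) ω) - filterMean T Q ν γ f n (obs (n + 1) ω)|
      ∂(strategicMeasure T Q μ γ) =
      ∫ ω, filterSign T Q μ ν γ f n (obs (n + 1) ω) * (f (ω n).1 -
        filterMean T Q ν γ f n (obs (n + 1) ω)) ∂(strategicMeasure T Q μ γ) := by
    rw [← sub_zero (∫ ω, filterSign T Q μ ν γ f n (obs (n + 1) ω) * _ ∂_), ← h2]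
    refine Eq.trans (integral_congr_ae (ae_of_all _ fun ω => ?_)) (integral_sub (hint ν) (hint μ))
    simp only
    rw [← filterSign_mul, filterMean]
    ring
  rw [h3, h1]
  refine integral_congr_ae ?_
  filter_upwards [(strategicMeasure_absolutelyContinuous h).ae_le
    (ae_integral_channelError_eq_zero (T := T) (Q := Q) (μ := μ) (γ := γ) hf hD n)] with ω hω
  rw [hω, sub_zero]

end CondIntegrals

section WeakMerging

variable {𝒳 𝒴 𝒰 : Type*} [TopologicalSpace 𝒳] [PolishSpace 𝒳] [MeasurableSpace 𝒳] [BorelSpace 𝒳]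
  [Nonempty 𝒳] [MeasurableSpace 𝒴] [MeasurableSpace 𝒰]
  {T : Kernel (𝒳 × 𝒰) 𝒳} [IsMarkovKernel T] {Q : Kernel 𝒳 𝒴} [IsMarkovKernel Q]
  {μ ν : ProbabilityMeasure 𝒳} {γ : Policy 𝒴 𝒰}

/-- The averaged signed error oscillates no more than `f` and the channel do. -/
theorem abs_channelError_sub_le {f : 𝒳 → ℝ} (hf : Measurable f) {D : ℝ} (hD0 : 0 < D)
    (hD : ∀ x, |f x| ≤ D) {δ : ℝ} (hδ : 0 ≤ δ) {x z : 𝒳} (h1 : |f x - f z| ≤ δ)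
    (h2 : tvDist (Q x) (Q z) ≤ ENNReal.ofReal δ) (n : ℕ) (y : Fin n → 𝒴) :
    |channelError T Q μ ν γ f n y x - channelError T Q μ ν γ f n y z| ≤ (1 + 2 * D) * δ := by
  have hs : Measurable fun y' : 𝒴 => (Fin.snoc (α := fun _ => 𝒴) y y' : Fin (n + 1) → 𝒴) :=
    (measurable_snoc n).comp (measurable_const.prodMk measurable_id)
  set s : 𝒴 → ℝ := fun y' => filterSign T Q μ ν γ f n (Fin.snoc (α := fun _ => 𝒴) y y') with hsdef
  set k : 𝒴 → ℝ := fun y' => s y' * filterMean T Q ν γ f n (Fin.snoc (α := fun _ => 𝒴) y y')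
    with hkdef
  have hsm : Measurable s := (measurable_filterSign hf n).comp hs
  have hkm : Measurable k := hsm.mul ((measurable_filterMean hf n).comp hs)
  have hsb (y') : |s y'| ≤ 1 := (abs_filterSign _ _ _).le
  have hkb (y') : |k y'| ≤ D := by
    simp only [hkdef, hsdef, abs_mul, abs_filterSign, one_mul]
    exact abs_filterMean_le hD n _
  have hsi (x : 𝒳) : Integrable s (Q x) :=
    Integrable.of_bound hsm.aestronglyMeasurable 1 (ae_of_all _ hsb)
  have hki (x : 𝒳) : Integrable k (Q x) :=
    Integrable.of_bound hkm.aestronglyMeasurable D (ae_of_all _ hkb)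
  have e (x : 𝒳) :
      channelError T Q μ ν γ f n y x = f x * ∫ y', s y' ∂(Q x) - ∫ y', k y' ∂(Q x) := by
    rw [← integral_const_mul, ← integral_sub ((hsi x).const_mul _) (hki x)]
    refine integral_congr_ae (ae_of_all _ fun y' => ?_)
    simp only [hkdef, hsdef]
    ring
  have b1 := abs_integral_sub_le_mul_of_tvDist_le (Q x) (Q z) hsm one_pos hδ hsb h2
  have b2 := abs_integral_sub_le_mul_of_tvDist_le (Q x) (Q z) hkm hD0 hδ hkb h2
  have b3 : |∫ y', s y' ∂(Q x)| ≤ 1 := abs_integral_le_of_abs_le _ hsb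
  have b4 : |(f x - f z) * ∫ y', s y' ∂(Q x)| ≤ δ * 1 := by
    rw [abs_mul]
    exact mul_le_mul h1 b3 (abs_nonneg _) hδ
  have b5 : |f z * (∫ y', s y' ∂(Q x) - ∫ y', s y' ∂(Q z))| ≤ D * (1 * δ) := by
    rw [abs_mul]
    exact mul_le_mul (hD z) b1 (abs_nonneg _) hD0.le
  rw [e, e]
  rw [abs_le] at *
  constructor <;> nlinarith

theorem measurable_abs_integral_condKernel_sub {f : 𝒳 → ℝ} (hf : Measurable f) (n m : ℕ) :
    Measurable fun y => ENNReal.ofReal |∫ x, f x ∂(condKernel T Q μ γ n m y) -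
      ∫ x, f x ∂(condKernel T Q ν γ n m y)| := by
  have h (μ : ProbabilityMeasure 𝒳) : Measurable fun y => ∫ x, f x ∂(condKernel T Q μ γ n m y) :=
    (hf.stronglyMeasurable.integral_kernel (κ := condKernel T Q μ γ n m)).measurable
  exact ((h μ).sub (h ν)).abs.ennreal_ofReal

/-- If the channel is continuous in total variation, weak merging of the predictors almost surely
implies weak merging of the filters in expectation. -/
theorem WeakMergeAS.weakMergeExp (h : (μ : Measure 𝒳) ≪ ν) (hQ : ChannelTVContinuous Q)
    (hw : WeakMergeAS (measurementLaw T Q μ γ) (predictorAt T Q μ γ) (predictorAt T Q ν γ)) :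
    WeakMergeExp (measurementLaw T Q μ γ) (filterAt T Q μ γ) (filterAt T Q ν γ) := by
  intro f
  have hf : Measurable f := f.continuous.measurable
  set D : ℝ := ‖f‖ + 1 with hDdef
  have hD0 : 0 < D := by positivity
  have hD (x : 𝒳) : |f x| ≤ D := (f.norm_coe_le_norm x).trans (by simp [hDdef])
  -- the distance of the filters for a given mesh of the partition of unity
  have key (δ : ℝ) (hδ : 0 < δ) : ∃ S : ℕ → ℝ≥0∞, Tendsto S atTop (𝓝 0) ∧ ∀ n,
      ∫⁻ y, ENNReal.ofReal |∫ x, f x ∂(filterAt T Q μ γ n y) - ∫ x, f x ∂(filterAt T Q ν γ n y)|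
        ∂(measurementLaw T Q μ γ) ≤
      ENNReal.ofReal (2 * ((1 + 2 * D) * δ)) + ENNReal.ofReal (2 * D) * S n := by
    obtain ⟨w, z, hwz⟩ := exists_partitionOfUnity hQ f hδ
    let s : (n : ℕ) → (Fin n → 𝒴) → ℝ≥0∞ := fun n y => ∑' j, ENNReal.ofReal
      |∫ x, w j x ∂(condKernel T Q μ γ n n y) - ∫ x, w j x ∂(condKernel T Q ν γ n n y)|
    have hsm (n : ℕ) : Measurable (s n) := Measurable.tsum fun j =>
      measurable_abs_integral_condKernel_sub (w j).continuous.measurable n n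
    refine ⟨fun n => ∫⁻ y, s n (history n y) ∂(measurementLaw T Q μ γ), ?_, fun n => ?_⟩
    · have := tendsto_lintegral_of_dominated_convergence (μ := measurementLaw T Q μ γ)
        (F := fun n y => s n (history n y)) (f := fun _ => 0) (fun _ => 2)
        (fun n => (hsm n).comp (measurable_history n))
        (fun n => ae_of_all _ fun y => tsum_abs_integral_sub_partitionOfUnity_le w _ _)
        (by simp) (by
          filter_upwards [hw] with y hy
          exact tendsto_tsum_abs_integral_sub_partitionOfUnity w
            (p := fun n => condState T Q μ γ n n y) (r := fun n => condState T Q ν γ n n y) hy)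
      simpa using this
    · simp only [lintegral_measurementLaw_eq_obs (hsm n)]
      have e := lintegral_measurementLaw_eq_obs (T := T) (Q := Q) (μ := μ) (γ := γ)
        (measurable_abs_integral_condKernel_sub (T := T) (Q := Q) (μ := μ) (ν := ν) (γ := γ)
          hf n (n + 1))
      refine e.trans_le ?_
      have hi : Integrable (fun ω : ℕ → 𝒳 × 𝒴 => |filterMean T Q μ γ f n (obs (n + 1) ω) -
          filterMean T Q ν γ f n (obs (n + 1) ω)|) (strategicMeasure T Q μ γ) :=
        Integrable.of_bound (((measurable_filterMean hf n).sub
          (measurable_filterMean hf n)).abs.comp (measurable_obs _)).aestronglyMeasurable (D + D)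
          (ae_of_all _ fun ω => by
            rw [Real.norm_eq_abs, abs_abs]
            exact (abs_sub _ _).trans
              (add_le_add (abs_filterMean_le hD n _) (abs_filterMean_le hD n _)))
      have e2 := ofReal_integral_eq_lintegral_ofReal hi (ae_of_all _ fun _ => abs_nonneg _)
      rw [integral_abs_filterMean_sub h hf hD n] at e2
      refine e2.symm.trans_le ?_
      calc ENNReal.ofReal (∫ ω, (∫ x, channelError T Q μ ν γ f n (obs n ω) x
                ∂(condKernel T Q μ γ n n (obs n ω)) -
              ∫ x, channelError T Q μ ν γ f n (obs n ω) x ∂(condKernel T Q ν γ n n (obs n ω)))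
              ∂(strategicMeasure T Q μ γ))
          ≤ ∫⁻ ω, ENNReal.ofReal |∫ x, channelError T Q μ ν γ f n (obs n ω) x
                ∂(condKernel T Q μ γ n n (obs n ω)) -
              ∫ x, channelError T Q μ ν γ f n (obs n ω) x ∂(condKernel T Q ν γ n n (obs n ω))|
              ∂(strategicMeasure T Q μ γ) := by
            refine (ENNReal.ofReal_le_ofReal (le_abs_self _)).trans ?_
            simp only [← Real.enorm_eq_ofReal_abs]
            exact enorm_integral_le_lintegral_enorm _
        _ ≤ ∫⁻ ω, (ENNReal.ofReal (2 * ((1 + 2 * D) * δ)) + ENNReal.ofReal (2 * D) * s n (obs n ω))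
              ∂(strategicMeasure T Q μ γ) := by
            refine lintegral_mono fun ω => ?_
            have hb := abs_integral_sub_le_of_partitionOfUnity w
              (condKernel T Q μ γ n n (obs n ω)) (condKernel T Q ν γ n n (obs n ω))
              ((measurable_channelError (T := T) (Q := Q) (μ := μ) (ν := ν) (γ := γ) hf n).comp
                (measurable_const (a := obs n ω).prodMk measurable_id))
              (abs_channelError_le hD n (obs n ω)) (z := z) (δ := (1 + 2 * D) * δ)
              fun j x hx => abs_channelError_sub_le hf hD0 hD hδ.le (hwz j x hx).1
                (hwz j x hx).2 n (obs n ω)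
            refine (ENNReal.ofReal_le_ofReal hb).trans ?_
            rw [ENNReal.ofReal_add (by positivity)
              (mul_nonneg (by positivity) (tsum_nonneg fun _ => abs_nonneg _)),
              ENNReal.ofReal_mul (p := 2 * D) (by positivity),
              ENNReal.ofReal_tsum_of_nonneg (fun _ => abs_nonneg _)
                (summable_abs_integral_sub_partitionOfUnity w _ _)]
        _ = _ := by
            rw [lintegral_add_left measurable_const,
              lintegral_const_mul' _ _ ENNReal.ofReal_ne_top]
            simp
  rw [ENNReal.tendsto_atTop_zero]
  intro ε hε
  by_cases hε1 : ε = ∞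
  · exact ⟨0, fun _ _ => by simp [hε1]⟩
  have hε0 : 0 < ε.toReal := ENNReal.toReal_pos hε.ne' hε1
  -- the mesh for which the first term is `ε / 2`
  obtain ⟨S, hS, hle⟩ := key (ε.toReal / (4 * (1 + 2 * D))) (by positivity)
  have hS' := ENNReal.Tendsto.const_mul (a := ENNReal.ofReal (2 * D)) hS
    (Or.inr ENNReal.ofReal_ne_top)
  rw [mul_zero] at hS'
  obtain ⟨N, hN⟩ := ENNReal.tendsto_atTop_zero.1 hS' (ENNReal.ofReal (ε.toReal / 2))
    (ENNReal.ofReal_pos.2 (by positivity))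
  refine ⟨N, fun n hn => (hle n).trans ((add_le_add_right (hN n hn) _).trans ?_)⟩
  rw [← ENNReal.ofReal_add (by positivity) (by positivity)]
  refine ENNReal.ofReal_le_of_le_toReal (le_of_eq ?_)
  field_simp
  ring

end WeakMerging

end POMDP

end

theorem mainTheorem2
    {𝒳 𝒴 𝒰 : Type*}
    [TopologicalSpace 𝒳] [PolishSpace 𝒳] [SigmaCompactSpace 𝒳] [MeasurableSpace 𝒳] [BorelSpace 𝒳]
    [Nonempty 𝒳]
    [TopologicalSpace 𝒴] [PolishSpace 𝒴] [MeasurableSpace 𝒴] [BorelSpace 𝒴]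
    [TopologicalSpace 𝒰] [PolishSpace 𝒰] [MeasurableSpace 𝒰] [BorelSpace 𝒰]
    (T : Kernel (𝒳 × 𝒰) 𝒳) [IsMarkovKernel T] (Q : Kernel 𝒳 𝒴) [IsMarkovKernel Q]
    (μ : ProbabilityMeasure 𝒳) :
    -- (i)
    (POMDP.ChannelTVContinuous Q → POMDP.PredictorStableWeakAS T Q μ →
      POMDP.FilterStableWeakExp T Q μ) ∧
    -- (ii)
    (POMDP.FilterStableTVExp T Q μ ↔ POMDP.PredictorStableTVExp T Q μ) ∧
    -- (iii)
    (POMDP.FilterStableTVExp T Q μ ↔ POMDP.FilterStableTVAS T Q μ) ∧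
    -- (iv), for one incorrect prior
    (∀ ν : ProbabilityMeasure 𝒳, (μ : Measure 𝒳) ≪ ν → POMDP.FiniteEntropies T Q μ ν →
      ((∀ γ : POMDP.Policy 𝒴 𝒰, POMDP.EntropyMerge (POMDP.measurementLaw T Q μ γ)
          (POMDP.filterAt T Q μ γ) (POMDP.filterAt T Q ν γ)) ↔
        (∀ γ : POMDP.Policy 𝒴 𝒰, POMDP.TVMergeExp (POMDP.measurementLaw T Q μ γ)
          (POMDP.filterAt T Q μ γ) (POMDP.filterAt T Q ν γ)))) ∧
    -- (iv), for all incorrect priors together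
    ((∀ ν : ProbabilityMeasure 𝒳, (μ : Measure 𝒳) ≪ ν → POMDP.FiniteEntropies T Q μ ν) →
      (POMDP.FilterStableEntropy T Q μ ↔ POMDP.FilterStableTVExp T Q μ)) := by
  have entropy (ν : ProbabilityMeasure 𝒳) (h : (μ : Measure 𝒳) ≪ ν)
      (hfin : POMDP.FiniteEntropies T Q μ ν) (γ : POMDP.Policy 𝒴 𝒰) :
      POMDP.EntropyMerge (POMDP.measurementLaw T Q μ γ)
          (POMDP.filterAt T Q μ γ) (POMDP.filterAt T Q ν γ) ↔
        POMDP.TVMergeExp (POMDP.measurementLaw T Q μ γ)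
          (POMDP.filterAt T Q μ γ) (POMDP.filterAt T Q ν γ) :=
    ⟨fun hE => hE.tvMergeExp, fun hE => hE.entropyMerge h (hfin γ).1⟩
  refine ⟨fun hQ hw γ ν h => (hw γ ν h).weakMergeExp h hQ, ?_, ?_, ?_, ?_⟩
  · exact forall₃_congr fun γ ν h => POMDP.tvMergeExp_filter_iff_predictor h
  · exact forall₃_congr fun γ ν h => ⟨fun hE => hE.tvMergeAS h, fun hE => hE.tvMergeExp h⟩
  · exact fun ν h hfin => forall_congr' fun γ => entropy ν h hfin γ
  · exact fun hfin => forall₃_congr fun γ ν h => entropy ν h (hfin ν h) γ
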